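/- Let $\zeta$ be the Riemann zeta function and let $\vartheta:\mathbf{R}\to\mathbf{R}$ be the Riemann--Siegel theta function, i.e. the continuous (in fact real analytic) function with $\vartheta(0)=0$ and $$\Gamma\left(\tfrac14+\tfrac{it}{2}\right)=\left|\Gamma\left(\tfrac14+\tfrac{it}{2}\right)\right|e^{i\left(\vartheta(t)+\frac t2\log\pi\right)}\qquad(t\in\mathbf{R}).$$ There is a unique real analytic function $\kappa:\mathbf{R}\to\mathbf{R}$ with $\kappa(0)=-\tfrac12$ and $$e^{2\pi i\kappa(t)}=1+2\vartheta'(t)\,\frac{\zeta(\frac12+it)}{\zeta'(\frac12+it)}\qquad(t\in\mathbf{R}),$$ where the quotient $\zeta(\frac12+it)/\zeta'(\frac12+it)$ is understood to be $0$ at the points where $\zeta'(\frac12+it)=0$ (at such points also $\zeta(\frac12+it)=0$, and $0$ is the value of the analytic continuation of the quotient). Let $0<\xi_1<\xi_2<\cdots$ be the infinite sequence of all positive real numbers $t$ with $\zeta(\frac12+it)=0$, in increasing order and counted without multiplicities. Then, without any unproved hypothesis, $\kappa(\xi_n)=n$ for every natural number $n\ge1$. -/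

import Mathlib

/-- The Riemann–Siegel theta function
`ϑ(t) = -(t/2) log π + (1/2) ∫₀ᵗ Re ψ(1/4 + ix/2) dx`, where `ψ = Γ'/Γ`.
It is the continuous determination, with `ϑ(0) = 0`, of `arg Γ(1/4 + it/2) - (t/2) log π`;
see `riemannSiegelTheta_spec`. -/
noncomputable def riemannSiegelTheta (t : ℝ) : ℝ :=
  -(t / 2) * Real.log Real.pi
    + (1 / 2) * ∫ x in (0 : ℝ)..t, (Complex.digamma (1 / 4 + Complex.I * ((x : ℂ) / 2))).re

theorem quarter_line_re_pos (x : ℝ) :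
    0 < (1 / 4 + Complex.I * ((x : ℂ) / 2) : ℂ).re := by
  have h : (1 / 4 + Complex.I * ((x : ℂ) / 2) : ℂ) = ((1 / 4 : ℝ) : ℂ) + Complex.I * ((x / 2 : ℝ) : ℂ) := by
    push_cast; ring
  rw [h]
  simp only [Complex.add_re, Complex.mul_re, Complex.ofReal_re, Complex.ofReal_im, Complex.I_re,
    Complex.I_im]
  norm_num

theorem continuous_digamma_quarter_line :
    Continuous fun x : ℝ => Complex.digamma (1 / 4 + Complex.I * ((x : ℂ) / 2)) := by
  have hopen : IsOpen {s : ℂ | 0 < s.re} := isOpen_lt continuous_const Complex.continuous_re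
  have hd : DifferentiableOn ℂ Complex.Gamma {s : ℂ | 0 < s.re} := fun s hs =>
    (Complex.differentiableAt_Gamma s fun m hm => by
      have h : (0 : ℝ) < s.re := hs
      rw [hm] at h
      simp only [Complex.neg_re, Complex.natCast_re] at h
      have := Nat.cast_nonneg (α := ℝ) m
      linarith).differentiableWithinAt
  have hc : ContinuousOn Complex.digamma {s : ℂ | 0 < s.re} := by
    rw [Complex.digamma_def]
    exact (hd.deriv hopen).continuousOn.div hd.continuousOn
      fun s hs => Complex.Gamma_ne_zero_of_re_pos hs
  exact hc.comp_continuous (by fun_prop) quarter_line_re_pos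

/-- `Γ(1/4 + it/2) = |Γ(1/4 + it/2)| e^{i(ϑ(t) + (t/2) log π)}`. Together with continuity and
`ϑ(0) = 0` this determines `ϑ`. -/
theorem riemannSiegelTheta_spec (t : ℝ) :
    Complex.Gamma (1 / 4 + Complex.I * ((t : ℂ) / 2))
      = (‖Complex.Gamma (1 / 4 + Complex.I * ((t : ℂ) / 2))‖ : ℂ)
        * Complex.exp (Complex.I *
            ((riemannSiegelTheta t + t / 2 * Real.log Real.pi : ℝ) : ℂ)) := by
  set ψ : ℝ → ℂ := fun x => Complex.digamma (1 / 4 + Complex.I * ((x : ℂ) / 2)) with hψ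
  have hψc : Continuous ψ := continuous_digamma_quarter_line
  set G : ℝ → ℂ := fun x => Complex.Gamma (1 / 4 + Complex.I * ((x : ℂ) / 2)) with hG
  set F : ℝ → ℂ := fun x => ∫ y in (0 : ℝ)..x, ψ y with hF
  have hFd : ∀ x, HasDerivAt F (ψ x) x := fun x => hψc.integral_hasStrictDerivAt 0 x |>.hasDerivAt
  have hGne : ∀ x, G x ≠ 0 := fun x => Complex.Gamma_ne_zero_of_re_pos (quarter_line_re_pos x)
  have hGd : ∀ x, HasDerivAt G (Complex.I / 2 * ψ x * G x) x := by
    intro x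
    have h1 : DifferentiableAt ℂ Complex.Gamma (1 / 4 + Complex.I * ((x : ℂ) / 2)) := by
      refine Complex.differentiableAt_Gamma _ fun m hm => ?_
      have h := quarter_line_re_pos x
      rw [hm] at h
      simp only [Complex.neg_re, Complex.natCast_re] at h
      have := Nat.cast_nonneg (α := ℝ) m
      linarith
    have h2 : HasDerivAt (fun y : ℝ => (1 / 4 + Complex.I * ((y : ℂ) / 2) : ℂ))
        (Complex.I * (1 / 2)) x :=
      (((hasDerivAt_id x).ofReal_comp.div_const 2).const_mul Complex.I).const_add (1 / 4 : ℂ)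
        |>.congr_deriv (by simp)
    refine (h1.hasDerivAt.comp x h2).congr_deriv ?_
    have : deriv Complex.Gamma (1 / 4 + Complex.I * ((x : ℂ) / 2)) = ψ x * G x := by
      simp only [hψ, hG, Complex.digamma_def, logDeriv_apply]
      rw [div_mul_cancel₀ _ (hGne x)]
    rw [this]; ring
  have hconst : ∀ x, G x * Complex.exp (-(Complex.I / 2 * F x)) = G 0 := by
    have hd : ∀ x, HasDerivAt (fun x => G x * Complex.exp (-(Complex.I / 2 * F x))) 0 x := fun x =>
      ((hGd x).mul (((hFd x).const_mul (Complex.I / 2)).neg.cexp)).congr_deriv (by ring)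
    intro x
    have := is_const_of_deriv_eq_zero (fun y => (hd y).differentiableAt)
      (fun y => (hd y).deriv) x 0
    simpa [hF] using this
  have hG0 : ∃ r : ℝ, 0 < r ∧ G 0 = (r : ℂ) := by
    refine ⟨Real.Gamma (1 / 4), Real.Gamma_pos_of_pos (by norm_num), ?_⟩
    rw [← Complex.Gamma_ofReal]
    simp [hG]
  obtain ⟨r, hr, hr0⟩ := hG0
  have hFre : (F t).re = ∫ x in (0 : ℝ)..t, (ψ x).re := by
    have := (Complex.reCLM.intervalIntegral_comp_comm (hψc.intervalIntegrable (μ := MeasureTheory.volume) 0 t))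
    simpa [hF] using this.symm
  have hth : (riemannSiegelTheta t + t / 2 * Real.log Real.pi : ℝ) = (F t).re / 2 := by
    rw [hFre]; simp only [riemannSiegelTheta, hψ]; ring
  have hGt : G t = ((r * Real.exp (-(F t).im / 2) : ℝ) : ℂ)
      * Complex.exp (Complex.I * (((F t).re / 2 : ℝ) : ℂ)) := by
    have h1 : G t = G 0 * Complex.exp (Complex.I / 2 * F t) := by
      rw [← hconst t, mul_assoc, ← Complex.exp_add]; simp
    rw [h1, hr0]
    push_cast
    rw [mul_assoc, ← Complex.exp_add]
    congr 2
    conv_lhs => rw [← Complex.re_add_im (F t)]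
    linear_combination ((F t).im : ℂ) / 2 * Complex.I_mul_I
  have hnorm : ‖G t‖ = r * Real.exp (-(F t).im / 2) := by
    rw [hGt, norm_mul, Complex.norm_real, mul_comm Complex.I, Complex.norm_exp_ofReal_mul_I,
      mul_one, Real.norm_of_nonneg (by positivity)]
  change G t = (‖G t‖ : ℂ) * _
  rw [hth, hnorm]
  exact hGt

/-- `κ : ℝ → ℝ` is real analytic, `κ(0) = -1/2`, and
`e^{2πiκ(t)} = 1 + 2 ϑ'(t) ζ(1/2 + it) / ζ'(1/2 + it)` for all real `t`.
Where `ζ'(1/2 + it) = 0`, also `ζ(1/2 + it) = 0`, and the quotient is read as `0`, which is both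
the value of its analytic continuation there and Lean's value of `0 / 0`. -/
structure IsKappa (κ : ℝ → ℝ) : Prop where
  analytic : AnalyticOnNhd ℝ κ Set.univ
  exp_eq : ∀ t : ℝ,
    Complex.exp (2 * Real.pi * Complex.I * κ t)
      = 1 + 2 * ((deriv riemannSiegelTheta t : ℝ) : ℂ)
          * (riemannZeta (1 / 2 + Complex.I * t) / deriv riemannZeta (1 / 2 + Complex.I * t))
  map_zero : κ 0 = -1 / 2

/-- For `n ≥ 1`, the `n`-th positive real `t` with `ζ(1/2 + it) = 0`, in increasing order and
without multiplicities: each term is the least such `t` exceeding the preceding term, starting from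
the auxiliary value `0` at index `0`. (If there were no further such `t`, the infimum of the empty
set would be `0`, where `ζ(1/2) ≠ 0`.) -/
noncomputable def criticalOrdinate : ℕ → ℝ
  | 0 => 0
  | n + 1 => sInf {t : ℝ | criticalOrdinate n < t ∧ riemannZeta (1 / 2 + Complex.I * t) = 0}

/-! Let Λ be the completed zeta function and R(t) = Λ(1/2 + it), which is real and even. Let ϑ' + ih
be the logarithmic derivative of `Gammaℝ` at 1/2 + it. Differentiating Λ = Gammaℝ · ζ gives Gammaℝ ·
ζ' = -(x + iy) with x = ϑ'R and y = R' + hR (`Gammaℝ_mul_deriv_riemannZeta`). Hence u = 1 + 2ϑ'ζ/ζ'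
equals (-x + iy)/(x + iy) wherever ζ' ≠ 0. So u is unimodular, and it is analytic because ζ/ζ' is
analytic even at zeros of ζ; this yields one and only one lift κ. Moreover κ is an integer exactly
where u = 1, that is, where ϑ' = 0 or R = 0 (`kappaPhase_eq_one_iff`).

The function ϑ' is even and strictly increasing on [0, ∞), with a single positive zero t₀ close to
2π. On [0, t₀] one has R < 0, and y(t₀) < 0. Starting from κ(0) = -1/2, κ stays in (-1, 0) before
t₀. Near t₀ the sign of sin 2πκ = 2xy/(x² + y²) is that of ϑ', so κ(t₀) = 0 and κ is positive just
after t₀ (`IsKappa.turning_point`). Beyond t₀, ϑ' > 0 and κ is an integer only at zeros of R. At a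
zero of order k, κ' = ϑ'/(πk) > 0, so every integer value is crossed upwards and consecutive zeros
carry consecutive integers (`IsKappa.next_zero`).

Two inputs need analysis. That the zeros never stop is Hardy's theorem
(`exists_completedZetaLine_zero_gt`), proved by comparing the behaviour of the theta function at two
cusps. The inequalities at t₀ (`exists_turning_point`) come from telescoping bounds for the digamma
function and from Riemann's integral for R, estimated with explicit majorants. The inequality y(t₀)
< 0 also shows that ζ' has no zero on the critical line except at zeros of ζ. -/

open Complex Set Filter Topology MeasureTheory

/-! ### Mellin transforms of the theta function along rays. -/

/-- Euler's integral with a complex rate. -/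
theorem integral_cpow_mul_cexp_neg_mul {a r : ℂ} (ha : 0 < a.re) (hr : 0 < r.re) :
    ∫ t : ℝ in Ioi 0, (t : ℂ) ^ (a - 1) * cexp (-(r * t)) = r ^ (-a) * Complex.Gamma a := by
  set F : ℂ → ℝ → ℂ := fun r t => (t : ℂ) ^ (a - 1) * cexp (-(r * t)) with hF
  have hmeas : ∀ b : ℂ, ∀ r : ℂ,
      AEStronglyMeasurable (fun t : ℝ => (t : ℂ) ^ (b - 1) * cexp (-(r * t)))
        (volume.restrict (Ioi 0)) := by
    intro b r
    refine ContinuousOn.aestronglyMeasurable ?_ measurableSet_Ioi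
    refine ContinuousOn.mul (fun t ht => ?_) (by fun_prop)
    exact (continuousAt_ofReal_cpow_const _ _ (Or.inr (ne_of_gt ht))).continuousWithinAt
  have hint : ∀ b : ℝ, 0 < b → ∀ ε : ℝ, 0 < ε →
      IntegrableOn (fun t : ℝ => t ^ (b - 1) * Real.exp (-(ε * t))) (Ioi 0) := by
    intro b hb ε hε
    have := integrableOn_rpow_mul_exp_neg_mul_rpow (s := b - 1) (p := 1) (by linarith) one_pos hε
    simpa using this
  have hnorm : ∀ b r : ℂ, ∀ t ∈ Ioi (0 : ℝ),
      ‖(t : ℂ) ^ (b - 1) * cexp (-(r * t))‖ = t ^ (b.re - 1) * Real.exp (-(r.re * t)) := by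
    intro b r t ht
    rw [norm_mul, norm_cpow_eq_rpow_re_of_pos ht, Complex.norm_exp]
    simp
  have hdiff : DifferentiableOn ℂ (fun r => ∫ t : ℝ in Ioi 0, F r t) {r | 0 < r.re} := by
    intro r₀ hr₀
    have hr₀' : 0 < r₀.re := hr₀
    have hs : {r : ℂ | r₀.re / 2 < r.re} ∈ 𝓝 r₀ :=
      (isOpen_lt continuous_const Complex.continuous_re).mem_nhds (by simp; linarith)
    have key := hasDerivAt_integral_of_dominated_loc_of_deriv_le
      (μ := volume.restrict (Ioi (0 : ℝ))) (F := F)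
      (F' := fun r t => -((t : ℂ) ^ (a + 1 - 1) * cexp (-(r * t)))) (x₀ := r₀)
      (bound := fun t => t ^ ((a + 1).re - 1) * Real.exp (-(r₀.re / 2 * t))) hs
      (Eventually.of_forall fun r => hmeas a r) ?_ (hmeas (a + 1) r₀).neg ?_ ?_ ?_
    · exact key.2.differentiableAt.differentiableWithinAt
    · refine (hint a.re ha r₀.re hr₀').mono' (hmeas a r₀) ?_
      filter_upwards [ae_restrict_mem measurableSet_Ioi] with t ht
      exact (hnorm a r₀ t ht).le
    · filter_upwards [ae_restrict_mem measurableSet_Ioi] with t ht r hr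
      have ht' : (0 : ℝ) < t := ht
      have hr' : r₀.re / 2 < r.re := hr
      rw [norm_neg, hnorm (a + 1) r t ht]
      gcongr
    · exact hint _ (by simp; linarith) _ (by linarith)
    · filter_upwards [ae_restrict_mem measurableSet_Ioi] with t ht r _
      have ht' : (t : ℂ) ≠ 0 := ofReal_ne_zero.2 (ne_of_gt ht)
      have h1 : HasDerivAt (fun r : ℂ => cexp (-(r * t))) (cexp (-(r * t)) * (-(1 * t))) r :=
        (((hasDerivAt_id r).mul_const (t : ℂ)).neg).cexp
      refine (h1.const_mul ((t : ℂ) ^ (a - 1))).congr_deriv ?_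
      have : (t : ℂ) ^ (a + 1 - 1) = (t : ℂ) ^ (a - 1) * t := by
        rw [show a + 1 - 1 = (a - 1) + 1 by ring, cpow_add _ _ ht', cpow_one]
      rw [this]; ring
  have hopen : IsOpen {r : ℂ | 0 < r.re} := isOpen_lt continuous_const Complex.continuous_re
  have hconn : IsPreconnected {r : ℂ | 0 < r.re} := (convex_halfSpace_re_gt 0).isPreconnected
  have hR : DifferentiableOn ℂ (fun r : ℂ => r ^ (-a) * Complex.Gamma a) {r | 0 < r.re} := by
    intro r hr
    exact (((differentiableAt_id).cpow_const (Or.inl hr)).mul_const _).differentiableWithinAt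
  -- Both sides are analytic in the rate `r` on the right half-plane, and they agree at the real
  -- points 1 + 1/(n+1), which accumulate at 1.
  have heq := (hdiff.analyticOnNhd hopen).eqOn_of_preconnected_of_frequently_eq
    (hR.analyticOnNhd hopen) hconn (z₀ := 1) (by simp) ?_
  · exact heq hr
  · have hlim : Tendsto (fun n : ℕ => ((1 + 1 / ((n : ℝ) + 1) : ℝ) : ℂ)) atTop (𝓝[≠] 1) := by
      refine tendsto_nhdsWithin_iff.2 ⟨?_, Eventually.of_forall fun n => ?_⟩
      · have := (tendsto_one_div_add_atTop_nhds_zero_nat (𝕜 := ℝ)).const_add 1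
        rw [add_zero] at this
        exact (continuous_ofReal.tendsto' 1 1 (by simp)).comp this
      · have : (0 : ℝ) < 1 / ((n : ℝ) + 1) := by positivity
        simp only [mem_compl_iff, mem_singleton_iff]
        rw [← ofReal_one, ofReal_inj]; linarith
    refine hlim.frequently (Frequently.of_forall fun n => ?_)
    set q : ℝ := 1 + 1 / ((n : ℝ) + 1) with hq
    have hq0 : 0 < q := by positivity
    have := Complex.integral_cpow_mul_exp_neg_mul_Ioi ha hq0
    simp only [hF]
    rw [this, one_div, cpow_neg, inv_cpow _ _ (by rw [arg_ofReal_of_nonneg hq0.le]; exact Real.pi_pos.ne)]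

theorem ofReal_mul_cpow {x : ℝ} (hx : 0 < x) {z : ℂ} (hz : z ≠ 0) (w : ℂ) :
    ((x : ℂ) * z) ^ w = (x : ℂ) ^ w * z ^ w := by
  have hx0 : (x : ℂ) ≠ 0 := ofReal_ne_zero.2 hx.ne'
  rw [cpow_def_of_ne_zero (mul_ne_zero hx0 hz), cpow_def_of_ne_zero hx0, cpow_def_of_ne_zero hz,
    log_ofReal_mul hx hz, ← Complex.exp_add, ofReal_log hx.le, add_mul]

/-- The theta function on the ray through `τ`. -/
noncomputable def thetaRay (τ : ℂ) (x : ℝ) : ℂ := jacobiTheta (I * (x * τ))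

theorem I_mul_ray_im (τ : ℂ) (x : ℝ) : (I * (x * τ)).im = x * τ.re := by simp

theorem jacobiTheta_I_mul_inv {z : ℂ} (hz : 0 < z.re) :
    jacobiTheta (I * z⁻¹) = z ^ (1 / 2 : ℂ) * jacobiTheta (I * z) := by
  have hz0 : z ≠ 0 := by rintro rfl; simp at hz
  have h := jacobiTheta₂_functional_equation 0 (I * z)
  have h1 : -I * (I * z) = z := by rw [← mul_assoc, neg_mul, I_mul_I]; ring
  have h2 : -1 / (I * z) = I * z⁻¹ := by
    field_simp; rw [I_sq]
  have h3 : z ^ (1 / 2 : ℂ) ≠ 0 := by rw [Ne, cpow_eq_zero_iff]; tauto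
  rw [jacobiTheta_eq_jacobiTheta₂, jacobiTheta_eq_jacobiTheta₂, h, h1, h2]
  simp only [zero_div, ne_eq, OfNat.ofNat_ne_zero, not_false_eq_true, zero_pow, mul_zero, exp_zero,
    mul_one]
  field_simp

theorem continuousOn_thetaRay {τ : ℂ} (hτ : 0 < τ.re) : ContinuousOn (thetaRay τ) (Ioi 0) := by
  intro x hx
  refine ContinuousAt.continuousWithinAt ?_
  refine ContinuousAt.comp (g := jacobiTheta) (continuousAt_jacobiTheta ?_) (by fun_prop)
  rw [I_mul_ray_im]; exact mul_pos hx hτ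

theorem thetaRay_isBigO {τ : ℂ} (hτ : 0 < τ.re) (r : ℝ) :
    (fun x => thetaRay τ x - 1) =O[atTop] fun x : ℝ => x ^ r := by
  have h1 : Tendsto (fun x : ℝ => I * (x * τ)) atTop (comap im atTop) := by
    rw [tendsto_comap_iff]
    have : (im ∘ fun x : ℝ => I * (x * τ)) = fun x : ℝ => x * τ.re := by
      ext x; simp
    rw [this]
    exact tendsto_id.atTop_mul_const hτ
  have h2 := isBigO_at_im_infty_jacobiTheta_sub_one.comp_tendsto h1
  have h3 : ((fun τ : ℂ => Real.exp (-Real.pi * τ.im)) ∘ fun x : ℝ => I * (x * τ))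
      = fun x : ℝ => Real.exp (-(Real.pi * τ.re) * x) := by
    ext x; simp only [Function.comp]; rw [I_mul_ray_im]; ring_nf
  rw [h3] at h2
  exact h2.trans (isLittleO_exp_neg_mul_rpow_atTop (by positivity) r).isBigO

theorem inv_re_pos {τ : ℂ} (hτ : 0 < τ.re) : 0 < (τ⁻¹).re := by
  have : τ ≠ 0 := by rintro rfl; simp at hτ
  rw [inv_re]; exact div_pos hτ (normSq_pos.2 this)

/-- The theta function along a ray of the right half-plane, as a functional-equation pair. -/
noncomputable def thetaRayPair (τ : ℂ) (hτ : 0 < τ.re) : WeakFEPair ℂ where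
  f := thetaRay τ
  g := thetaRay τ⁻¹
  k := 1 / 2
  ε := τ ^ (-(1 / 2) : ℂ)
  f₀ := 1
  g₀ := 1
  hf_int := (continuousOn_thetaRay hτ).locallyIntegrableOn measurableSet_Ioi
  hg_int := (continuousOn_thetaRay (inv_re_pos hτ)).locallyIntegrableOn measurableSet_Ioi
  hk := one_half_pos
  hε := by
    have : τ ≠ 0 := by rintro rfl; simp at hτ
    rw [Ne, cpow_eq_zero_iff]; tauto
  h_feq x hx := by
    have hx' : (0 : ℝ) < x := hx
    have hτ' := inv_re_pos hτ
    have hre : 0 < ((x : ℂ) * τ⁻¹).re := by rw [re_ofReal_mul]; exact mul_pos hx' hτ'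
    have h := jacobiTheta_I_mul_inv hre
    have harg : τ.arg ≠ Real.pi := by
      intro h
      have := abs_arg_lt_pi_div_two_iff.2 (Or.inl hτ)
      rw [h, abs_of_pos Real.pi_pos] at this
      linarith [Real.pi_pos]
    have hp : ((x : ℂ) * τ⁻¹) ^ (1 / 2 : ℂ) = τ ^ (-(1 / 2) : ℂ) * ((x ^ (1 / 2 : ℝ) : ℝ) : ℂ) := by
      rw [ofReal_mul_cpow hx' (by rintro h0; simp [h0] at hτ'), cpow_neg, inv_cpow _ _ harg,
        ofReal_cpow hx'.le]
      push_cast; ring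
    rw [hp] at h
    simp only [thetaRay, smul_eq_mul]
    rw [← h]
    congr 2
    simp [mul_comm]
  hf_top := thetaRay_isBigO hτ
  hg_top := thetaRay_isBigO (inv_re_pos hτ)

theorem hasSum_thetaRay_sub_one {τ : ℂ} (hτ : 0 < τ.re) {x : ℝ} (hx : 0 < x) :
    HasSum (fun n : ℕ => 2 * cexp (-(((Real.pi * ((n : ℝ) + 1) ^ 2 : ℝ) : ℂ) * τ * x)))
      (thetaRay τ x - 1) := by
  have h := (hasSum_nat_jacobiTheta (τ := I * (x * τ)) (by
    rw [I_mul_ray_im]; exact mul_pos hx hτ)).mul_left 2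
  rw [mul_div_cancel₀ _ (two_ne_zero' ℂ)] at h
  refine h.congr_fun fun n => ?_
  congr 2
  push_cast
  linear_combination (-(Real.pi * ((n : ℂ) + 1) ^ 2 * τ * x)) * I_sq

/-- Termwise integration by Euler's integral, legitimate because the integrated norms form a
multiple of ∑ (n+1)^(-2 Re s). All dependence on `τ` is the factor `τ ^ (-s)`, so the ray `τ = 1`
determines every other ray. -/
theorem mellin_thetaRay_sub_one {τ : ℂ} (hτ : 0 < τ.re) {s : ℂ} (hs : 1 / 2 < s.re) :
    mellin (fun x => thetaRay τ x - 1) s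
      = τ ^ (-s) * ∑' n : ℕ, 2 * (((Real.pi * ((n : ℝ) + 1) ^ 2 : ℝ) : ℂ) ^ (-s) * Gamma s) := by
  have hs0 : 0 < s.re := by linarith
  have hτ0 : τ ≠ 0 := by rintro rfl; simp at hτ
  set c : ℕ → ℝ := fun n => Real.pi * ((n : ℝ) + 1) ^ 2 with hc
  have hc0 : ∀ n, 0 < c n := fun n => by have := Real.pi_pos; positivity
  have hcτ : ∀ n, 0 < ((c n : ℂ) * τ).re := fun n => by
    rw [re_ofReal_mul]; exact mul_pos (hc0 n) hτ
  set F : ℕ → ℝ → ℂ := fun n x => (x : ℂ) ^ (s - 1) * (2 * cexp (-((c n : ℂ) * τ * x))) with hF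
  have hnorm : ∀ n, ∀ x ∈ Ioi (0 : ℝ),
      ‖F n x‖ = 2 * (x ^ (s.re - 1) * Real.exp (-(c n * τ.re * x))) := by
    intro n x hx
    simp only [hF]
    rw [norm_mul, norm_mul, norm_cpow_eq_rpow_re_of_pos hx, Complex.norm_exp]
    have : (-((c n : ℂ) * τ * x)).re = -(c n * τ.re * x) := by
      simp [mul_assoc]
    rw [this]; simp; ring
  have hint' : ∀ n, IntegrableOn
      (fun x : ℝ => x ^ (s.re - 1) * Real.exp (-(c n * τ.re * x))) (Ioi 0) := by
    intro n
    have := integrableOn_rpow_mul_exp_neg_mul_rpow (s := s.re - 1) (p := 1) (by linarith) one_pos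
      (mul_pos (hc0 n) hτ)
    simpa using this
  have hint : ∀ n, IntegrableOn (F n) (Ioi 0) := by
    intro n
    refine ((hint' n).const_mul 2).mono' ?_ ?_
    · refine ContinuousOn.aestronglyMeasurable ?_ measurableSet_Ioi
      refine ContinuousOn.mul (fun t ht => ?_) (by fun_prop)
      exact (continuousAt_ofReal_cpow_const _ _ (Or.inr (ne_of_gt ht))).continuousWithinAt
    · filter_upwards [ae_restrict_mem measurableSet_Ioi] with x hx
      exact (hnorm n x hx).le
  have hval : ∀ n, ∫ x in Ioi (0 : ℝ), F n x = τ ^ (-s) * (2 * ((c n : ℂ) ^ (-s) * Gamma s)) := by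
    intro n
    have h := integral_cpow_mul_cexp_neg_mul hs0 (hcτ n)
    rw [ofReal_mul_cpow (hc0 n) hτ0] at h
    calc ∫ x in Ioi (0 : ℝ), F n x
        = ∫ x in Ioi (0 : ℝ), 2 * ((x : ℂ) ^ (s - 1) * cexp (-((c n : ℂ) * τ * x))) := by
          congr 1; ext x; simp only [hF]; ring
      _ = 2 * ((c n : ℂ) ^ (-s) * τ ^ (-s) * Gamma s) := by rw [integral_const_mul, h]
      _ = _ := by ring
  have hnval : ∀ n, ∫ x in Ioi (0 : ℝ), ‖F n x‖
      = (2 * (Real.pi * τ.re) ^ (-s.re) * Real.Gamma s.re) * (1 / ((n : ℝ) + 1) ^ (2 * s.re)) := by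
    intro n
    rw [setIntegral_congr_fun measurableSet_Ioi (fun x hx => hnorm n x hx), integral_const_mul,
      Real.integral_rpow_mul_exp_neg_mul_Ioi hs0 (mul_pos (hc0 n) hτ)]
    have hn : (0 : ℝ) < (n : ℝ) + 1 := by positivity
    have hpt : 0 < Real.pi * τ.re := mul_pos Real.pi_pos hτ
    have h1 : c n * τ.re = (Real.pi * τ.re) * ((n : ℝ) + 1) ^ 2 := by simp only [hc]; ring
    rw [h1, one_div, Real.inv_rpow (by positivity), ← Real.rpow_neg (by positivity),
      Real.mul_rpow hpt.le (by positivity), ← Real.rpow_natCast, ← Real.rpow_mul hn.le, one_div,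
      ← Real.rpow_neg hn.le]
    push_cast
    ring_nf
  have hsum : Summable fun n => ∫ x in Ioi (0 : ℝ), ‖F n x‖ := by
    simp_rw [hnval]
    refine Summable.mul_left _ ?_
    have := (summable_nat_add_iff 1).2 (Real.summable_one_div_nat_rpow.2 (by linarith : 1 < 2 * s.re))
    simpa using this
  have h := hasSum_integral_of_summable_integral_norm hint hsum
  have h2 : mellin (fun x => thetaRay τ x - 1) s = ∫ x in Ioi (0 : ℝ), ∑' n, F n x := by
    refine setIntegral_congr_fun measurableSet_Ioi fun x hx => ?_
    simp only [smul_eq_mul]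
    rw [← ((hasSum_thetaRay_sub_one hτ hx).mul_left ((x : ℂ) ^ (s - 1))).tsum_eq]
  rw [h2, ← h.tsum_eq, ← tsum_mul_left]
  exact tsum_congr hval

theorem thetaRayPair_Λ_of_lt {τ : ℂ} (hτ : 0 < τ.re) {s : ℂ} (hs : 1 / 2 < s.re) :
    (thetaRayPair τ hτ).Λ s = τ ^ (-s) * completedRiemannZeta (2 * s) * 2 := by
  have hone : (0 : ℝ) < (1 : ℂ).re := by simp
  have h1 := ((thetaRayPair τ hτ).hasMellin (s := s) hs).2
  have h2 := ((HurwitzZeta.hurwitzEvenFEPair 0).hasMellin (s := s) hs).2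
  have h3 : mellin (fun x => (HurwitzZeta.hurwitzEvenFEPair 0).f x
      - (HurwitzZeta.hurwitzEvenFEPair 0).f₀) s = mellin (fun x => thetaRay 1 x - 1) s := by
    congr 1; ext x
    simp only [HurwitzZeta.hurwitzEvenFEPair, Function.comp, if_true, thetaRay]
    rw [HurwitzZeta.evenKernel_eq_cosKernel_of_zero, ← QuotientAddGroup.mk_zero,
      HurwitzZeta.cosKernel_def, ofReal_zero, mul_one, jacobiTheta_eq_jacobiTheta₂]
  have h4 : completedRiemannZeta (2 * s) * 2 = mellin (fun x => thetaRay 1 x - 1) s := by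
    rw [← h3, h2, completedRiemannZeta, HurwitzZeta.completedHurwitzZetaEven]
    rw [mul_div_cancel_left₀ _ (two_ne_zero' ℂ)]; ring
  rw [← h1, mul_assoc, h4]
  change mellin (fun x => thetaRay τ x - 1) s = _
  rw [mellin_thetaRay_sub_one hτ hs, mellin_thetaRay_sub_one hone hs, one_cpow, one_mul]

/-- Analytic continuation from Re s > 1/2 through the plane punctured at the two poles, which is
connected. The identity is wanted on Re s = 1/4. -/
theorem thetaRayPair_Λ_eq {τ : ℂ} (hτ : 0 < τ.re) {s : ℂ} (hs0 : s ≠ 0) (hs1 : s ≠ 1 / 2) :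
    (thetaRayPair τ hτ).Λ s = τ ^ (-s) * completedRiemannZeta (2 * s) * 2 := by
  have hτ0 : τ ≠ 0 := by rintro rfl; simp at hτ
  set U : Set ℂ := {0, 1 / 2}ᶜ with hU
  have hUo : IsOpen U := ((finite_singleton (1 / 2 : ℂ)).insert 0).isClosed.isOpen_compl
  have hUc : IsPreconnected U :=
    ((((finite_singleton (1 / 2 : ℂ)).insert 0).countable).isConnected_compl_of_one_lt_rank
      (by simp)).isPreconnected
  have hL : DifferentiableOn ℂ (thetaRayPair τ hτ).Λ U := fun z hz => by
    simp only [hU, mem_compl_iff, mem_insert_iff, mem_singleton_iff, not_or] at hz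
    refine ((thetaRayPair τ hτ).differentiableAt_Λ (Or.inl hz.1) (Or.inl ?_)).differentiableWithinAt
    simpa [thetaRayPair] using hz.2
  have hRd : DifferentiableOn ℂ (fun s => τ ^ (-s) * completedRiemannZeta (2 * s) * 2) U :=
    fun z hz => by
    simp only [hU, mem_compl_iff, mem_insert_iff, mem_singleton_iff, not_or] at hz
    have h2 : DifferentiableAt ℂ (fun s => completedRiemannZeta (2 * s)) z := by
      refine DifferentiableAt.comp (g := completedRiemannZeta) z
        (differentiableAt_completedZeta ?_ ?_) (by fun_prop)
      · simpa using hz.1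
      · intro h; exact hz.2 (by linear_combination h / 2)
    exact (((differentiableAt_id.neg.const_cpow (Or.inl hτ0)).mul h2).mul_const
      2).differentiableWithinAt
  have h := (hL.analyticOnNhd hUo).eqOn_of_preconnected_of_eventuallyEq
    (hRd.analyticOnNhd hUo) hUc (z₀ := 1) (by simp [hU]) ?_
  · exact h (by simp [hU, hs0]; simpa using hs1)
  · filter_upwards [(isOpen_lt continuous_const Complex.continuous_re).mem_nhds
      (show (1 / 2 : ℝ) < (1 : ℂ).re by norm_num)] with z hz
    exact thetaRayPair_Λ_of_lt hτ hz

/-! ### Mellin inversion and decay of Λ on the critical line. -/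

theorem hasMellin_cpow_indicator_Ioi (a : ℂ) {s : ℂ} (hs : s.re + a.re < 0) :
    HasMellin (indicator (Ioi 1) (fun t => (t : ℂ) ^ a : ℝ → ℂ)) s (-(1 / (s + a))) := by
  have aux : (s - 1 + a).re < -1 := by simp; linarith
  have hsub : Ioi (1 : ℝ) ⊆ Ioi 0 := Ioi_subset_Ioi zero_le_one
  have hEq : EqOn (fun t : ℝ => (t : ℂ) ^ (s - 1) • (t : ℂ) ^ a) (fun t => (t : ℂ) ^ (s - 1 + a))
      (Ioi 1) := fun t ht => by
    have : (t : ℂ) ≠ 0 := ofReal_ne_zero.2 (ne_of_gt (hsub ht))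
    simp only [smul_eq_mul]; rw [cpow_add _ _ this]
  have hI : IntegrableOn (fun t : ℝ => (t : ℂ) ^ (s - 1) • (t : ℂ) ^ a) (Ioi 1) :=
    (integrableOn_Ioi_cpow_of_lt aux one_pos).congr_fun hEq.symm measurableSet_Ioi
  simp_rw [HasMellin, mellin, MellinConvergent, ← indicator_smul, IntegrableOn,
    integrable_indicator_iff measurableSet_Ioi, integral_indicator measurableSet_Ioi, IntegrableOn,
    Measure.restrict_restrict_of_subset hsub]
  refine ⟨hI, ?_⟩
  rw [setIntegral_congr_fun measurableSet_Ioi hEq, integral_Ioi_cpow_of_lt aux one_pos]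
  simp; ring_nf

/-- In the critical strip `Λ` is the Mellin transform with both constant terms removed. -/
theorem thetaRayPair_hasMellin_strip {τ : ℂ} (hτ : 0 < τ.re) {s : ℂ} (h0 : 0 < s.re)
    (h1 : s.re < 1 / 2) :
    HasMellin (fun x : ℝ => thetaRay τ x - 1 - τ ^ (-(1 / 2) : ℂ) * (x : ℂ) ^ (-(1 / 2) : ℂ)) s
      ((thetaRayPair τ hτ).Λ s) := by
  set P := thetaRayPair τ hτ with hP
  have hA : HasMellin P.f_modif s (P.Λ₀ s) := by
    refine ⟨?_, rfl⟩
    obtain ⟨t, ht⟩ := exists_gt s.re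
    obtain ⟨u, hu⟩ := exists_lt s.re
    refine mellinConvergent_of_isBigO_rpow P.hf_modif_int
      (P.isStrongFEPair_toStrongFEPair.hf_top _) ht (P.isStrongFEPair_toStrongFEPair.hf_zero _) hu
  have hB := hasMellin_one_Ioc h0
  have hC := hasMellin_cpow_indicator_Ioi (-(1 / 2) : ℂ) (s := s) (by simp; linarith)
  have hC' := hasMellin_const_smul hC.1 (τ ^ (-(1 / 2) : ℂ))
  have hD := hasMellin_sub hA.1 hB.1
  have hE := hasMellin_sub hD.1 hC'.1
  -- `f_modif` subtracts each constant term on one side of 1 only. Removing each on the other side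
  -- too contributes -1/s and -ε/(1/2 - s), precisely the polar terms of Λ - Λ₀.
  have hval : mellin P.f_modif s - mellin ((Ioc 0 1).indicator fun _ => (1 : ℂ)) s
      - τ ^ (-(1 / 2) : ℂ) • mellin ((Ioi 1).indicator fun t : ℝ => (t : ℂ) ^ (-(1 / 2) : ℂ)) s
      = P.Λ s := by
    rw [hA.2, hB.2, hC.2, WeakFEPair.Λ]
    have hk : (P.k : ℂ) = 1 / 2 := by simp [hP, thetaRayPair]
    rw [hk, show P.ε = τ ^ (-(1 / 2) : ℂ) from rfl, show P.f₀ = 1 from rfl, show P.g₀ = 1 from rfl]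
    simp only [smul_eq_mul, mul_one]
    rw [show (1 / 2 - s : ℂ) = -(s + -(1 / 2)) by ring, div_neg, one_div, one_div]
    ring
  -- The point 1 must be discarded: `f_modif` vanishes there.
  have hae : ∀ᵐ x : ℝ ∂volume.restrict (Ioi 0),
      (x : ℂ) ^ (s - 1) • (P.f_modif x - (Ioc 0 1).indicator (fun _ => (1 : ℂ)) x
        - τ ^ (-(1 / 2) : ℂ) • (Ioi 1).indicator (fun t : ℝ => (t : ℂ) ^ (-(1 / 2) : ℂ)) x)
      = (x : ℂ) ^ (s - 1) • (thetaRay τ x - 1 - τ ^ (-(1 / 2) : ℂ) * (x : ℂ) ^ (-(1 / 2) : ℂ)) := by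
    filter_upwards [ae_restrict_mem measurableSet_Ioi,
      ae_restrict_of_ae (compl_mem_ae_iff.mpr (measure_singleton (1 : ℝ)))] with x hx hx1
    have hx0 : (0 : ℝ) < x := hx
    congr 1
    rcases lt_or_gt_of_ne (show x ≠ 1 from hx1) with h | h
    · rw [WeakFEPair.f_modif, Pi.add_apply, indicator_of_notMem (by simp [h.le]),
        indicator_of_mem (mem_Ioo.2 ⟨hx0, h⟩), indicator_of_mem (mem_Ioc.2 ⟨hx0, h.le⟩),
        indicator_of_notMem (by simp [h.le])]
      simp only [hP, thetaRayPair, smul_eq_mul, mul_one, mul_zero]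
      rw [ofReal_cpow hx0.le]; push_cast; ring
    · rw [WeakFEPair.f_modif, Pi.add_apply, indicator_of_mem (mem_Ioi.2 h),
        indicator_of_notMem (by simp [h.le]), indicator_of_notMem (by simp [h]),
        indicator_of_mem (mem_Ioi.2 h)]
      simp only [hP, thetaRayPair, smul_eq_mul]
      ring
  refine ⟨(integrable_congr hae).1 hE.1, ?_⟩
  rw [← hval, ← hC'.2, ← hD.2, ← hE.2]
  exact (integral_congr_ae hae).symm

theorem integrable_exp_neg_mul_abs {c : ℝ} (hc : 0 < c) :
    Integrable fun y : ℝ => Real.exp (-(c * |y|)) := by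
  have h := integrable_inv_one_add_sq.comp_mul_left' (R := c / 2) (by positivity)
  refine (h.const_mul 1).mono' (by fun_prop) (Eventually.of_forall fun y => ?_)
  rw [Real.norm_of_nonneg (Real.exp_pos _).le, one_mul, Real.exp_neg]
  refine inv_anti₀ (by positivity) ?_
  have h1 := Real.quadratic_le_exp_of_nonneg (show 0 ≤ c * |y| by positivity)
  have h2 : (c * |y|) ^ 2 = c ^ 2 * y ^ 2 := by rw [mul_pow, sq_abs]
  have h3 : 0 ≤ c * |y| := by positivity
  nlinarith [sq_nonneg (c * y)]

theorem norm_cpow_neg_quarter {τ : ℂ} (hτ : τ ≠ 0) (y : ℝ) :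
    ‖τ ^ (-(1 / 4 + y * I : ℂ))‖ = ‖τ‖ ^ (-(1 / 4) : ℝ) * Real.exp (τ.arg * y) := by
  rw [norm_cpow_of_ne_zero hτ]
  have h1 : (-(1 / 4 + y * I : ℂ)).re = -(1 / 4) := by
    rw [show (-(1 / 4 + y * I : ℂ)) = ((-(1 / 4) : ℝ) : ℂ) + ((-y : ℝ) : ℂ) * I by push_cast; ring]
    simp
  have h2 : (-(1 / 4 + y * I : ℂ)).im = -y := by
    rw [show (-(1 / 4 + y * I : ℂ)) = ((-(1 / 4) : ℝ) : ℂ) + ((-y : ℝ) : ℂ) * I by push_cast; ring]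
    simp
  rw [h1, h2, mul_neg, Real.exp_neg, div_inv_eq_mul]

theorem quarter_add_ne (y : ℝ) : (1 / 4 + y * I : ℂ) ≠ 0 ∧ (1 / 4 + y * I : ℂ) ≠ 1 / 2 := by
  constructor <;> intro h <;> have := congrArg re h <;> norm_num at this

theorem thetaRayPair_Λ_quarter {τ : ℂ} (hτ : 0 < τ.re) (y : ℝ) :
    (thetaRayPair τ hτ).Λ (1 / 4 + y * I)
      = τ ^ (-(1 / 4 + y * I : ℂ)) * completedRiemannZeta (1 / 2 + I * (2 * y : ℝ)) * 2 := by
  rw [thetaRayPair_Λ_eq hτ (quarter_add_ne y).1 (quarter_add_ne y).2]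
  congr 3; push_cast; ring

/-- For τ = exp(iδ) the factor τ^(-(1/4 + iy)) has modulus exp(δy), while a Mellin transform is
bounded on a vertical line by the integral of the modulus of its integrand. Rotating the ray thus
yields exponential decay of Λ at any rate below π/2. -/
theorem exists_bound_exp_mul_completedZeta {δ : ℝ} (hδ : |δ| < Real.pi / 2) :
    ∃ M, ∀ y : ℝ, Real.exp (δ * y) * ‖completedRiemannZeta (1 / 2 + I * (2 * y : ℝ))‖ ≤ M := by
  have hδ' := abs_lt.1 hδ
  set τ : ℂ := cexp (δ * I) with hτd
  have hre : 0 < τ.re := by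
    rw [hτd, exp_ofReal_mul_I_re]; exact Real.cos_pos_of_mem_Ioo ⟨by linarith, by linarith⟩
  have harg : τ.arg = δ := by
    rw [hτd, arg_exp_mul_I, toIocMod_eq_self]
    constructor <;> linarith [Real.pi_pos]
  have hτ0 : τ ≠ 0 := Complex.exp_ne_zero _
  have hnorm : ‖τ‖ = 1 := by rw [hτd, norm_exp_ofReal_mul_I]
  set G : ℝ → ℂ := fun x => thetaRay τ x - 1 - τ ^ (-(1 / 2) : ℂ) * (x : ℂ) ^ (-(1 / 2) : ℂ)
  refine ⟨(∫ x in Ioi (0 : ℝ), ‖G x‖ * x ^ (-(3 / 4) : ℝ)) / 2, fun y => ?_⟩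
  have h := thetaRayPair_hasMellin_strip hre (s := 1 / 4 + y * I) (by simp) (by simp; norm_num)
  have h1 : ‖(thetaRayPair τ hre).Λ (1 / 4 + y * I)‖
      ≤ ∫ x in Ioi (0 : ℝ), ‖G x‖ * x ^ (-(3 / 4) : ℝ) := by
    rw [← h.2, mellin]
    refine (norm_integral_le_integral_norm _).trans (le_of_eq ?_)
    refine setIntegral_congr_fun measurableSet_Ioi fun x hx => ?_
    simp only [norm_smul]
    rw [norm_cpow_eq_rpow_re_of_pos hx, mul_comm]
    congr 2
    simp; norm_num
  rw [thetaRayPair_Λ_quarter hre, norm_mul, norm_mul, norm_cpow_neg_quarter hτ0, hnorm, harg] at h1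
  simp only [Real.one_rpow, one_mul, Complex.norm_two] at h1
  linarith

theorem continuous_completedZeta_line :
    Continuous fun y : ℝ => completedRiemannZeta (1 / 2 + I * (2 * y : ℝ)) := by
  refine continuous_iff_continuousAt.2 fun y => ?_
  refine ContinuousAt.comp (g := completedRiemannZeta)
    (differentiableAt_completedZeta ?_ ?_).continuousAt (by fun_prop)
  · intro h; have := congrArg re h; norm_num at this
  · intro h; have := congrArg re h; norm_num at this

theorem integrable_exp_mul_abs_completedZeta {δ : ℝ} (hδ0 : 0 ≤ δ) (hδ : δ < Real.pi / 2) :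
    Integrable fun y : ℝ =>
      Real.exp (δ * |y|) * ‖completedRiemannZeta (1 / 2 + I * (2 * y : ℝ))‖ := by
  obtain ⟨δ', h1, h2⟩ := exists_between hδ
  have hδ' : |δ'| < Real.pi / 2 := by rw [abs_of_pos (hδ0.trans_lt h1)]; exact h2
  obtain ⟨M, hM⟩ := exists_bound_exp_mul_completedZeta hδ'
  obtain ⟨M', hM'⟩ := exists_bound_exp_mul_completedZeta (δ := -δ') (by rwa [abs_neg])
  refine ((integrable_exp_neg_mul_abs (sub_pos.2 h1)).const_mul (max M M')).mono' ?_ ?_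
  · exact (Continuous.mul (by fun_prop) continuous_completedZeta_line.norm).aestronglyMeasurable
  · refine Eventually.of_forall fun y => ?_
    rw [Real.norm_of_nonneg (by positivity)]
    have h3 : Real.exp (δ' * |y|) * ‖completedRiemannZeta (1 / 2 + I * (2 * y : ℝ))‖ ≤ max M M' := by
      rcases abs_choice y with h | h
      · rw [h]; exact (hM y).trans (le_max_left _ _)
      · rw [h, mul_neg, ← neg_mul]; exact (hM' y).trans (le_max_right _ _)
    have h4 : Real.exp (δ * |y|) = Real.exp (δ' * |y|) * Real.exp (-((δ' - δ) * |y|)) := by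
      rw [← Real.exp_add]; ring_nf
    rw [h4]
    calc _ = Real.exp (δ' * |y|) * ‖completedRiemannZeta (1 / 2 + I * (2 * y : ℝ))‖
          * Real.exp (-((δ' - δ) * |y|)) := by ring
      _ ≤ _ := by gcongr

theorem integrable_cpow_mul_completedZeta {τ : ℂ} (hτ : 0 < τ.re) :
    Integrable fun y : ℝ => τ ^ (-(1 / 4 + y * I : ℂ))
      * completedRiemannZeta (1 / 2 + I * (2 * y : ℝ)) := by
  have hτ0 : τ ≠ 0 := by rintro rfl; simp at hτ
  have harg : |τ.arg| < Real.pi / 2 := abs_arg_lt_pi_div_two_iff.2 (Or.inl hτ)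
  refine ((integrable_exp_mul_abs_completedZeta (abs_nonneg _) harg).const_mul
    (‖τ‖ ^ (-(1 / 4) : ℝ))).mono' ?_ (Eventually.of_forall fun y => ?_)
  · refine (Continuous.mul ?_ continuous_completedZeta_line).aestronglyMeasurable
    exact Continuous.const_cpow (by fun_prop) (Or.inl hτ0)
  · rw [norm_mul, norm_cpow_neg_quarter hτ0, mul_assoc]
    have : τ.arg * y ≤ |τ.arg| * |y| := by rw [← abs_mul]; exact le_abs_self _
    gcongr

/-- Mellin inversion evaluated at x = 1. It links the size of Λ on the critical line to the boundary
behaviour of theta as `τ` nears the imaginary axis. -/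
theorem integral_cpow_mul_completedZeta {τ : ℂ} (hτ : 0 < τ.re) :
    ∫ y : ℝ, τ ^ (-(1 / 4 + y * I : ℂ)) * completedRiemannZeta (1 / 2 + I * (2 * y : ℝ))
      = Real.pi * (jacobiTheta (I * τ) - 1 - τ ^ (-(1 / 2) : ℂ)) := by
  set G : ℝ → ℂ := fun x => thetaRay τ x - 1 - τ ^ (-(1 / 2) : ℂ) * (x : ℂ) ^ (-(1 / 2) : ℂ) with hG
  have hM : ∀ y : ℝ, mellin G (((1 / 4 : ℝ) : ℂ) + y * I)
      = τ ^ (-(1 / 4 + y * I : ℂ)) * completedRiemannZeta (1 / 2 + I * (2 * y : ℝ)) * 2 := by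
    intro y
    rw [← thetaRayPair_Λ_quarter hτ]
    have := (thetaRayPair_hasMellin_strip hτ (s := 1 / 4 + y * I) (by simp)
      (by simp; norm_num)).2
    push_cast
    exact this
  have hconv : MellinConvergent G ((1 / 4 : ℝ) : ℂ) := by
    have := (thetaRayPair_hasMellin_strip hτ (s := ((1 / 4 : ℝ) : ℂ)) (by simp)
      (by simp; norm_num)).1
    exact this
  have hV : VerticalIntegrable (mellin G) (1 / 4) := by
    unfold VerticalIntegrable
    simp_rw [hM]
    exact (integrable_cpow_mul_completedZeta hτ).mul_const 2
  have hcont : ContinuousAt G 1 := by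
    refine ContinuousAt.sub (ContinuousAt.sub ?_ continuousAt_const) (ContinuousAt.mul
      continuousAt_const (continuousAt_ofReal_cpow_const _ _ (Or.inr one_ne_zero)))
    exact (continuousOn_thetaRay hτ).continuousAt (Ioi_mem_nhds one_pos)
  have h := mellinInv_mellin_eq (1 / 4) G one_pos hconv hV hcont
  rw [mellinInv] at h
  simp_rw [hM, ofReal_one, one_cpow, one_smul] at h
  rw [integral_mul_const, real_smul] at h
  simp only [hG, thetaRay, ofReal_one, one_mul, one_cpow, mul_one] at h
  rw [← h]
  generalize (∫ y : ℝ, τ ^ (-(1 / 4 + y * I : ℂ)) * completedRiemannZeta (1 / 2 + I * (2 * y : ℝ)))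
    = J
  have : (Real.pi : ℂ) ≠ 0 := ofReal_ne_zero.2 Real.pi_ne_zero
  push_cast
  field_simp

/-! ### The theta function near the cusp where it stays bounded. -/

/-- The shift by 1 multiplies the n-th term by (-1)^n, so θ(τ) + θ(τ+1) is twice the sum over even
n, which is θ(4τ). -/
theorem jacobiTheta_add_one {τ : ℂ} (hτ : 0 < τ.im) :
    jacobiTheta (τ + 1) = 2 * jacobiTheta (4 * τ) - jacobiTheta τ := by
  have h1 := hasSum_nat_jacobiTheta hτ
  have h2 := hasSum_nat_jacobiTheta (τ := τ + 1) (by simpa using hτ)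
  have h3 := hasSum_nat_jacobiTheta (τ := 4 * τ) (by simpa using hτ)
  set a : ℕ → ℂ := fun n => cexp (Real.pi * I * ((n : ℂ) + 1) ^ 2 * τ)
    + cexp (Real.pi * I * ((n : ℂ) + 1) ^ 2 * (τ + 1)) with ha
  have hper : ∀ n : ℕ, cexp (Real.pi * I * ((n : ℂ) + 1) ^ 2 * (τ + 1))
      = cexp (Real.pi * I * ((n : ℂ) + 1) ^ 2 * τ) * (-1) ^ (n + 1) := by
    intro n
    have : cexp (Real.pi * I * ((n : ℂ) + 1) ^ 2) = (-1) ^ (n + 1) := by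
      rw [show (Real.pi * I * ((n : ℂ) + 1) ^ 2) = (((n + 1) ^ 2 : ℕ) : ℂ) * (Real.pi * I) by
        push_cast; ring, Complex.exp_nat_mul, exp_pi_mul_I, sq, pow_mul]
      rcases Nat.even_or_odd (n + 1) with h | h
      · simp [h.neg_one_pow]
      · simp [h.neg_one_pow]
    rw [mul_add, mul_one, Complex.exp_add, this]
  have h4 : HasSum (a ∘ fun k : ℕ => 2 * k + 1) ((jacobiTheta (4 * τ) - 1) / 2 * 2) := by
    refine (h3.mul_right 2).congr_fun fun k => ?_
    simp only [ha, Function.comp]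
    rw [hper, Even.neg_one_pow ⟨k + 1, by ring⟩]
    push_cast
    rw [mul_one, ← mul_two]
    congr 2; ring
  have hinj : Function.Injective fun k : ℕ => 2 * k + 1 := fun x y h => by
    simp only at h; omega
  rw [hinj.hasSum_iff ?_] at h4
  · have := h4.unique (h1.add h2)
    linear_combination -2 * this
  · intro n hn
    have hodd : Odd (n + 1) := by
      rw [← Nat.not_even_iff_odd]
      rintro ⟨k, hk⟩
      exact hn ⟨k - 1, by simp only; omega⟩
    simp only [ha]
    rw [hper, hodd.neg_one_pow]; ring

theorem norm_jacobiTheta_sub_one_le_div {τ : ℂ} (hτ : 0 < τ.im) :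
    ‖jacobiTheta τ - 1‖ ≤ 2 / (Real.pi * τ.im) := by
  refine (norm_jacobiTheta_sub_one_le hτ).trans ?_
  have hp : 0 < Real.pi * τ.im := mul_pos Real.pi_pos hτ
  have h1 : Real.pi * τ.im + 1 ≤ Real.exp (Real.pi * τ.im) := Real.add_one_le_exp _
  rw [neg_mul, Real.exp_neg]
  have h2 : 0 < Real.exp (Real.pi * τ.im) - 1 := by linarith
  have h3 : Real.exp (Real.pi * τ.im) ≠ 0 := (Real.exp_pos _).ne'
  have : 2 / (1 - (Real.exp (Real.pi * τ.im))⁻¹) * (Real.exp (Real.pi * τ.im))⁻¹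
      = 2 / (Real.exp (Real.pi * τ.im) - 1) := by
    have h4 : 1 - (Real.exp (Real.pi * τ.im))⁻¹ ≠ 0 := by
      have : (Real.exp (Real.pi * τ.im))⁻¹ < 1 := inv_lt_one_of_one_lt₀ (by linarith)
      linarith
    field_simp
  rw [this]
  gcongr
  linarith

theorem norm_cpow_half {z : ℂ} (hz : z ≠ 0) : ‖z ^ (1 / 2 : ℂ)‖ = √‖z‖ := by
  rw [norm_cpow_of_ne_zero hz, Real.sqrt_eq_rpow]
  simp

/-- As δ tends to π/2 the argument tends to the cusp -1. With z = exp(iδ) - i, period 2 and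
`jacobiTheta_add_one` turn the value into 2θ(4iz) - θ(iz). After modular inversion the two leading
terms cancel because (4z)^(1/2) = 2z^(1/2), and both remainders are O(|z|), since Re z = cos δ is
comparable to |z|. -/
theorem norm_jacobiTheta_I_mul_exp_le {δ : ℝ} (h0 : 0 ≤ δ) (h1 : δ < Real.pi / 2) :
    ‖jacobiTheta (I * cexp (δ * I))‖ ≤ 64 / Real.pi := by
  set z : ℂ := cexp (δ * I) - I with hz
  set c := Real.cos δ
  set s := Real.sin δ
  have hc : 0 < c := Real.cos_pos_of_mem_Ioo ⟨by linarith, h1⟩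
  have hs0 : 0 ≤ s := Real.sin_nonneg_of_nonneg_of_le_pi h0 (by linarith)
  have hs1 : s ≤ 1 := Real.sin_le_one δ
  have hcs : s ^ 2 + c ^ 2 = 1 := Real.sin_sq_add_cos_sq δ
  have hzre : z.re = c := by simp [hz, exp_ofReal_mul_I_re, c]
  have hzim : z.im = s - 1 := by simp [hz, exp_ofReal_mul_I_im, s]
  have hz0 : z ≠ 0 := by intro h; rw [h] at hzre; simp at hzre; linarith
  have hn : normSq z = 2 - 2 * s := by rw [normSq_apply, hzre, hzim]; nlinarith
  have hn2 : ‖z‖ ^ 2 = 2 - 2 * s := by rw [← hn, normSq_eq_norm_sq]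
  have hzpos : 0 < ‖z‖ := norm_pos_iff.2 hz0
  have hcz : c ≤ ‖z‖ := by rw [← hzre]; exact re_le_norm z
  have hnz : ‖z‖ ^ 2 ≤ 2 * c ^ 2 := by nlinarith
  have hz2 : ‖z‖ ≤ 2 := by nlinarith
  have hre : 0 < z.re := hzre ▸ hc
  have hJ : jacobiTheta (I * cexp (δ * I)) = 2 * jacobiTheta (I * (4 * z)) - jacobiTheta (I * z) := by
    have him : 0 < (I * z).im := by simpa using hre
    have := jacobiTheta_add_one him
    rw [← mul_assoc, mul_comm 4 I, mul_assoc] at this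
    rw [← this]
    rw [← jacobiTheta_two_add]
    congr 1
    rw [hz, mul_sub, I_mul_I]; ring
  have hA := jacobiTheta_I_mul_inv hre
  have hB := jacobiTheta_I_mul_inv (z := 4 * z) (by simpa using hre)
  have h4 : (4 * z) ^ (1 / 2 : ℂ) = 2 * z ^ (1 / 2 : ℂ) := by
    have := ofReal_mul_cpow (x := 4) (by norm_num) hz0 (1 / 2)
    push_cast at this
    rw [this]; congr 1
    rw [show (4 : ℂ) = ((4 : ℝ) : ℂ) by simp, show (1 / 2 : ℂ) = ((1 / 2 : ℝ) : ℂ) by simp,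
      ← ofReal_cpow (by norm_num), ← Real.sqrt_eq_rpow, show (4 : ℝ) = 2 ^ 2 by norm_num,
      Real.sqrt_sq (by norm_num)]
    simp
  have hmul : z ^ (1 / 2 : ℂ) * jacobiTheta (I * cexp (δ * I))
      = (jacobiTheta (I * (4 * z)⁻¹) - 1) - (jacobiTheta (I * z⁻¹) - 1) := by
    rw [hJ, hA, hB, h4]; ring
  have hb : ∀ r : ℝ, 1 ≤ r → r ≤ 4 → ‖jacobiTheta (I * ((r : ℂ) * z)⁻¹) - 1‖ ≤ 16 / Real.pi * ‖z‖ := by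
    intro r hr hr4
    have him : (I * ((r : ℂ) * z)⁻¹).im = c / (r * ‖z‖ ^ 2) := by
      rw [mul_inv, ← ofReal_inv]
      have : (I * (((r⁻¹ : ℝ) : ℂ) * z⁻¹)).im = r⁻¹ * (z⁻¹).re := by simp
      rw [this, inv_re, hzre, hn, hn2]
      field_simp
    have hpos : 0 < c / (r * ‖z‖ ^ 2) := by positivity
    refine (norm_jacobiTheta_sub_one_le_div (him ▸ hpos)).trans ?_
    rw [him]
    have hpi := Real.pi_pos
    rw [div_le_iff₀ (by positivity)]
    have : 16 / Real.pi * ‖z‖ * (Real.pi * (c / (r * ‖z‖ ^ 2))) = 16 * c / (r * ‖z‖) := by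
      field_simp
    rw [this, le_div_iff₀ (by positivity)]
    have h5 : ‖z‖ ≤ 2 * c := by nlinarith
    nlinarith
  have hb1 := hb 1 le_rfl (by norm_num)
  have hb4 := hb 4 (by norm_num) le_rfl
  rw [ofReal_one, one_mul] at hb1
  push_cast at hb4
  have hfin : √‖z‖ * ‖jacobiTheta (I * cexp (δ * I))‖ ≤ 32 / Real.pi * ‖z‖ := by
    rw [← norm_cpow_half hz0, ← norm_mul, hmul]
    refine (norm_sub_le _ _).trans ?_
    calc _ ≤ 16 / Real.pi * ‖z‖ + 16 / Real.pi * ‖z‖ := add_le_add hb4 hb1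
      _ = _ := by ring
  have hsq : √‖z‖ * √‖z‖ = ‖z‖ := Real.mul_self_sqrt hzpos.le
  have hsp : 0 < √‖z‖ := Real.sqrt_pos.2 hzpos
  have h6 : ‖jacobiTheta (I * cexp (δ * I))‖ ≤ 32 / Real.pi * √‖z‖ := by
    refine le_of_mul_le_mul_left (hfin.trans_eq ?_) hsp
    linear_combination (-32 / Real.pi) * hsq
  have h7 : √‖z‖ ≤ 2 := by nlinarith
  calc _ ≤ _ := h6
    _ ≤ 32 / Real.pi * 2 := by gcongr
    _ = _ := by ring

/-! ### Hardy's theorem. -/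

/-- The completed zeta function on the critical line, as a real function. -/
noncomputable def completedZetaLine (t : ℝ) : ℝ := (completedRiemannZeta (1 / 2 + I * t)).re

theorem critical_line_ne (t : ℝ) : (1 / 2 + I * t : ℂ) ≠ 0 ∧ (1 / 2 + I * t : ℂ) ≠ 1 := by
  constructor <;> intro h <;> have := congrArg re h <;> norm_num at this

theorem Gammaℝ_critical_ne_zero (t : ℝ) : Gammaℝ (1 / 2 + I * t) ≠ 0 :=
  Gammaℝ_ne_zero_of_re_pos (by simp)

theorem Gammaℝ_conj (s : ℂ) : Gammaℝ ((starRingEnd ℂ) s) = (starRingEnd ℂ) (Gammaℝ s) := by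
  have h := cpow_conj (Real.pi : ℂ) (-s / 2)
    (by rw [arg_ofReal_of_nonneg Real.pi_pos.le]; exact Real.pi_pos.ne)
  rw [conj_ofReal] at h
  rw [Gammaℝ_def, Gammaℝ_def, map_mul, ← Complex.Gamma_conj, ← h]
  simp [map_div₀, Complex.conj_ofNat 2]

theorem completedZeta_critical_eq (t : ℝ) :
    completedRiemannZeta (1 / 2 + I * t) = Gammaℝ (1 / 2 + I * t) * riemannZeta (1 / 2 + I * t) := by
  rw [riemannZeta_def_of_ne_zero (critical_line_ne t).1,
    mul_div_cancel₀ _ (Gammaℝ_critical_ne_zero t)]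

theorem conj_critical (t : ℝ) : (starRingEnd ℂ) (1 / 2 + I * t : ℂ) = 1 / 2 + I * ((-t : ℝ) : ℂ) := by
  rw [map_add, map_mul, conj_I, conj_ofReal, map_div₀, map_one, Complex.conj_ofNat]
  push_cast; ring

theorem completedZeta_critical_neg (t : ℝ) :
    completedRiemannZeta (1 / 2 + I * ((-t : ℝ) : ℂ)) = completedRiemannZeta (1 / 2 + I * t) := by
  rw [← completedRiemannZeta_one_sub]
  congr 1; push_cast; ring

/-- Conjugation sends `t` to `-t`, because ζ and `Gammaℝ` are real on the real axis; the functional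
equation sends `-t` back to `t`. -/
theorem completedZeta_critical_eq_ofReal (t : ℝ) :
    completedRiemannZeta (1 / 2 + I * t) = completedZetaLine t := by
  have h : (starRingEnd ℂ) (completedRiemannZeta (1 / 2 + I * t))
      = completedRiemannZeta (1 / 2 + I * t) := by
    conv_rhs => rw [← completedZeta_critical_neg, completedZeta_critical_eq, ← conj_critical]
    rw [riemannZeta_conj, Gammaℝ_conj, ← map_mul, ← completedZeta_critical_eq]
  exact (conj_eq_iff_re.1 h).symm

theorem completedZetaLine_neg (t : ℝ) : completedZetaLine (-t) = completedZetaLine t := by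
  rw [completedZetaLine, completedZeta_critical_neg, completedZetaLine]

theorem completedZetaLine_eq_zero_iff (t : ℝ) :
    completedZetaLine t = 0 ↔ riemannZeta (1 / 2 + I * t) = 0 := by
  rw [← ofReal_eq_zero, ← completedZeta_critical_eq_ofReal, completedZeta_critical_eq, mul_eq_zero,
    or_iff_right (Gammaℝ_critical_ne_zero t)]

theorem continuous_completedZetaLine : Continuous completedZetaLine := by
  refine Complex.continuous_re.comp (continuous_iff_continuousAt.2 fun y => ?_)
  exact ContinuousAt.comp (g := completedRiemannZeta)
    (differentiableAt_completedZeta (critical_line_ne y).1 (critical_line_ne y).2).continuousAt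
    (by fun_prop)

theorem sign_const_of_ne_zero {f : ℝ → ℝ} (hf : Continuous f) {T : ℝ} (h : ∀ t, T < t → f t ≠ 0) :
    ∃ σ : ℝ, |σ| = 1 ∧ ∀ t, T < t → σ * f t = |f t| := by
  by_cases hex : ∃ t, T < t ∧ 0 < f t
  · obtain ⟨t₀, ht₀, hp⟩ := hex
    refine ⟨1, abs_one, fun t ht => ?_⟩
    rw [one_mul, abs_of_pos]
    by_contra hn
    have hneg : f t < 0 := lt_of_le_of_ne (not_lt.1 hn) (h t ht)
    obtain ⟨c, hc, hc0⟩ := isPreconnected_Ioi.intermediate_value (a := t) (b := t₀) ht ht₀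
      hf.continuousOn (show (0 : ℝ) ∈ Icc (f t) (f t₀) from ⟨hneg.le, hp.le⟩)
    exact h c hc hc0
  · push Not at hex
    refine ⟨-1, by simp, fun t ht => ?_⟩
    rw [abs_of_nonpos (hex t ht)]; ring

theorem exp_mul_I_cpow_neg_quarter {δ : ℝ} (h1 : |δ| < Real.pi / 2) (y : ℝ) :
    cexp (δ * I) ^ (-(1 / 4 + y * I : ℂ))
      = cexp (-(δ * I / 4)) * ((Real.exp (δ * y) : ℝ) : ℂ) := by
  have h := abs_lt.1 h1
  have hlog : Complex.log (cexp (δ * I)) = δ * I :=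
    log_exp (by simp; linarith [Real.pi_pos]) (by simp; linarith [Real.pi_pos])
  rw [cpow_def_of_ne_zero (Complex.exp_ne_zero _), hlog, ofReal_exp, ← Complex.exp_add]
  congr 1
  push_cast
  linear_combination (-(δ * y : ℂ)) * I_sq

/-- Hardy's theorem: the critical line contains zeros of `ζ` of arbitrarily large ordinate. -/
theorem exists_completedZetaLine_zero_gt (T : ℝ) : ∃ t, T < t ∧ completedZetaLine t = 0 := by
  by_contra hcon
  push Not at hcon
  obtain ⟨σ, hσ, hsign⟩ := sign_const_of_ne_zero continuous_completedZetaLine hcon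
  have hpi := Real.pi_pos
  set L : ℝ → ℝ := fun y => completedZetaLine (2 * y) with hL
  have hLc : Continuous L := continuous_completedZetaLine.comp (by fun_prop)
  set Y := |T| with hY
  have hLsign : ∀ y, Y < |y| → σ * L y = |L y| := by
    intro y hy
    have hT : T < 2 * |y| := by
      have := le_abs_self T
      have := abs_nonneg T
      linarith
    have h := hsign _ hT
    have he : completedZetaLine (2 * |y|) = L y := by
      rcases abs_choice y with h | h
      · rw [h]
      · rw [h, mul_neg, completedZetaLine_neg]
    rwa [he] at h
  have hcoe : ∀ y : ℝ, completedRiemannZeta (1 / 2 + I * (2 * y : ℝ)) = (L y : ℂ) := fun y => by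
    rw [completedZeta_critical_eq_ofReal]
  have hintabs : ∀ δ, 0 ≤ δ → δ < Real.pi / 2 → Integrable fun y => Real.exp (δ * y) * |L y| := by
    intro δ h0 h1
    refine (integrable_exp_mul_abs_completedZeta h0 h1).mono'
      (Continuous.aestronglyMeasurable (by fun_prop)) (Eventually.of_forall fun y => ?_)
    rw [Real.norm_of_nonneg (by positivity), hcoe, norm_real, Real.norm_eq_abs]
    have : δ * y ≤ δ * |y| := mul_le_mul_of_nonneg_left (le_abs_self y) h0
    gcongr
  have hint : ∀ δ, 0 ≤ δ → δ < Real.pi / 2 → Integrable fun y => Real.exp (δ * y) * L y := by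
    intro δ h0 h1
    refine (hintabs δ h0 h1).mono' (Continuous.aestronglyMeasurable (by fun_prop))
      (Eventually.of_forall fun y => ?_)
    rw [norm_mul, Real.norm_of_nonneg (Real.exp_pos _).le, Real.norm_eq_abs]
  -- the signed integrals are bounded because the theta function is bounded near `i`
  have hsigned : ∀ δ, 0 ≤ δ → δ < Real.pi / 2 →
      |∫ y, Real.exp (δ * y) * L y| ≤ Real.pi * (64 / Real.pi + 2) := by
    intro δ h0 h1
    have habs : |δ| < Real.pi / 2 := by rwa [abs_of_nonneg h0]
    have hre : 0 < (cexp (δ * I)).re := by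
      rw [exp_ofReal_mul_I_re]; exact Real.cos_pos_of_mem_Ioo ⟨by linarith, h1⟩
    have h := integral_cpow_mul_completedZeta hre
    simp_rw [exp_mul_I_cpow_neg_quarter habs, hcoe, mul_assoc, ← ofReal_mul] at h
    rw [integral_const_mul, integral_complex_ofReal] at h
    have hn := congrArg norm h
    have hn1 : ‖cexp (-(δ * I / 4))‖ = 1 := by
      rw [show (-(δ * I / 4) : ℂ) = ((-δ / 4 : ℝ) : ℂ) * I by push_cast; ring, norm_exp_ofReal_mul_I]
    rw [norm_mul, hn1, one_mul, norm_real, norm_mul, norm_real, Real.norm_of_nonneg hpi.le,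
      Real.norm_eq_abs] at hn
    rw [hn]
    gcongr
    have h3 : ‖cexp (δ * I) ^ (-(1 / 2) : ℂ)‖ = 1 := by
      rw [norm_cpow_of_ne_zero (Complex.exp_ne_zero _), norm_exp_ofReal_mul_I]; simp
    calc _ ≤ ‖jacobiTheta (I * cexp (δ * I))‖ + ‖(1 : ℂ)‖ + ‖cexp (δ * I) ^ (-(1 / 2) : ℂ)‖ :=
          (norm_sub_le _ _).trans (by gcongr; exact norm_sub_le _ _)
      _ ≤ 64 / Real.pi + 1 + 1 := by
          rw [h3, norm_one]; gcongr; exact norm_jacobiTheta_I_mul_exp_le h0 h1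
      _ = _ := by ring
  -- Constant sign outside [-Y, Y] turns the bound on signed integrals into one on absolute
  -- integrals, uniform in δ. Inside, the discrepancy is at most 2 exp(2Y)|L|, as δ < π/2 ≤ 2.
  obtain ⟨C, hC0, hC⟩ : ∃ C, 0 ≤ C ∧ ∀ δ, 0 ≤ δ → δ < Real.pi / 2 →
      ∫ y, Real.exp (δ * y) * |L y| ≤ C := by
    have hloc : IntegrableOn (fun y => 2 * (Real.exp (2 * Y) * |L y|)) (Icc (-Y) Y) :=
      (Continuous.continuousOn (by fun_prop)).integrableOn_Icc
    refine ⟨Real.pi * (64 / Real.pi + 2) + ∫ y in Icc (-Y) Y, 2 * (Real.exp (2 * Y) * |L y|), ?_,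
      fun δ h0 h1 => ?_⟩
    · have : 0 ≤ ∫ y in Icc (-Y) Y, 2 * (Real.exp (2 * Y) * |L y|) :=
        integral_nonneg fun y => by positivity
      positivity
    have hI : Integrable ((Icc (-Y) Y).indicator fun y => 2 * (Real.exp (2 * Y) * |L y|)) :=
      (integrable_indicator_iff measurableSet_Icc).2 hloc
    have hle : ∫ y, Real.exp (δ * y) * |L y| ≤ ∫ y, (σ * (Real.exp (δ * y) * L y)
        + (Icc (-Y) Y).indicator (fun y => 2 * (Real.exp (2 * Y) * |L y|)) y) := by
      refine integral_mono (hintabs δ h0 h1) (((hint δ h0 h1).const_mul σ).add hI) fun y => ?_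
      have hE := Real.exp_pos (δ * y)
      by_cases hy : Y < |y|
      · have : y ∉ Icc (-Y) Y := fun h => absurd (abs_le.2 h) (not_le.2 hy)
        simp only [indicator_of_notMem this, add_zero]
        rw [← hLsign y hy]; exact le_of_eq (by ring)
      · have hy' : |y| ≤ Y := not_lt.1 hy
        simp only [indicator_of_mem (show y ∈ Icc (-Y) Y from abs_le.1 hy')]
        have h2 : Real.exp (δ * y) ≤ Real.exp (2 * Y) := by
          refine Real.exp_le_exp.2 ?_
          have hpi4 := Real.pi_le_four
          calc δ * y ≤ δ * |y| := mul_le_mul_of_nonneg_left (le_abs_self y) h0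
            _ ≤ 2 * Y := by
              have := abs_nonneg y
              nlinarith
        have h3 : -|L y| ≤ σ * L y := by
          have := neg_abs_le (σ * L y)
          rwa [abs_mul, hσ, one_mul] at this
        have h4 : Real.exp (δ * y) * |L y| ≤ Real.exp (2 * Y) * |L y| := by gcongr
        have h5 := mul_le_mul_of_nonneg_left h3 hE.le
        linarith
    refine hle.trans ?_
    rw [integral_add ((hint δ h0 h1).const_mul σ) hI, integral_indicator measurableSet_Icc,
      integral_const_mul]
    have : σ * ∫ y, Real.exp (δ * y) * L y ≤ Real.pi * (64 / Real.pi + 2) := by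
      refine (le_abs_self _).trans ?_
      rw [abs_mul, hσ, one_mul]; exact hsigned δ h0 h1
    linarith
  -- Absolute integrals depend only on arg τ, so the bound spreads from the unit circle to every `τ`
  -- with nonnegative argument and modulus at least 1, hence to other cusps.
  have hbound : ∀ τ : ℂ, 0 < τ.re → 0 ≤ τ.arg → 1 ≤ ‖τ‖ →
      ‖jacobiTheta (I * τ)‖ ≤ C / Real.pi + 2 := by
    intro τ hre harg hn
    have hτ0 : τ ≠ 0 := by rintro rfl; simp at hre
    have harg2 : τ.arg < Real.pi / 2 :=
      (le_abs_self _).trans_lt (abs_arg_lt_pi_div_two_iff.2 (Or.inl hre))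
    have h := integral_cpow_mul_completedZeta hre
    have h2 : ‖∫ y : ℝ, τ ^ (-(1 / 4 + y * I : ℂ)) * completedRiemannZeta (1 / 2 + I * (2 * y : ℝ))‖
        ≤ C := by
      refine (norm_integral_le_integral_norm _).trans ?_
      refine le_trans (integral_mono (integrable_cpow_mul_completedZeta hre).norm
        (hintabs _ harg harg2) fun y => ?_) (hC _ harg harg2)
      simp only
      rw [norm_mul, norm_cpow_neg_quarter hτ0, hcoe, norm_real, Real.norm_eq_abs, mul_assoc]
      refine mul_le_of_le_one_left (by positivity) ?_
      exact Real.rpow_le_one_of_one_le_of_nonpos hn (by norm_num)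
    rw [h, norm_mul, norm_real, Real.norm_of_nonneg hpi.le] at h2
    have h3 : ‖τ ^ (-(1 / 2) : ℂ)‖ ≤ 1 := by
      rw [norm_cpow_of_ne_zero hτ0]
      simp only [neg_re, neg_im]
      norm_num
      exact Real.rpow_le_one_of_one_le_of_nonpos hn (by norm_num)
    have h4 : ‖jacobiTheta (I * τ) - 1 - τ ^ (-(1 / 2) : ℂ)‖ ≤ C / Real.pi := by
      rw [le_div_iff₀ hpi, mul_comm]; exact h2
    calc ‖jacobiTheta (I * τ)‖
        = ‖(jacobiTheta (I * τ) - 1 - τ ^ (-(1 / 2) : ℂ)) + 1 + τ ^ (-(1 / 2) : ℂ)‖ := by congr 1; ring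
      _ ≤ ‖jacobiTheta (I * τ) - 1 - τ ^ (-(1 / 2) : ℂ)‖ + ‖(1 : ℂ)‖ + ‖τ ^ (-(1 / 2) : ℂ)‖ :=
          (norm_add_le _ _).trans (by gcongr; exact norm_add_le _ _)
      _ ≤ C / Real.pi + 1 + 1 := by rw [norm_one]; gcongr
      _ = _ := by ring
  -- but the theta function is unbounded near the cusp `-2`
  have hseq : ∀ N : ℝ, 1 ≤ N → √N * ‖jacobiTheta (I * (N : ℂ))‖ ≤ C / Real.pi + 2 := by
    intro N hN
    have hN0 : 0 < N := by linarith
    -- Iτ = i/N - 2 is a translate of i/N by a period; the imaginary part 2 also secures arg τ ≥ 0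
    -- and |τ| ≥ 1.
    set τ : ℂ := ((N⁻¹ : ℝ) : ℂ) + 2 * I with hτ
    have hre : τ.re = N⁻¹ := by simp [hτ]
    have him : τ.im = 2 := by simp [hτ]
    have hb := hbound τ (by rw [hre]; positivity) (arg_nonneg_iff.2 (by rw [him]; norm_num))
      (le_trans (by rw [him]; norm_num) (abs_im_le_norm τ))
    have hJ : jacobiTheta (I * τ) = jacobiTheta (I * ((N : ℂ))⁻¹) := by
      rw [← jacobiTheta_two_add]; congr 1; rw [hτ]; push_cast
      linear_combination 2 * I_sq
    rw [hJ, jacobiTheta_I_mul_inv (by simpa using hN0), norm_mul,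
      norm_cpow_half (ofReal_ne_zero.2 hN0.ne'), norm_real, Real.norm_of_nonneg hN0.le] at hb
    exact hb
  have hlow : ∀ N : ℝ, 1 ≤ N → 1 / 4 ≤ ‖jacobiTheta (I * (N : ℂ))‖ := by
    intro N hN
    have him : (I * (N : ℂ)).im = N := by simp
    have h := norm_jacobiTheta_sub_one_le_div (τ := I * (N : ℂ)) (by rw [him]; linarith)
    rw [him] at h
    have h1 : 2 / (Real.pi * N) ≤ 3 / 4 := by
      rw [div_le_iff₀ (by positivity)]
      nlinarith [Real.pi_gt_three]
    have h2 := norm_sub_norm_le (1 : ℂ) (1 - jacobiTheta (I * (N : ℂ)))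
    rw [sub_sub_cancel, norm_one, norm_sub_rev] at h2
    linarith
  set K := C / Real.pi + 2 with hK
  have hK2 : 2 ≤ K := by have : 0 ≤ C / Real.pi := by positivity
                         linarith
  -- With N = (8K)² the lower bound √N/4 equals 2K, which exceeds K.
  have hN : 1 ≤ (8 * K) ^ 2 := by nlinarith
  have h1 := hseq _ hN
  have h2 := hlow _ hN
  rw [Real.sqrt_sq (by linarith)] at h1
  nlinarith

/-! ### Gauss's formula for the digamma function. -/

/-- The weight `e^{-x} - (1 - x/n)₊ⁿ` whose Mellin transform is `Γ(s) - GammaSeq s n`. -/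
noncomputable def eulerGap (n : ℕ) (x : ℝ) : ℝ :=
  Real.exp (-x) - (Ioc (0 : ℝ) n).indicator (fun x => (1 - x / n) ^ n) x

theorem eulerGap_nonneg (n : ℕ) (x : ℝ) : 0 ≤ eulerGap n x := by
  unfold eulerGap
  by_cases hx : x ∈ Ioc (0 : ℝ) n
  · rw [indicator_of_mem hx]; exact sub_nonneg.2 (Real.one_sub_div_pow_le_exp_neg hx.2)
  · rw [indicator_of_notMem hx, sub_zero]; exact (Real.exp_pos _).le

theorem eulerGap_le (n : ℕ) (x : ℝ) : eulerGap n x ≤ Real.exp (-x) := by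
  unfold eulerGap
  by_cases hx : x ∈ Ioc (0 : ℝ) n
  · rw [indicator_of_mem hx]
    have : 0 ≤ 1 - x / n := by
      have hn : (0 : ℝ) < n := hx.1.trans_le hx.2
      rw [sub_nonneg, div_le_one hn]; exact hx.2
    linarith [pow_nonneg this n]
  · rw [indicator_of_notMem hx, sub_zero]

theorem measurable_eulerGap (n : ℕ) : Measurable (eulerGap n) := by
  unfold eulerGap
  exact Measurable.sub (by fun_prop) (Measurable.indicator (by fun_prop) measurableSet_Ioc)

theorem integrableOn_eulerGap (n : ℕ) {σ : ℝ} (hσ : 0 < σ) :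
    IntegrableOn (fun x => eulerGap n x * x ^ (σ - 1)) (Ioi 0) := by
  refine (Real.GammaIntegral_convergent hσ).mono'
    (((measurable_eulerGap n).mul (by fun_prop)).aestronglyMeasurable) ?_
  filter_upwards [ae_restrict_mem measurableSet_Ioi] with x hx
  have hx' : (0 : ℝ) < x := hx
  rw [Real.norm_of_nonneg (mul_nonneg (eulerGap_nonneg n x) (by positivity))]
  gcongr
  exact eulerGap_le n x

theorem Gamma_sub_GammaSeq {s : ℂ} (hs : 0 < s.re) {n : ℕ} (hn : n ≠ 0) :
    Gamma s - GammaSeq s n = ∫ x in Ioi (0 : ℝ), (eulerGap n x : ℂ) * (x : ℂ) ^ (s - 1) := by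
  have hsub : Ioc (0 : ℝ) n ⊆ Ioi 0 := fun x hx => hx.1
  have h1 : IntegrableOn (fun x : ℝ => ((Real.exp (-x) : ℝ) : ℂ) * (x : ℂ) ^ (s - 1)) (Ioi 0) :=
    GammaIntegral_convergent hs
  have h3 : IntegrableOn (fun x : ℝ => (((1 - x / n) ^ n : ℝ) : ℂ) * (x : ℂ) ^ (s - 1))
      (Ioc 0 n) := by
    refine Integrable.mono (h1.mono_set hsub) ?_ ?_
    · refine ContinuousOn.aestronglyMeasurable ?_ measurableSet_Ioc
      refine ContinuousOn.mul (by fun_prop) (fun t ht => ?_)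
      exact (continuousAt_ofReal_cpow_const _ _ (Or.inr (ne_of_gt ht.1))).continuousWithinAt
    · filter_upwards [ae_restrict_mem measurableSet_Ioc] with x hx
      rw [norm_mul, norm_mul, norm_real, norm_real, Real.norm_of_nonneg (Real.exp_pos _).le]
      gcongr
      have hn : (0 : ℝ) < n := hx.1.trans_le hx.2
      have : 0 ≤ 1 - x / n := by rw [sub_nonneg, div_le_one hn]; exact hx.2
      rw [Real.norm_of_nonneg (pow_nonneg this n)]
      exact Real.one_sub_div_pow_le_exp_neg hx.2
  rw [Gamma_eq_integral hs, GammaIntegral, GammaSeq_eq_approx_Gamma_integral hs hn,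
    intervalIntegral.integral_of_le (Nat.cast_nonneg n)]
  have h4 := setIntegral_indicator (μ := volume) (s := Ioi (0 : ℝ)) (t := Ioc (0 : ℝ) n)
    (f := fun x : ℝ => (((1 - x / n) ^ n : ℝ) : ℂ) * (x : ℂ) ^ (s - 1)) measurableSet_Ioc
  rw [inter_eq_right.2 hsub] at h4
  rw [← h4, ← integral_sub h1]
  · refine setIntegral_congr_fun measurableSet_Ioi fun x _ => ?_
    simp only [eulerGap]
    by_cases hx : x ∈ Ioc (0 : ℝ) n
    · rw [indicator_of_mem hx, indicator_of_mem hx]; push_cast; ring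
    · rw [indicator_of_notMem hx, indicator_of_notMem hx]; push_cast; ring
  · rw [integrable_indicator_iff measurableSet_Ioc, IntegrableOn,
      Measure.restrict_restrict_of_subset hsub]
    exact h3

theorem tendsto_integral_eulerGap {σ : ℝ} (hσ : 0 < σ) :
    Tendsto (fun n : ℕ => ∫ x in Ioi (0 : ℝ), eulerGap n x * x ^ (σ - 1)) atTop (𝓝 0) := by
  have h := (GammaSeq_tendsto_Gamma (σ : ℂ)).const_sub (Gamma σ)
  rw [sub_self] at h
  have h2 := (continuous_re.tendsto 0).comp h
  refine h2.congr' ?_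
  filter_upwards [eventually_ne_atTop 0] with n hn
  simp only [Function.comp]
  rw [Gamma_sub_GammaSeq (by simpa using hσ) hn]
  have : ∫ x in Ioi (0 : ℝ), (eulerGap n x : ℂ) * (x : ℂ) ^ ((σ : ℂ) - 1)
      = ((∫ x in Ioi (0 : ℝ), eulerGap n x * x ^ (σ - 1) : ℝ) : ℂ) := by
    rw [← integral_complex_ofReal]
    refine setIntegral_congr_fun measurableSet_Ioi fun x hx => ?_
    simp only [ofReal_mul]
    rw [ofReal_cpow (le_of_lt hx)]; push_cast; rfl
  rw [this, ofReal_re]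

/-- Since the weight is nonnegative and x^(σ-1) ≤ x^(a-1) + x^(b-1) for a ≤ σ ≤ b, convergence at
the two real points a and b controls the whole strip uniformly. -/
theorem norm_Gamma_sub_GammaSeq_le {a b : ℝ} (ha : 0 < a) {s : ℂ} (h1 : a ≤ s.re) (h2 : s.re ≤ b)
    {n : ℕ} (hn : n ≠ 0) :
    ‖Gamma s - GammaSeq s n‖ ≤ (∫ x in Ioi (0 : ℝ), eulerGap n x * x ^ (a - 1))
      + ∫ x in Ioi (0 : ℝ), eulerGap n x * x ^ (b - 1) := by
  have hb : 0 < b := by linarith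
  rw [Gamma_sub_GammaSeq (by linarith) hn,
    ← integral_add (integrableOn_eulerGap n ha) (integrableOn_eulerGap n hb)]
  refine norm_integral_le_of_norm_le
    ((integrableOn_eulerGap n ha).add (integrableOn_eulerGap n hb)) ?_
  filter_upwards [ae_restrict_mem measurableSet_Ioi] with x hx
  have hx' : (0 : ℝ) < x := hx
  rw [norm_mul, norm_real, Real.norm_of_nonneg (eulerGap_nonneg n x),
    norm_cpow_eq_rpow_re_of_pos hx, ← mul_add, sub_re, one_re]
  refine mul_le_mul_of_nonneg_left ?_ (eulerGap_nonneg n x)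
  have p1 : 0 < x ^ (a - 1) := Real.rpow_pos_of_pos hx' _
  have p2 : 0 < x ^ (b - 1) := Real.rpow_pos_of_pos hx' _
  rcases le_total x 1 with h | h
  · have := Real.rpow_le_rpow_of_exponent_ge hx' h (show a - 1 ≤ s.re - 1 by linarith)
    linarith
  · have := Real.rpow_le_rpow_of_exponent_le h (show s.re - 1 ≤ b - 1 by linarith)
    linarith

theorem GammaSeq_tendstoLocallyUniformlyOn :
    TendstoLocallyUniformlyOn (fun (n : ℕ) s => GammaSeq s n) Gamma atTop {s : ℂ | 0 < s.re} := by
  rw [Metric.tendstoLocallyUniformlyOn_iff]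
  intro ε hε s hs
  have hs' : 0 < s.re := hs
  refine ⟨{z : ℂ | s.re / 2 < z.re ∧ z.re < s.re + 1}, mem_nhdsWithin_of_mem_nhds
    (IsOpen.mem_nhds ((isOpen_lt continuous_const continuous_re).inter
      (isOpen_lt continuous_re continuous_const)) ⟨by simp; linarith, by simp⟩), ?_⟩
  have h := (tendsto_integral_eulerGap (show 0 < s.re / 2 by linarith)).add
    (tendsto_integral_eulerGap (show 0 < s.re + 1 by linarith))
  rw [add_zero] at h
  filter_upwards [h.eventually_lt_const hε, eventually_ne_atTop 0] with n hn hn0 z hz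
  rw [dist_eq_norm]
  exact (norm_Gamma_sub_GammaSeq_le (by linarith) hz.1.le hz.2.le hn0).trans_lt hn

theorem add_natCast_ne_zero {s : ℂ} (hs : 0 < s.re) (j : ℕ) : s + j ≠ 0 := by
  intro h
  have := congrArg re h
  simp only [add_re, natCast_re, zero_re] at this
  have := Nat.cast_nonneg (α := ℝ) j
  linarith

theorem hasDerivAt_GammaSeq {s : ℂ} (hs : 0 < s.re) {n : ℕ} (hn : n ≠ 0) :
    HasDerivAt (fun s => GammaSeq s n)
      (GammaSeq s n * (Complex.log n - ∑ j ∈ Finset.range (n + 1), 1 / (s + j))) s := by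
  have hn0 : (n : ℂ) ≠ 0 := Nat.cast_ne_zero.2 hn
  have h1 : HasDerivAt (fun s : ℂ => (n : ℂ) ^ s * n.factorial)
      ((n : ℂ) ^ s * Complex.log n * 1 * n.factorial) s :=
    ((hasDerivAt_id s).const_cpow (Or.inl hn0)).mul_const _
  have hP : ∏ j ∈ Finset.range (n + 1), (s + j) ≠ 0 :=
    Finset.prod_ne_zero_iff.2 fun j _ => add_natCast_ne_zero hs j
  have h2 : HasDerivAt (fun s : ℂ => ∏ j ∈ Finset.range (n + 1), (s + j))
      ((∏ j ∈ Finset.range (n + 1), (s + j)) * ∑ j ∈ Finset.range (n + 1), 1 / (s + j)) s := by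
    have h3 : ∀ j ∈ Finset.range (n + 1), HasDerivAt (fun s : ℂ => s + j) 1 s := fun j _ =>
      (hasDerivAt_id s).add_const _
    refine (HasDerivAt.fun_finsetProd h3).congr_deriv ?_
    rw [Finset.mul_sum]
    refine Finset.sum_congr rfl fun j hj => ?_
    rw [← Finset.mul_prod_erase _ _ hj, smul_eq_mul]
    have := add_natCast_ne_zero hs j
    field_simp
  refine (h1.div h2 hP).congr_deriv ?_
  rw [GammaSeq]
  field_simp

/-- Gauss's limit formula for the digamma function. -/
theorem tendsto_log_sub_sum_digamma {s : ℂ} (hs : 0 < s.re) :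
    Tendsto (fun n : ℕ => Complex.log n - ∑ j ∈ Finset.range (n + 1), 1 / (s + j)) atTop
      (𝓝 (digamma s)) := by
  have hopen : IsOpen {s : ℂ | 0 < s.re} := isOpen_lt continuous_const continuous_re
  -- Locally uniform convergence of analytic functions passes to logarithmic derivatives.
  have h := logDeriv_tendsto hopen (x := s) hs GammaSeq_tendstoLocallyUniformlyOn ?_
    (Gamma_ne_zero_of_re_pos hs)
  · rw [digamma_def]
    refine h.congr' ?_
    filter_upwards [eventually_ne_atTop 0] with n hn
    have hne : GammaSeq s n ≠ 0 := by
      rw [GammaSeq]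
      refine div_ne_zero (mul_ne_zero ?_ (Nat.cast_ne_zero.2 n.factorial_ne_zero))
        (Finset.prod_ne_zero_iff.2 fun j _ => add_natCast_ne_zero hs j)
      rw [Ne, cpow_eq_zero_iff]; simp [hn]
    rw [logDeriv_apply, (hasDerivAt_GammaSeq hs hn).deriv, mul_div_cancel_left₀ _ hne]
  · filter_upwards [eventually_ne_atTop 0] with n hn z hz
    exact (hasDerivAt_GammaSeq hz hn).differentiableAt.differentiableWithinAt

/-! ### Telescoping bounds for the digamma function on the line Re s = 1/4. -/

theorem half_log_div_le_cubic {x : ℝ} (h0 : 0 ≤ x) (h1 : x < 1) :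
    1 / 2 * Real.log ((1 + x) / (1 - x)) ≤ x + x ^ 3 / (3 * (1 - x ^ 2)) := by
  set F : ℝ → ℝ := fun x => 1 / 2 * Real.log ((1 + x) / (1 - x))
    - ∑ i ∈ Finset.range 1, x ^ (2 * i + 1) / (2 * i + 1) - x ^ 3 / (3 * (1 - x ^ 2)) with hF
  have hd : ∀ y ∈ Icc 0 x, HasDerivAt F (-(2 / 3 * y ^ 4 / (1 - y ^ 2) ^ 2)) y := by
    intro y hy
    have hy1 : 0 < 1 - y ^ 2 := by nlinarith [hy.1, hy.2]
    have ha := Real.hasDerivAt_half_log_one_add_div_one_sub_sub_sum_range (y := y) 1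
      (by linarith [hy.1]) (by linarith [hy.2])
    have hb : HasDerivAt (fun x : ℝ => x ^ 3 / (3 * (1 - x ^ 2)))
        ((3 * y ^ 2 * (3 * (1 - y ^ 2)) - y ^ 3 * (3 * (-(2 * y)))) / (3 * (1 - y ^ 2)) ^ 2) y := by
      have h3 : HasDerivAt (fun x : ℝ => x ^ 3) (3 * y ^ 2) y := by simpa using hasDerivAt_pow 3 y
      have h2 : HasDerivAt (fun x : ℝ => 3 * (1 - x ^ 2)) (3 * (-(2 * y))) y := by
        have := ((hasDerivAt_pow 2 y).const_sub 1).const_mul 3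
        simpa using this
      exact h3.div h2 (by positivity)
    refine (ha.sub hb).congr_deriv ?_
    field_simp
    ring
  have hanti : AntitoneOn F (Icc 0 x) := by
    refine antitoneOn_of_hasDerivWithinAt_nonpos (convex_Icc 0 x)
      (fun y hy => (hd y hy).continuousAt.continuousWithinAt)
      (fun y hy => (hd y (interior_subset hy)).hasDerivWithinAt) fun y hy => ?_
    have : 0 ≤ 2 / 3 * y ^ 4 / (1 - y ^ 2) ^ 2 := by positivity
    linarith
  have := hanti ⟨le_rfl, h0⟩ ⟨h0, le_rfl⟩ h0
  simp only [hF] at this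
  norm_num at this
  linarith

/-- This is X ≤ artanh X at X = u/(u² + y²): the ratio (1+X)/(1-X) compares one quadratic at u + 1/2
and u - 1/2, which makes the bound telescope in Gauss's sum. -/
theorem div_le_half_log_sub {u y : ℝ} (hu : 0 ≤ u) (hy : 1 / 4 < y ^ 2) :
    u / (u ^ 2 + y ^ 2) ≤ 1 / 2 * Real.log ((u + 1 / 2) ^ 2 + (y ^ 2 - 1 / 4))
      - 1 / 2 * Real.log ((u - 1 / 2) ^ 2 + (y ^ 2 - 1 / 4)) := by
  have hA : 0 < u ^ 2 + y ^ 2 := by nlinarith [sq_nonneg u]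
  have hlt : u < u ^ 2 + y ^ 2 := by nlinarith [sq_nonneg (u - 1 / 2)]
  have h := Real.sum_range_le_log_div (x := u / (u ^ 2 + y ^ 2)) (by positivity)
    ((div_lt_one hA).2 hlt) 1
  norm_num at h
  rw [← mul_sub, ← Real.log_div (by nlinarith) (by nlinarith [sq_nonneg (u - 1 / 2)])]
  have he : (1 + u / (u ^ 2 + y ^ 2)) / (1 - u / (u ^ 2 + y ^ 2))
      = ((u + 1 / 2) ^ 2 + (y ^ 2 - 1 / 4)) / ((u - 1 / 2) ^ 2 + (y ^ 2 - 1 / 4)) := by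
    rw [show (u + 1 / 2) ^ 2 + (y ^ 2 - 1 / 4) = (u ^ 2 + y ^ 2) + u by ring,
      show (u - 1 / 2) ^ 2 + (y ^ 2 - 1 / 4) = (u ^ 2 + y ^ 2) - u by ring]
    have : u ^ 2 + y ^ 2 - u ≠ 0 := by linarith
    field_simp
  rw [he] at h
  linarith

/-- Opposite bound: enlarging the denominator by 1/3 leaves room for the cubic error in
`half_log_div_le_cubic` once y² ≥ 1/3. -/
theorem half_log_sub_le_div {u y : ℝ} (hu : 0 < u) (hy : 1 / 3 ≤ y ^ 2) :
    1 / 2 * Real.log ((u + 1 / 2) ^ 2 + (y ^ 2 + 1 / 12))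
      - 1 / 2 * Real.log ((u - 1 / 2) ^ 2 + (y ^ 2 + 1 / 12)) ≤ u / (u ^ 2 + y ^ 2) := by
  set A := u ^ 2 + y ^ 2 + 1 / 3 with hA
  have hA0 : 0 < A := by positivity
  have hlt : u < A := by nlinarith [sq_nonneg (u - 1 / 2), sq_nonneg y]
  have h := half_log_div_le_cubic (x := u / A) (by positivity) ((div_lt_one hA0).2 hlt)
  rw [← mul_sub, ← Real.log_div (by positivity) (by positivity)]
  have he : (1 + u / A) / (1 - u / A)
      = ((u + 1 / 2) ^ 2 + (y ^ 2 + 1 / 12)) / ((u - 1 / 2) ^ 2 + (y ^ 2 + 1 / 12)) := by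
    rw [show (u + 1 / 2) ^ 2 + (y ^ 2 + 1 / 12) = A + u by rw [hA]; ring,
      show (u - 1 / 2) ^ 2 + (y ^ 2 + 1 / 12) = A - u by rw [hA]; ring]
    have : A - u ≠ 0 := by linarith
    field_simp
  rw [he] at h
  refine h.trans ?_
  have hAu : 0 < A ^ 2 - u ^ 2 := by nlinarith
  have h2 : u / A + (u / A) ^ 3 / (3 * (1 - (u / A) ^ 2))
      = u * (3 * (A ^ 2 - u ^ 2) + u ^ 2) / (3 * A * (A ^ 2 - u ^ 2)) := by
    have : 1 - (u / A) ^ 2 ≠ 0 := by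
      rw [div_pow, one_sub_div (by positivity)]; positivity
    field_simp
  rw [h2, div_le_div_iff₀ (by positivity) (by positivity)]
  have h3 : u ^ 2 + y ^ 2 = A - 1 / 3 := by rw [hA]; ring
  rw [h3]
  have h4 : u ^ 2 ≤ A - 1 / 3 := by rw [hA]; nlinarith [sq_nonneg y]
  have h5 : (3 * (A ^ 2 - u ^ 2) + u ^ 2) * (A - 1 / 3) ≤ 3 * A * (A ^ 2 - u ^ 2) := by
    have h6 : u ^ 2 * (1 / 3) ≤ u ^ 2 * y ^ 2 := by gcongr
    have h7 : A - u ^ 2 = y ^ 2 + 1 / 3 := by rw [hA]; ring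
    have h8 : u ^ 2 * (y ^ 2 + 1 / 3) ≤ A * (A - u ^ 2) := by
      rw [h7]; exact mul_le_mul_of_nonneg_right (by linarith) (by positivity)
    nlinarith
  nlinarith

theorem re_inv_quarter_add (y : ℝ) (j : ℕ) :
    (1 / ((1 / 4 + I * (y : ℂ)) + j)).re = ((j : ℝ) + 1 / 4) / (((j : ℝ) + 1 / 4) ^ 2 + y ^ 2) := by
  have h : ((1 / 4 + I * (y : ℂ)) + j) = (((j : ℝ) + 1 / 4 : ℝ) : ℂ) + (y : ℂ) * I := by
    push_cast; ring
  rw [h, one_div, inv_re, normSq_add_mul_I]; simp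

theorem im_inv_quarter_add (y : ℝ) (j : ℕ) :
    (1 / ((1 / 4 + I * (y : ℂ)) + j)).im = -(y / (((j : ℝ) + 1 / 4) ^ 2 + y ^ 2)) := by
  have h : ((1 / 4 + I * (y : ℂ)) + j) = (((j : ℝ) + 1 / 4 : ℝ) : ℂ) + (y : ℂ) * I := by
    push_cast; ring
  rw [h, one_div, inv_im, normSq_add_mul_I]; simp [neg_div]

theorem tendsto_re_digamma (y : ℝ) :
    Tendsto (fun n : ℕ => Real.log n - ∑ j ∈ Finset.range (n + 1),
      ((j : ℝ) + 1 / 4) / (((j : ℝ) + 1 / 4) ^ 2 + y ^ 2)) atTop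
      (𝓝 (digamma (1 / 4 + I * (y : ℂ))).re) := by
  refine ((continuous_re.tendsto _).comp
    (tendsto_log_sub_sum_digamma (s := 1 / 4 + I * y) (by simp))).congr fun n => ?_
  simp only [Function.comp, sub_re, re_sum, re_inv_quarter_add]
  rw [← natCast_log, ofReal_re]

theorem tendsto_im_digamma (y : ℝ) :
    Tendsto (fun n : ℕ => ∑ j ∈ Finset.range (n + 1), y / (((j : ℝ) + 1 / 4) ^ 2 + y ^ 2)) atTop
      (𝓝 (digamma (1 / 4 + I * (y : ℂ))).im) := by
  refine ((continuous_im.tendsto _).comp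
    (tendsto_log_sub_sum_digamma (s := 1 / 4 + I * y) (by simp))).congr fun n => ?_
  simp only [Function.comp, sub_im, im_sum, im_inv_quarter_add]
  rw [← natCast_log, ofReal_im]; simp

/-- In Gauss's formula every subtracted term decreases with y², and the term j = 0 does so strictly,
which survives the limit. -/
theorem strictMonoOn_re_digamma :
    StrictMonoOn (fun y : ℝ => (digamma (1 / 4 + I * (y : ℂ))).re) (Ici 0) := by
  intro y₁ h₁ y₂ h₂ hlt
  have h₁' : (0 : ℝ) ≤ y₁ := h₁
  have hsq : y₁ ^ 2 < y₂ ^ 2 := by nlinarith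
  set f : ℝ → ℕ → ℝ := fun y j => ((j : ℝ) + 1 / 4) / (((j : ℝ) + 1 / 4) ^ 2 + y ^ 2) with hf
  have hle : ∀ j, f y₂ j ≤ f y₁ j := fun j => by simp only [hf]; gcongr
  have h0 : f y₂ 0 < f y₁ 0 := by simp only [hf]; gcongr
  have h := (tendsto_re_digamma y₂).sub (tendsto_re_digamma y₁)
  have hge : f y₁ 0 - f y₂ 0 ≤ (digamma (1 / 4 + I * (y₂ : ℂ))).re
      - (digamma (1 / 4 + I * (y₁ : ℂ))).re := by
    refine ge_of_tendsto' h fun n => ?_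
    rw [sub_sub_sub_cancel_left, ← Finset.sum_sub_distrib]
    exact Finset.single_le_sum (f := fun j => f y₁ j - f y₂ j)
      (fun j _ => sub_nonneg.2 (hle j)) (Finset.mem_range.2 n.succ_pos)
  simp only
  linarith

theorem tendsto_log_sub_half_log {c : ℝ} (hc : 0 < c) :
    Tendsto (fun n : ℕ => Real.log n - 1 / 2 * Real.log (((n : ℝ) + 3 / 4) ^ 2 + c)) atTop (𝓝 0) := by
  have h1 : Tendsto (fun n : ℕ => (1 + 3 / 4 * (1 / (n : ℝ))) ^ 2 + c * (1 / (n : ℝ)) ^ 2) atTop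
      (𝓝 1) := by
    have := tendsto_one_div_atTop_nhds_zero_nat (𝕜 := ℝ)
    have h := (((this.const_mul (3 / 4)).const_add 1).pow 2).add ((this.pow 2).const_mul c)
    simpa using h
  have h2 := ((Real.continuousAt_log one_ne_zero).tendsto.comp h1).const_mul (-(1 / 2))
  rw [Real.log_one, mul_zero] at h2
  refine h2.congr' ?_
  filter_upwards [eventually_gt_atTop 0] with n hn
  have hn' : (0 : ℝ) < n := Nat.cast_pos.2 hn
  simp only [Function.comp]
  have : (1 + 3 / 4 * (1 / (n : ℝ))) ^ 2 + c * (1 / (n : ℝ)) ^ 2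
      = (((n : ℝ) + 3 / 4) ^ 2 + c) / (n : ℝ) ^ 2 := by field_simp
  rw [this, Real.log_div (by positivity) (by positivity), Real.log_pow]
  push_cast; ring

/-- Summing over u = j + 1/4 telescopes. The upper end cancels log n in the limit; the lower end
sits at -1/4, whence 1/16 - 1/4 = -3/16. -/
theorem le_re_digamma {y : ℝ} (hy : 1 / 4 < y ^ 2) :
    1 / 2 * Real.log (y ^ 2 - 3 / 16) ≤ (digamma (1 / 4 + I * (y : ℂ))).re := by
  have hl := (tendsto_log_sub_half_log (c := y ^ 2 - 1 / 4) (by linarith)).add_const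
    (1 / 2 * Real.log (y ^ 2 - 3 / 16))
  rw [zero_add] at hl
  refine le_of_tendsto_of_tendsto' hl (tendsto_re_digamma y) fun n => ?_
  have hsum : ∑ j ∈ Finset.range (n + 1), ((j : ℝ) + 1 / 4) / (((j : ℝ) + 1 / 4) ^ 2 + y ^ 2)
      ≤ 1 / 2 * Real.log (((n : ℝ) + 3 / 4) ^ 2 + (y ^ 2 - 1 / 4))
        - 1 / 2 * Real.log (y ^ 2 - 3 / 16) := by
    have := Finset.sum_range_sub
      (fun j : ℕ => 1 / 2 * Real.log (((j : ℝ) - 1 / 4) ^ 2 + (y ^ 2 - 1 / 4))) (n + 1)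
    have h0 : ((0 : ℕ) - 1 / 4 : ℝ) ^ 2 + (y ^ 2 - 1 / 4) = y ^ 2 - 3 / 16 := by push_cast; ring
    have h1 : (((n + 1 : ℕ) : ℝ) - 1 / 4) = (n : ℝ) + 3 / 4 := by push_cast; ring
    rw [h0, h1] at this
    rw [← this]
    refine Finset.sum_le_sum fun j _ => ?_
    have := div_le_half_log_sub (u := (j : ℝ) + 1 / 4) (by positivity) hy
    convert! this using 5 <;> push_cast <;> ring
  linarith

/-- The same telescoping, now with 1/16 + 1/12 = 7/48 at the lower end. -/
theorem re_digamma_le {y : ℝ} (hy : 1 / 3 ≤ y ^ 2) :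
    (digamma (1 / 4 + I * (y : ℂ))).re ≤ 1 / 2 * Real.log (y ^ 2 + 7 / 48) := by
  have hl := (tendsto_log_sub_half_log (c := y ^ 2 + 1 / 12) (by positivity)).add_const
    (1 / 2 * Real.log (y ^ 2 + 7 / 48))
  rw [zero_add] at hl
  refine le_of_tendsto_of_tendsto' (tendsto_re_digamma y) hl fun n => ?_
  have hsum : 1 / 2 * Real.log (((n : ℝ) + 3 / 4) ^ 2 + (y ^ 2 + 1 / 12))
        - 1 / 2 * Real.log (y ^ 2 + 7 / 48)
      ≤ ∑ j ∈ Finset.range (n + 1), ((j : ℝ) + 1 / 4) / (((j : ℝ) + 1 / 4) ^ 2 + y ^ 2) := by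
    have := Finset.sum_range_sub
      (fun j : ℕ => 1 / 2 * Real.log (((j : ℝ) - 1 / 4) ^ 2 + (y ^ 2 + 1 / 12))) (n + 1)
    have h0 : ((0 : ℕ) - 1 / 4 : ℝ) ^ 2 + (y ^ 2 + 1 / 12) = y ^ 2 + 7 / 48 := by push_cast; ring
    have h1 : (((n + 1 : ℕ) : ℝ) - 1 / 4) = (n : ℝ) + 3 / 4 := by push_cast; ring
    rw [h0, h1] at this
    rw [← this]
    refine Finset.sum_le_sum fun j _ => ?_
    have := half_log_sub_le_div (u := (j : ℝ) + 1 / 4) (by positivity) hy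
    convert! this using 5 <;> push_cast <;> ring
  linarith

/-- The choice of `c` makes the arctangent difference equal to arctan(c/(u² + y²)), which is at most
its argument; the left side telescopes in u. -/
theorem arctan_sub_le {u y c : ℝ} (hy : 0 < y) (hc : 0 < c) (hcy : c ^ 2 = y ^ 2 + 1 / 4) :
    y / c * (Real.arctan ((u + 1 / 2) / c) - Real.arctan ((u - 1 / 2) / c))
      ≤ y / (u ^ 2 + y ^ 2) := by
  have hpos : 0 < u ^ 2 + y ^ 2 := by positivity
  have hprod : (u + 1 / 2) / c * (-((u - 1 / 2) / c)) = 1 - (u ^ 2 + y ^ 2) / c ^ 2 := by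
    field_simp; rw [hcy]; ring
  have hlt : (u + 1 / 2) / c * (-((u - 1 / 2) / c)) < 1 := by
    rw [hprod]; have : 0 < (u ^ 2 + y ^ 2) / c ^ 2 := by positivity
    linarith
  have h := Real.arctan_add hlt
  rw [Real.arctan_neg, ← sub_eq_add_neg] at h
  rw [h]
  have he : ((u + 1 / 2) / c + -((u - 1 / 2) / c)) / (1 - (u + 1 / 2) / c * (-((u - 1 / 2) / c)))
      = c / (u ^ 2 + y ^ 2) := by
    rw [hprod, sub_sub_cancel]; field_simp; ring
  rw [he]
  have h2 : Real.arctan (c / (u ^ 2 + y ^ 2)) ≤ c / (u ^ 2 + y ^ 2) :=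
    by
      have h0 : 0 ≤ c / (u ^ 2 + y ^ 2) := by positivity
      have := Real.le_tan (Real.arctan_nonneg.2 h0) (Real.arctan_lt_pi_div_two _)
      rwa [Real.tan_arctan] at this
  calc _ ≤ y / c * (c / (u ^ 2 + y ^ 2)) := by gcongr
    _ = _ := by field_simp

theorem le_im_digamma {y c : ℝ} (hy : 0 < y) (hc : 0 < c) (hcy : c ^ 2 = y ^ 2 + 1 / 4) :
    y / c * (Real.pi / 2 + Real.arctan (1 / (4 * c))) ≤ (digamma (1 / 4 + I * (y : ℂ))).im := by
  have hlim : Tendsto (fun n : ℕ => y / c * (Real.arctan (((n : ℝ) + 3 / 4) / c)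
      + Real.arctan (1 / (4 * c)))) atTop
      (𝓝 (y / c * (Real.pi / 2 + Real.arctan (1 / (4 * c))))) := by
    have h1 : Tendsto (fun n : ℕ => ((n : ℝ) + 3 / 4) / c) atTop atTop :=
      (tendsto_atTop_add_const_right _ _ tendsto_natCast_atTop_atTop).atTop_div_const hc
    have h2 := (Real.tendsto_arctan_atTop.mono_right nhdsWithin_le_nhds).comp h1
    exact (h2.add_const _).const_mul _
  refine le_of_tendsto_of_tendsto' hlim (tendsto_im_digamma y) fun n => ?_
  have := Finset.sum_range_sub (fun j : ℕ => Real.arctan (((j : ℝ) - 1 / 4) / c)) (n + 1)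
  have h0 : Real.arctan ((((0 : ℕ) : ℝ) - 1 / 4) / c) = -Real.arctan (1 / (4 * c)) := by
    rw [← Real.arctan_neg]; congr 1; push_cast; field_simp; ring
  have h1 : (((n + 1 : ℕ) : ℝ) - 1 / 4) = (n : ℝ) + 3 / 4 := by push_cast; ring
  rw [h0, h1, sub_neg_eq_add] at this
  rw [← this, Finset.mul_sum]
  refine Finset.sum_le_sum fun j _ => ?_
  have := arctan_sub_le (u := (j : ℝ) + 1 / 4) hy hc hcy
  convert! this using 5 <;> push_cast <;> ring

/-! ### The derivative of ϑ and its positive zero. -/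

/-- The complex logarithmic derivative of the archimedean factor on the critical line has real part
`ϑ'`. -/
theorem hasDerivAt_riemannSiegelTheta (t : ℝ) :
    HasDerivAt riemannSiegelTheta
      (-(1 / 2) * Real.log Real.pi + 1 / 2 * (digamma (1 / 4 + I * ((t : ℂ) / 2))).re) t := by
  have hc : Continuous fun x : ℝ => (digamma (1 / 4 + I * ((x : ℂ) / 2))).re :=
    continuous_re.comp continuous_digamma_quarter_line
  have h1 := (hc.integral_hasStrictDerivAt 0 t).hasDerivAt.const_mul (1 / 2)
  have h2 : HasDerivAt (fun t : ℝ => -(t / 2) * Real.log Real.pi) (-(1 / 2) * Real.log Real.pi) t :=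
    (((hasDerivAt_id t).div_const 2).neg.mul_const _).congr_deriv (by simp)
  exact h2.add h1

theorem deriv_riemannSiegelTheta (t : ℝ) : deriv riemannSiegelTheta t
    = -(1 / 2) * Real.log Real.pi + 1 / 2 * (digamma (1 / 4 + I * ((t / 2 : ℝ) : ℂ))).re := by
  rw [(hasDerivAt_riemannSiegelTheta t).deriv]; push_cast; rfl

theorem continuous_deriv_riemannSiegelTheta : Continuous (deriv riemannSiegelTheta) := by
  have hc : Continuous fun x : ℝ => (digamma (1 / 4 + I * ((x : ℂ) / 2))).re :=
    continuous_re.comp continuous_digamma_quarter_line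
  have : deriv riemannSiegelTheta = fun t : ℝ =>
      -(1 / 2) * Real.log Real.pi + 1 / 2 * (digamma (1 / 4 + I * ((t : ℂ) / 2))).re :=
    funext fun t => (hasDerivAt_riemannSiegelTheta t).deriv
  rw [this]; fun_prop

theorem re_digamma_neg (y : ℝ) :
    (digamma (1 / 4 + I * ((-y : ℝ) : ℂ))).re = (digamma (1 / 4 + I * (y : ℂ))).re :=
  tendsto_nhds_unique (tendsto_re_digamma (-y)) (by simpa using tendsto_re_digamma y)

theorem im_digamma_neg (y : ℝ) :
    (digamma (1 / 4 + I * ((-y : ℝ) : ℂ))).im = -(digamma (1 / 4 + I * (y : ℂ))).im :=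
  tendsto_nhds_unique (tendsto_im_digamma (-y)) (by
    refine (tendsto_im_digamma y).neg.congr fun n => ?_
    rw [← Finset.sum_neg_distrib]; simp [neg_div])

theorem deriv_riemannSiegelTheta_neg (t : ℝ) :
    deriv riemannSiegelTheta (-t) = deriv riemannSiegelTheta t := by
  rw [deriv_riemannSiegelTheta, deriv_riemannSiegelTheta, neg_div, re_digamma_neg]

theorem strictMonoOn_deriv_riemannSiegelTheta :
    StrictMonoOn (deriv riemannSiegelTheta) (Ici 0) := by
  intro a ha b hb hab
  have ha' : (0 : ℝ) ≤ a := ha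
  have := strictMonoOn_re_digamma (show a / 2 ∈ Ici (0 : ℝ) by simp; linarith)
    (show b / 2 ∈ Ici (0 : ℝ) by simp; linarith) (by linarith : a / 2 < b / 2)
  rw [deriv_riemannSiegelTheta, deriv_riemannSiegelTheta]
  simp only at this
  linarith

/-- ϑ' vanishes where Re ψ(1/4 + it/2) = log π. The two digamma bounds, both close to log(t/2),
enclose (t₀/2)² around π². -/
theorem exists_deriv_riemannSiegelTheta_eq_zero : ∃ t₀ : ℝ, 0 < t₀ ∧
    deriv riemannSiegelTheta t₀ = 0 ∧
    Real.pi ^ 2 - 7 / 48 ≤ (t₀ / 2) ^ 2 ∧ (t₀ / 2) ^ 2 ≤ Real.pi ^ 2 + 3 / 16 := by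
  have hpi := Real.pi_gt_three
  have hpi4 := Real.pi_lt_d2
  have hlogpi : Real.log Real.pi = 1 / 2 * Real.log (Real.pi ^ 2) := by
    rw [Real.log_pow]; push_cast; ring
  have h1 : deriv riemannSiegelTheta 2 < 0 := by
    rw [deriv_riemannSiegelTheta]
    have h := re_digamma_le (y := 2 / 2) (by norm_num)
    have h2 : Real.log ((2 / 2) ^ 2 + 7 / 48) < Real.log (Real.pi ^ 2) :=
      Real.log_lt_log (by norm_num) (by nlinarith)
    linarith
  have h2 : 0 < deriv riemannSiegelTheta 8 := by
    rw [deriv_riemannSiegelTheta]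
    have h := le_re_digamma (y := 8 / 2) (by norm_num)
    have h2 : Real.log (Real.pi ^ 2) < Real.log ((8 / 2) ^ 2 - 3 / 16) :=
      Real.log_lt_log (by positivity) (by nlinarith)
    linarith
  obtain ⟨t₀, ht₀, hz⟩ := intermediate_value_Icc (show (2 : ℝ) ≤ 8 by norm_num)
    continuous_deriv_riemannSiegelTheta.continuousOn ⟨h1.le, h2.le⟩
  have hre : (digamma (1 / 4 + I * ((t₀ / 2 : ℝ) : ℂ))).re = 1 / 2 * Real.log (Real.pi ^ 2) := by
    rw [deriv_riemannSiegelTheta] at hz; linarith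
  have hsq : 1 ≤ (t₀ / 2) ^ 2 := by nlinarith [ht₀.1]
  refine ⟨t₀, by linarith [ht₀.1], hz, ?_, ?_⟩
  · have h := re_digamma_le (y := t₀ / 2) (by linarith)
    rw [hre] at h
    have := (Real.log_le_log_iff (by positivity) (by positivity)).1
      (by linarith : Real.log (Real.pi ^ 2) ≤ Real.log ((t₀ / 2) ^ 2 + 7 / 48))
    linarith
  · have h := le_re_digamma (y := t₀ / 2) (by linarith)
    rw [hre] at h
    have := (Real.log_le_log_iff (by linarith) (by positivity)).1
      (by linarith : Real.log ((t₀ / 2) ^ 2 - 3 / 16) ≤ Real.log (Real.pi ^ 2))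
    linarith

theorem div_sqrt_le_arctan {x : ℝ} (hx : 0 ≤ x) : x / √(1 + x ^ 2) ≤ Real.arctan x := by
  rw [← Real.sin_arctan]; exact Real.sin_le (Real.arctan_nonneg.2 hx)

theorem im_digamma_gt {y : ℝ} (hy : 0 < y) (h1 : Real.pi ^ 2 - 7 / 48 ≤ y ^ 2)
    (h2 : y ^ 2 ≤ Real.pi ^ 2 + 3 / 16) : 1.626 < (digamma (1 / 4 + I * (y : ℂ))).im := by
  have hp1 := Real.pi_gt_d4
  have hp2 := Real.pi_lt_d4
  have hyl : 9.72 ≤ y ^ 2 := by nlinarith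
  have hyu : y ^ 2 ≤ 10.058 := by nlinarith
  set c := √(y ^ 2 + 1 / 4) with hc
  have hc2 : c ^ 2 = y ^ 2 + 1 / 4 := Real.sq_sqrt (by positivity)
  have hc0 : 0 < c := Real.sqrt_pos.2 (by positivity)
  have hcu : c ≤ 3.211 := by nlinarith
  have hcl : 3 ≤ c := by nlinarith
  have h := le_im_digamma hy hc0 hc2
  have hx : 0.0778 ≤ 1 / (4 * c) := by rw [le_div_iff₀ (by positivity)]; linarith
  have hat : 0.077 ≤ Real.arctan (1 / (4 * c)) := by
    refine le_trans ?_ (Real.arctan_strictMono.monotone hx)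
    refine le_trans ?_ (div_sqrt_le_arctan (by norm_num))
    rw [le_div_iff₀ (by positivity)]
    have : √(1 + 0.0778 ^ 2) ≤ 1.0099 := Real.sqrt_le_iff.2 ⟨by norm_num, by norm_num⟩
    linarith
  have hyc : 0.9872 ≤ y / c := by
    rw [le_div_iff₀ hc0]
    refine le_of_sq_le_sq ?_ hy.le
    rw [mul_pow, hc2]; nlinarith
  nlinarith

/-! ### Riemann's integral for Λ on the critical line. -/

/-- `∑_{n ≠ 0} exp (-π n² x)`, the nonconstant part of the theta function. -/
noncomputable def thetaTail (x : ℝ) : ℝ := HurwitzZeta.evenKernel 0 x - 1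

theorem hasSum_thetaTail {x : ℝ} (hx : 0 < x) :
    HasSum (fun n : ℕ => 2 * Real.exp (-Real.pi * (n + 1) ^ 2 * x)) (thetaTail x) := by
  have := HurwitzZeta.hasSum_nat_cosKernel₀ 0 hx
  rw [thetaTail, HurwitzZeta.evenKernel_eq_cosKernel_of_zero]
  simpa using this

theorem two_mul_exp_le_thetaTail {x : ℝ} (hx : 0 < x) :
    2 * Real.exp (-Real.pi * x) ≤ thetaTail x := by
  simpa using le_hasSum (hasSum_thetaTail hx) 0 fun n _ => by positivity

theorem exp_neg_three_pi_le : Real.exp (-(3 * Real.pi)) ≤ 1 / 8000 := by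
  rw [Real.exp_neg, one_div]
  apply inv_anti₀ (by norm_num)
  have h1 : Real.exp 1 ^ 9 ≤ Real.exp (3 * Real.pi) := by
    rw [← Real.exp_nat_mul]
    refine Real.exp_le_exp.2 ?_
    push_cast
    linarith [Real.pi_gt_three]
  have h2 : (2.718 : ℝ) ^ 9 ≤ Real.exp 1 ^ 9 := by
    gcongr
    linarith [Real.exp_one_gt_d9]
  refine le_trans ?_ (h2.trans h1)
  norm_num

/-- Since (n+1)² - 1 ≥ 3n, the tail is dominated by a geometric series of ratio exp(-3π) ≤ 1/8000.
-/
theorem thetaTail_le {x : ℝ} (hx : 1 ≤ x) :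
    thetaTail x ≤ 2 * Real.exp (-Real.pi * x) * (1 + 1 / 5000) := by
  have h0 : 0 < x := by linarith
  have hq : Real.exp (-(3 * Real.pi)) < 1 := by linarith [exp_neg_three_pi_le]
  have hg := (hasSum_geometric_of_lt_one (Real.exp_pos _).le hq).mul_left (2 * Real.exp (-Real.pi * x))
  have hle : thetaTail x ≤ 2 * Real.exp (-Real.pi * x) * (1 - Real.exp (-(3 * Real.pi)))⁻¹ := by
    refine hasSum_le (fun n => ?_) (hasSum_thetaTail h0) hg
    rw [mul_assoc 2, ← Real.exp_nat_mul, ← Real.exp_add]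
    have hp := Real.pi_pos
    have hn : (0 : ℝ) ≤ n := n.cast_nonneg
    have : (n : ℝ) ≤ n ^ 2 := by
      rcases Nat.eq_zero_or_pos n with rfl | h
      · simp
      · have : (1 : ℝ) ≤ n := by exact_mod_cast h
        nlinarith
    have h3 : 3 * (n : ℝ) ≤ ((n : ℝ) ^ 2 + 2 * n) * x := by nlinarith
    gcongr
    nlinarith [mul_le_mul_of_nonneg_left h3 hp.le]
  refine hle.trans ?_
  gcongr
  rw [inv_le_comm₀ (by linarith) (by norm_num)]
  have := exp_neg_three_pi_le
  norm_num
  linarith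

theorem thetaTail_nonneg {x : ℝ} (hx : 0 < x) : 0 ≤ thetaTail x :=
  le_trans (by positivity) (two_mul_exp_le_thetaTail hx)

theorem continuousOn_thetaTail : ContinuousOn thetaTail (Ici 1) :=
  ContinuousOn.sub ((HurwitzZeta.continuousOn_evenKernel 0).mono fun _ hx =>
    zero_lt_one.trans_le (mem_Ici.1 hx)) continuousOn_const

theorem integrableOn_thetaTail_mul_rpow (r : ℝ) :
    IntegrableOn (fun x => thetaTail x * x ^ r) (Ioi 1) := by
  refine integrable_of_isBigO_exp_neg (b := 1) one_pos
    (continuousOn_thetaTail.mul ?_) ?_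
  · exact continuousOn_id.rpow_const fun x hx => Or.inl (zero_lt_one.trans_le hx).ne'
  · have h1 : thetaTail =O[atTop] fun x => Real.exp (-Real.pi * x) := by
      refine Asymptotics.IsBigO.of_bound 4 ?_
      filter_upwards [eventually_ge_atTop 1] with x hx
      rw [Real.norm_of_nonneg (thetaTail_nonneg (by linarith)),
        Real.norm_of_nonneg (Real.exp_pos _).le]
      nlinarith [thetaTail_le hx, Real.exp_pos (-Real.pi * x)]
    have h2 : (fun x : ℝ => x ^ r) =O[atTop] fun x => Real.exp ((Real.pi - 1) * x) :=
      (isLittleO_rpow_exp_pos_mul_atTop r (by linarith [Real.pi_gt_three])).isBigO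
    refine (h1.mul h2).congr_right fun x => ?_
    rw [← Real.exp_add]; ring_nf

/-- The part of `thetaTail` above `1`, complex valued. -/
noncomputable def thetaTailInd : ℝ → ℂ := (Ioi 1).indicator fun x => (thetaTail x : ℂ)

/-- The functional equation folds (0, 1) onto (1, ∞), so only the rapidly decaying part above 1
remains in the Mellin transform. -/
theorem f_modif_hurwitzEvenFEPair {x : ℝ} (hx : 0 < x) :
    (HurwitzZeta.hurwitzEvenFEPair 0).f_modif x
      = thetaTailInd x + (x : ℂ) ^ (-(1 / 2) : ℂ) • thetaTailInd x⁻¹ := by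
  have hf : (HurwitzZeta.hurwitzEvenFEPair 0).f x = (HurwitzZeta.evenKernel 0 x : ℂ) := rfl
  have hf0 : (HurwitzZeta.hurwitzEvenFEPair 0).f₀ = 1 := by simp [HurwitzZeta.hurwitzEvenFEPair]
  have hg0 : (HurwitzZeta.hurwitzEvenFEPair 0).g₀ = 1 := rfl
  have he : (HurwitzZeta.hurwitzEvenFEPair 0).ε = 1 := rfl
  have hk : (HurwitzZeta.hurwitzEvenFEPair 0).k = 1 / 2 := rfl
  rw [WeakFEPair.f_modif, Pi.add_apply, thetaTailInd]
  rcases lt_trichotomy 1 x with h | rfl | h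
  · have h' : ¬ 1 < x⁻¹ := by rw [not_lt]; exact inv_le_one_of_one_le₀ h.le
    simp [indicator, h, h.not_gt, h', hf, hf0, thetaTail]
  · simp
  · have h' : 1 < x⁻¹ := (one_lt_inv₀ hx).2 h
    have hfe := HurwitzZeta.evenKernel_functional_equation 0 x
    rw [← HurwitzZeta.evenKernel_eq_cosKernel_of_zero, one_div x] at hfe
    have hc : (x : ℂ) ^ (-(1 / 2) : ℂ) = ((x ^ (-(1 / 2) : ℝ) : ℝ) : ℂ) := by
      rw [ofReal_cpow hx.le]; push_cast; rfl
    simp only [indicator, mem_Ioi, h.not_gt, mem_Ioo, h, h', hx, hf, hg0, he, hk, thetaTail,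
      if_true, if_false, and_self, hc, hfe, smul_eq_mul]
    rw [Real.rpow_neg hx.le]
    push_cast
    ring

theorem cpow_smul_thetaTailInd (s : ℂ) (x : ℝ) : (x : ℂ) ^ (s - 1) • thetaTailInd x
    = (Ioi 1).indicator (fun x : ℝ => (x : ℂ) ^ (s - 1) * (thetaTail x : ℂ)) x := by
  by_cases h : x ∈ Ioi 1 <;> simp [thetaTailInd, indicator, h]

theorem integrableOn_cpow_mul_thetaTail (s : ℂ) :
    IntegrableOn (fun x : ℝ => (x : ℂ) ^ (s - 1) * (thetaTail x : ℂ)) (Ioi 1) := by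
  refine (integrableOn_thetaTail_mul_rpow (s.re - 1)).mono' ?_ ?_
  · refine ContinuousOn.aestronglyMeasurable (fun x hx => ?_) measurableSet_Ioi
    have h0 : (0 : ℝ) < x := zero_lt_one.trans hx
    refine ContinuousWithinAt.mul ?_ ?_
    · exact (continuousAt_ofReal_cpow_const x (s - 1) (Or.inr h0.ne')).continuousWithinAt
    · exact continuous_ofReal.continuousAt.comp_continuousWithinAt
        ((continuousOn_thetaTail.mono Ioi_subset_Ici_self) x hx)
  · refine (ae_restrict_iff' measurableSet_Ioi).2 (ae_of_all _ fun x hx => ?_)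
    have h0 : (0 : ℝ) < x := zero_lt_one.trans hx
    rw [norm_mul, norm_cpow_eq_rpow_re_of_pos h0, norm_real,
      Real.norm_of_nonneg (thetaTail_nonneg h0), mul_comm]
    simp

theorem mellinConvergent_thetaTailInd (s : ℂ) : MellinConvergent thetaTailInd s := by
  unfold MellinConvergent
  simp only [cpow_smul_thetaTailInd]
  exact ((integrable_indicator_iff measurableSet_Ioi).2
    (integrableOn_cpow_mul_thetaTail s)).integrableOn

theorem mellin_thetaTailInd (s : ℂ) :
    mellin thetaTailInd s = ∫ x in Ioi (1 : ℝ), (x : ℂ) ^ (s - 1) * (thetaTail x : ℂ) := by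
  unfold mellin
  simp only [cpow_smul_thetaTailInd]
  rw [setIntegral_indicator measurableSet_Ioi, Ioi_inter_Ioi]
  simp

theorem completedRiemannZeta₀_eq_mellin (s : ℂ) : completedRiemannZeta₀ s
    = (mellin thetaTailInd (s / 2) + mellin thetaTailInd ((1 - s) / 2)) / 2 := by
  have h1 : completedRiemannZeta₀ s = (HurwitzZeta.hurwitzEvenFEPair 0).Λ₀ (s / 2) / 2 := rfl
  rw [h1, WeakFEPair.Λ₀]
  congr 1
  have h2 : mellin (HurwitzZeta.hurwitzEvenFEPair 0).f_modif (s / 2) = mellin (fun x : ℝ =>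
      thetaTailInd x + (x : ℂ) ^ (-(1 / 2) : ℂ) • thetaTailInd x⁻¹) (s / 2) :=
    setIntegral_congr_fun measurableSet_Ioi fun x hx => by
      simp only [f_modif_hurwitzEvenFEPair hx]
  have h3 : MellinConvergent (fun x : ℝ => (x : ℂ) ^ (-(1 / 2) : ℂ) • thetaTailInd x⁻¹) (s / 2) := by
    rw [MellinConvergent.cpow_smul]
    have := (MellinConvergent.comp_rpow (f := thetaTailInd) (s := s / 2 + -(1 / 2))
      (a := -1) (by norm_num)).2 (mellinConvergent_thetaTailInd _)
    simpa only [Real.rpow_neg_one] using this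
  rw [h2, (hasMellin_add (mellinConvergent_thetaTailInd _) h3).2, mellin_cpow_smul, mellin_comp_inv]
  congr 2
  ring

/-- At s = 1/2 + it the powers x^(s/2-1) and x^((1-s)/2-1) are conjugate and add up to a cosine, and
the polar terms combine through s(1-s) = 1/4 + t². -/
theorem completedZetaLine_eq_integral (t : ℝ) : completedZetaLine t
    = (∫ x in Ioi (1 : ℝ), thetaTail x * x ^ (-(3 / 4) : ℝ) * Real.cos (t / 2 * Real.log x))
      - 1 / (1 / 4 + t ^ 2) := by
  have h1 : completedRiemannZeta (1 / 2 + I * t) = ((∫ x in Ioi (1 : ℝ),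
      thetaTail x * x ^ (-(3 / 4) : ℝ) * Real.cos (t / 2 * Real.log x) : ℝ) : ℂ)
        - ((1 / (1 / 4 + t ^ 2) : ℝ) : ℂ) := by
    have hs := critical_line_ne t
    have hs' : (1 : ℂ) - (1 / 2 + I * t) ≠ 0 := sub_ne_zero.2 hs.2.symm
    have hm : (1 / 2 + I * t : ℂ) * (1 - (1 / 2 + I * t)) = ((1 / 4 + t ^ 2 : ℝ) : ℂ) := by
      push_cast; linear_combination -(t : ℂ) ^ 2 * I_sq
    rw [completedRiemannZeta_eq, sub_sub, div_add_div _ _ hs.1 hs', hm]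
    congr 1
    · rw [completedRiemannZeta₀_eq_mellin, mellin_thetaTailInd, mellin_thetaTailInd,
        ← integral_add (integrableOn_cpow_mul_thetaTail _) (integrableOn_cpow_mul_thetaTail _),
        ← integral_div, ← integral_complex_ofReal]
      refine setIntegral_congr_fun measurableSet_Ioi fun x hx => ?_
      have h0 : (0 : ℝ) < x := zero_lt_one.trans hx
      have hx0 : (x : ℂ) ≠ 0 := ofReal_ne_zero.2 h0.ne'
      have e1 : ((1 / 2 + I * t : ℂ)) / 2 - 1
          = ((-(3 / 4) : ℝ) : ℂ) + ((t / 2 : ℝ) : ℂ) * I := by push_cast; ring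
      have e2 : ((1 - (1 / 2 + I * t) : ℂ)) / 2 - 1
          = ((-(3 / 4) : ℝ) : ℂ) + -(((t / 2 : ℝ) : ℂ) * I) := by push_cast; ring
      rw [e1, e2, cpow_add _ _ hx0, cpow_add _ _ hx0, ← ofReal_cpow h0.le,
        cpow_def_of_ne_zero hx0 (_ * I), cpow_def_of_ne_zero hx0 (-(_ * I)), ← ofReal_log h0.le]
      push_cast
      rw [Complex.cos]
      have e3 : (Real.log x : ℂ) * (t / 2 * I) = t / 2 * Real.log x * I := by ring
      have e4 : (Real.log x : ℂ) * -(t / 2 * I) = -(t / 2 * Real.log x) * I := by ring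
      rw [e3, e4]
      ring
    · push_cast; ring
  rw [completedZetaLine, h1, ← ofReal_sub, ofReal_re]

theorem integrableOn_thetaTail_mul_of_abs_le {f : ℝ → ℝ} {C : ℝ} (hf : ContinuousOn f (Ioi 1))
    (hC : ∀ x, 1 < x → |f x| ≤ C * x) :
    IntegrableOn (fun x => thetaTail x * x ^ (-(3 / 4) : ℝ) * f x) (Ioi 1) := by
  refine ((integrableOn_thetaTail_mul_rpow (1 / 4)).const_mul C).mono' ?_ ?_
  · refine ContinuousOn.aestronglyMeasurable ?_ measurableSet_Ioi
    refine ((continuousOn_thetaTail.mono Ioi_subset_Ici_self).mul ?_).mul hf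
    exact continuousOn_id.rpow_const fun x hx => Or.inl (zero_lt_one.trans hx).ne'
  · refine (ae_restrict_iff' measurableSet_Ioi).2 (ae_of_all _ fun x hx => ?_)
    have h0 : (0 : ℝ) < x := zero_lt_one.trans hx
    have hT := thetaTail_nonneg h0
    have hr : x ^ (1 / 4 : ℝ) = x ^ (-(3 / 4) : ℝ) * x := by
      rw [← Real.rpow_add_one h0.ne']; norm_num
    rw [norm_mul, Real.norm_of_nonneg (by positivity), Real.norm_eq_abs, hr]
    calc _ ≤ thetaTail x * x ^ (-(3 / 4) : ℝ) * (C * x) := by gcongr; exact hC x hx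
      _ = _ := by ring

theorem continuousOn_log_Ioi_one : ContinuousOn Real.log (Ioi 1) :=
  Real.continuousOn_log.mono fun _ hx => (zero_lt_one.trans hx).ne'

theorem integrableOn_thetaTail_mul_cos (a : ℝ) : IntegrableOn
    (fun x => thetaTail x * x ^ (-(3 / 4) : ℝ) * Real.cos (a * Real.log x)) (Ioi 1) :=
  integrableOn_thetaTail_mul_of_abs_le (C := 1)
    (Real.continuous_cos.comp_continuousOn (continuousOn_const.mul continuousOn_log_Ioi_one))
    fun x hx => (Real.abs_cos_le_one _).trans (by linarith)

theorem abs_log_mul_sin_le {x : ℝ} (hx : 1 < x) (q : ℝ) : |Real.log x * Real.sin q| ≤ x := by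
  have h0 := Real.log_nonneg hx.le
  have h1 := Real.log_le_sub_one_of_pos (zero_lt_one.trans hx)
  rw [abs_mul, abs_of_nonneg h0]
  nlinarith [Real.abs_sin_le_one q, abs_nonneg (Real.sin q)]

theorem integrableOn_thetaTail_mul_log_mul_sin (a : ℝ) : IntegrableOn
    (fun x => thetaTail x * x ^ (-(3 / 4) : ℝ) * (Real.log x * Real.sin (a * Real.log x)))
    (Ioi 1) :=
  integrableOn_thetaTail_mul_of_abs_le (C := 1)
    (continuousOn_log_Ioi_one.mul
      (Real.continuous_sin.comp_continuousOn (continuousOn_const.mul continuousOn_log_Ioi_one)))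
    fun x hx => by simpa using abs_log_mul_sin_le hx _

theorem hasDerivAt_completedZetaLine (t : ℝ) : HasDerivAt completedZetaLine
    (2 * t / (1 / 4 + t ^ 2) ^ 2 - 1 / 2 * ∫ x in Ioi (1 : ℝ),
      thetaTail x * x ^ (-(3 / 4) : ℝ) * (Real.log x * Real.sin (t / 2 * Real.log x))) t := by
  rw [funext completedZetaLine_eq_integral]
  have h1 := (hasDerivAt_integral_of_dominated_loc_of_deriv_le (μ := volume.restrict (Ioi 1))
    (F := fun t x => thetaTail x * x ^ (-(3 / 4) : ℝ) * Real.cos (t / 2 * Real.log x))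
    (F' := fun t x => -(1 / 2) * (thetaTail x * x ^ (-(3 / 4) : ℝ)
      * (Real.log x * Real.sin (t / 2 * Real.log x))))
    (bound := fun x => thetaTail x * x ^ (-(3 / 4) : ℝ) * x) (x₀ := t) univ_mem
    (Eventually.of_forall fun t => (integrableOn_thetaTail_mul_cos (t / 2)).aestronglyMeasurable)
    (integrableOn_thetaTail_mul_cos (t / 2))
    ((integrableOn_thetaTail_mul_log_mul_sin (t / 2)).const_mul _).aestronglyMeasurable
    ?_ (integrableOn_thetaTail_mul_of_abs_le (C := 1) continuousOn_id fun x hx => by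
      simp [abs_of_pos (zero_lt_one.trans hx)]) ?_).2
  · rw [integral_const_mul] at h1
    have h2 : HasDerivAt (fun t : ℝ => 1 / (1 / 4 + t ^ 2))
        (-(2 * t / (1 / 4 + t ^ 2) ^ 2)) t := by
      have h3 : HasDerivAt (fun t : ℝ => 1 / 4 + t ^ 2) (2 * t) t := by
        simpa using (hasDerivAt_pow 2 t).const_add (1 / 4)
      have := h3.inv (by positivity)
      simp only [one_div]
      simp only [one_div] at this
      exact this.congr_deriv (by ring)
    exact (h1.sub h2).congr_deriv (by ring)
  · refine (ae_restrict_iff' measurableSet_Ioi).2 (ae_of_all _ fun x hx s _ => ?_)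
    have h0 : (0 : ℝ) < x := zero_lt_one.trans hx
    have hT := thetaTail_nonneg h0
    have := abs_log_mul_sin_le hx (s / 2 * Real.log x)
    rw [norm_mul, norm_mul, Real.norm_of_nonneg (by positivity : (0:ℝ) ≤ thetaTail x * _),
      Real.norm_eq_abs, Real.norm_eq_abs]
    calc _ ≤ 1 * (thetaTail x * x ^ (-(3 / 4) : ℝ) * x) := by
          gcongr; norm_num [abs_of_pos]
      _ = _ := one_mul _
  · refine (ae_restrict_iff' measurableSet_Ioi).2 (ae_of_all _ fun x hx s _ => ?_)
    have h3 : HasDerivAt (fun s : ℝ => s / 2 * Real.log x) (1 / 2 * Real.log x) s :=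
      ((hasDerivAt_id s).div_const 2).mul_const _
    exact ((h3.cos).const_mul _).congr_deriv (by ring)

/-! ### Explicit estimates: the signs of R and of R' + hR at the turning point. -/

/-- An integral is bounded without being evaluated: -S' dominates the integrand and S is eventually
nonnegative, so only S(a) has to be computed. -/
theorem setIntegral_Ioi_le_of_hasDerivAt {φ S S' : ℝ → ℝ} {a : ℝ}
    (hS : ∀ x, a ≤ x → HasDerivAt S (S' x) x) (hφ : IntegrableOn φ (Ioi a))
    (hle : ∀ x, a < x → φ x ≤ -S' x) (hnn : ∀ᶠ x in atTop, 0 ≤ S x) :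
    ∫ x in Ioi a, φ x ≤ S a := by
  refine le_of_tendsto (intervalIntegral_tendsto_integral_Ioi a hφ tendsto_id) ?_
  filter_upwards [hnn, eventually_ge_atTop a] with b hb hab
  have h := intervalIntegral.integral_le_sub_of_hasDeriv_right_of_le (g := fun x => -S x)
    (g' := fun x => -S' x) (φ := φ) hab
    (fun x hx => (hS x hx.1).neg.continuousAt.continuousWithinAt)
    (fun x hx => (hS x hx.1.le).neg.hasDerivWithinAt)
    ((hφ.mono_set Ioc_subset_Ioi_self).congr_set_ae Ioc_ae_eq_Icc.symm) (fun x hx => hle x hx.1)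
  simp only [id]
  linarith

theorem hasDerivAt_exp_mul_rpow_mul {Q : ℝ → ℝ} {Q' x : ℝ} (hx : 0 < x) (hQ : HasDerivAt Q Q' x) :
    HasDerivAt (fun x => Real.exp (-Real.pi * x) * x ^ (-(3 / 4) : ℝ) * Q x)
      (-(Real.exp (-Real.pi * x) * x ^ (-(3 / 4) : ℝ) * ((Real.pi + 3 / 4 / x) * Q x - Q'))) x := by
  have h1 : HasDerivAt (fun x : ℝ => Real.exp (-Real.pi * x))
      (Real.exp (-Real.pi * x) * (-Real.pi)) x := by
    simpa using ((hasDerivAt_id x).const_mul (-Real.pi)).exp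
  have h2 : HasDerivAt (fun x : ℝ => x ^ (-(3 / 4) : ℝ))
      (-(3 / 4) * (x ^ (-(3 / 4) : ℝ) / x)) x := by
    have := Real.hasDerivAt_rpow_const (x := x) (p := -(3 / 4)) (Or.inl hx.ne')
    rwa [Real.rpow_sub_one hx.ne'] at this
  exact ((h1.mul h2).mul hQ).congr_deriv (by simp only [Pi.mul_apply]; field_simp; ring)

theorem cos_le_one_sub_sq_add_pow_four {q : ℝ} (hq : 0 ≤ q) :
    Real.cos q ≤ 1 - q ^ 2 / 2 + q ^ 4 / 24 := by
  have hd : ∀ x : ℝ, HasDerivAt (fun q : ℝ => 1 - q ^ 2 / 2 + q ^ 4 / 24 - Real.cos q)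
      (-x + x ^ 3 / 6 + Real.sin x) x := fun x => by
    have := ((((hasDerivAt_pow 2 x).div_const 2).const_sub 1).add
      ((hasDerivAt_pow 4 x).div_const 24)).sub (Real.hasDerivAt_cos x)
    exact this.congr_deriv (by norm_num; ring)
  have hm : MonotoneOn (fun q : ℝ => 1 - q ^ 2 / 2 + q ^ 4 / 24 - Real.cos q) (Ici 0) := by
    refine monotoneOn_of_deriv_nonneg (convex_Ici 0)
      (fun x _ => (hd x).continuousAt.continuousWithinAt)
      (fun x _ => (hd x).differentiableAt.differentiableWithinAt) fun x hx => ?_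
    rw [interior_Ici] at hx
    rw [(hd x).deriv]
    linarith [Real.sin_ge_sub_cube (le_of_lt hx)]
  have := hm self_mem_Ici hq hq
  simp at this
  linarith

theorem sinh_sub_cube_le {w : ℝ} (hw : 0 ≤ w) : Real.sinh w - Real.sinh w ^ 3 / 6 ≤ w := by
  have hd : ∀ x : ℝ, HasDerivAt (fun w : ℝ => w - (Real.sinh w - Real.sinh w ^ 3 / 6))
      ((Real.cosh x - 1) ^ 2 * (Real.cosh x + 2) / 2) x := fun x => by
    have h := Real.hasDerivAt_sinh x
    have := (hasDerivAt_id x).sub (h.sub ((h.pow 3).div_const 6))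
    refine this.congr_deriv ?_
    have := Real.cosh_sq x
    norm_num
    linear_combination (-Real.cosh x / 2) * this
  have hm : MonotoneOn (fun w : ℝ => w - (Real.sinh w - Real.sinh w ^ 3 / 6)) (Ici 0) := by
    refine monotoneOn_of_deriv_nonneg (convex_Ici 0)
      (fun x _ => (hd x).continuousAt.continuousWithinAt)
      (fun x _ => (hd x).differentiableAt.differentiableWithinAt) fun x _ => ?_
    rw [(hd x).deriv]
    have := Real.one_le_cosh x
    positivity
  have := hm self_mem_Ici hw hw
  simp at this
  linarith

/-- Makes z = (x-1)²/x a rational substitute for log² x, with two-sided error control from sinh. -/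
theorem sub_one_sq_div_eq {x : ℝ} (hx : 0 < x) :
    (x - 1) ^ 2 / x = 4 * Real.sinh (Real.log x / 2) ^ 2 := by
  have h : Real.cosh (Real.log x) = 1 + 2 * Real.sinh (Real.log x / 2) ^ 2 := by
    have := Real.cosh_two_mul (Real.log x / 2)
    rw [Real.cosh_sq, mul_div_cancel₀ _ two_ne_zero] at this
    linarith
  rw [Real.cosh_log hx] at h
  have : (x - 1) ^ 2 / x = x + x⁻¹ - 2 := by field_simp; ring
  rw [this]; linarith

theorem log_sq_le {x : ℝ} (hx : 1 ≤ x) : Real.log x ^ 2 ≤ (x - 1) ^ 2 / x := by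
  rw [sub_one_sq_div_eq (by linarith)]
  have h0 : 0 ≤ Real.log x / 2 := by have := Real.log_nonneg hx; positivity
  nlinarith [Real.self_le_sinh_iff.2 h0]

theorem le_log_sq {x : ℝ} (hx : 1 ≤ x) :
    (x - 1) ^ 2 / x - ((x - 1) ^ 2 / x) ^ 2 / 12 ≤ Real.log x ^ 2 := by
  rw [sub_one_sq_div_eq (by linarith)]
  have h0 : 0 ≤ Real.log x / 2 := by have := Real.log_nonneg hx; positivity
  have h1 := sinh_sub_cube_le h0
  have h2 := Real.sinh_nonneg_iff.2 h0
  set S := Real.sinh (Real.log x / 2)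
  rcases le_total (S ^ 2) 6 with h | h
  · have h3 : 0 ≤ S - S ^ 3 / 6 := by nlinarith
    have h4 : (S - S ^ 3 / 6) ^ 2 ≤ (Real.log x / 2) ^ 2 := by gcongr
    nlinarith [sq_nonneg (S ^ 3)]
  · nlinarith [sq_nonneg (Real.log x)]

theorem pi_sq_bounds : 9.8695 ≤ Real.pi ^ 2 ∧ Real.pi ^ 2 ≤ 9.8697 := by
  have h1 := Real.pi_gt_d6
  have h2 := Real.pi_lt_d6
  constructor <;> nlinarith

/-- With v = log x, Taylor's formula gives 1.626 - (0.813a² + a)v² + (0.813a⁴/12 + a³/6)v⁴. Then v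
is traded for z using z - z²/12 ≤ v² ≤ z; the last coefficient absorbs 12.17 + 11.02/12. -/
theorem cos_sub_log_mul_sin_le {a x : ℝ} (ha : 0 < a) (ha1 : Real.pi ^ 2 - 7 / 48 ≤ a ^ 2)
    (ha2 : a ^ 2 ≤ Real.pi ^ 2 + 3 / 16) (hx : 1 ≤ x) :
    1.626 * Real.cos (a * Real.log x) - Real.log x * Real.sin (a * Real.log x)
      ≤ 1.626 - 11.02 * ((x - 1) ^ 2 / x) + 13.09 * ((x - 1) ^ 2 / x) ^ 2 := by
  obtain ⟨hp1, hp2⟩ := pi_sq_bounds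
  have hv := Real.log_nonneg hx
  have h1 := log_sq_le hx
  have h2 := le_log_sq hx
  set v := Real.log x
  set z := (x - 1) ^ 2 / x
  have hq : 0 ≤ a * v := by positivity
  have hc := cos_le_one_sub_sq_add_pow_four hq
  have hs := mul_le_mul_of_nonneg_left (Real.sin_ge_sub_cube hq) hv
  have a1 : 3.118 ≤ a := by nlinarith
  have a2 : a ≤ 3.1714 := by nlinarith
  have g : 11.02 ≤ 0.813 * a ^ 2 + a := by nlinarith
  have b : 0.813 * a ^ 4 / 12 + a ^ 3 / 6 ≤ 12.17 := by
    have : a ^ 4 ≤ 10.0572 ^ 2 := by nlinarith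
    have : a ^ 3 ≤ 3.1714 * 10.0572 := by nlinarith
    nlinarith
  have hg : 11.02 * v ^ 2 ≤ (0.813 * a ^ 2 + a) * v ^ 2 := by gcongr
  have hb : (0.813 * a ^ 4 / 12 + a ^ 3 / 6) * v ^ 4 ≤ 12.17 * z ^ 2 := by
    have : v ^ 4 ≤ z ^ 2 := by
      rw [show v ^ 4 = (v ^ 2) ^ 2 by ring]; gcongr
    gcongr
  nlinarith [sq_nonneg z]

theorem majorant_inequality {p y : ℝ} (hp1 : 3.1415 ≤ p) (hp2 : p ≤ 3.1416) (hy : 0 ≤ y) :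
    (1 + y) ^ 2 * (1.626 * (1 + y) ^ 2 - 11.02 * ((1 + y) * y ^ 2) + 13.09 * y ^ 4)
      ≤ (p * (1 + y) + 3.75) * (0.2847 + 0.3328 * y - 1.871 * y ^ 2 - 2.2735 * y ^ 3
          + 2.8435 * y ^ 4 + 4.167 * y ^ 5)
        - (1 + y) * (0.3328 - 3.742 * y - 6.8205 * y ^ 2 + 11.374 * y ^ 3 + 20.835 * y ^ 4) := by
  have aux : 0 ≤ 0.0032 + 0.093 * y - 0.0222 * y ^ 2 + 0.4565 * y ^ 3 - 1.41123 * y ^ 4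
      + 1.6547 * y ^ 5 := by
    have h1 : 0 ≤ y ^ 3 * (0.3565 - 1.41123 * y + 1.6547 * y ^ 2) := by
      have : 0 ≤ 0.3565 - 1.41123 * y + 1.6547 * y ^ 2 := by nlinarith [sq_nonneg (y - 0.4264)]
      positivity
    have h2 : 0 ≤ y * (0.093 - 0.0222 * y + 0.1 * y ^ 2) := by
      have : 0 ≤ 0.093 - 0.0222 * y + 0.1 * y ^ 2 := by nlinarith [sq_nonneg (y - 0.1)]
      positivity
    nlinarith
  have y2 := pow_nonneg hy 2
  have y3 := pow_nonneg hy 3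
  have y4 := pow_nonneg hy 4
  have y5 := pow_nonneg hy 5
  have y6 := pow_nonneg hy 6
  have e1 : 0 ≤ (3.1415 * (1 + y) + 3.75) * (0.2847 + 0.3328 * y - 1.871 * y ^ 2 - 2.2735 * y ^ 3
          + 2.8435 * y ^ 4 + 4.167 * y ^ 5)
        - (1 + y) * (0.3328 - 3.742 * y - 6.8205 * y ^ 2 + 11.374 * y ^ 3 + 20.835 * y ^ 4)
      - (1 + y) ^ 2 * (1.626 * (1 + y) ^ 2 - 11.02 * ((1 + y) * y ^ 2) + 13.09 * y ^ 4) := by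
    ring_nf
    linarith
  have e2 : 0 ≤ (3.1416 * (1 + y) + 3.75) * (0.2847 + 0.3328 * y - 1.871 * y ^ 2 - 2.2735 * y ^ 3
          + 2.8435 * y ^ 4 + 4.167 * y ^ 5)
        - (1 + y) * (0.3328 - 3.742 * y - 6.8205 * y ^ 2 + 11.374 * y ^ 3 + 20.835 * y ^ 4)
      - (1 + y) ^ 2 * (1.626 * (1 + y) ^ 2 - 11.02 * ((1 + y) * y ^ 2) + 13.09 * y ^ 4) := by
    ring_nf
    linarith
  -- The inequality is affine in `p`, so it interpolates between the endpoints 3.1415 and 3.1416,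
  -- whose distance is 1/10000.
  linear_combination 10000 * mul_nonneg (sub_nonneg.2 hp2) e1
    + 10000 * mul_nonneg (sub_nonneg.2 hp1) e2

/-- The majorant `P` is chosen so that `-(exp (-π x) x^(-3/4) P x)'` dominates the integrand
`exp (-π x) x^(-3/4) (1.626 - 11.02 z + 13.09 z²)`, where `z = (x - 1)² / x`. -/
noncomputable def majorant (x : ℝ) : ℝ :=
  (0.2847 + 0.3328 * (x - 1) - 1.871 * (x - 1) ^ 2 - 2.2735 * (x - 1) ^ 3
    + 2.8435 * (x - 1) ^ 4 + 4.167 * (x - 1) ^ 5) / x ^ 3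

theorem majorant_nonneg {x : ℝ} (hx : 2 ≤ x) : 0 ≤ majorant x := by
  obtain ⟨y, rfl⟩ : ∃ y, x = 1 + y := ⟨x - 1, by ring⟩
  have hy : 1 ≤ y := by linarith
  rw [majorant, add_sub_cancel_left]
  refine div_nonneg ?_ (by positivity)
  have h4 : y ^ 2 ≤ y ^ 4 := pow_le_pow_right₀ hy (by norm_num)
  have h5 : y ^ 3 ≤ y ^ 5 := pow_le_pow_right₀ hy (by norm_num)
  nlinarith [pow_pos (zero_lt_one.trans_le hy) 4, pow_pos (zero_lt_one.trans_le hy) 5]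

theorem exists_hasDerivAt_majorant {x : ℝ} (hx : 1 ≤ x) : ∃ d, HasDerivAt majorant d x ∧
    1.626 - 11.02 * ((x - 1) ^ 2 / x) + 13.09 * ((x - 1) ^ 2 / x) ^ 2
      ≤ (Real.pi + 3 / 4 / x) * majorant x - d := by
  obtain ⟨y, rfl⟩ : ∃ y, x = 1 + y := ⟨x - 1, by ring⟩
  have hy : 0 ≤ y := by linarith
  have h0 : 0 < 1 + y := by linarith
  have hd : HasDerivAt majorant
      (((0.3328 - 3.742 * y - 6.8205 * y ^ 2 + 11.374 * y ^ 3 + 20.835 * y ^ 4) * (1 + y)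
        - 3 * (0.2847 + 0.3328 * y - 1.871 * y ^ 2 - 2.2735 * y ^ 3
          + 2.8435 * y ^ 4 + 4.167 * y ^ 5)) / (1 + y) ^ 4) (1 + y) := by
    have h1 : HasDerivAt (fun x : ℝ => x - 1) 1 (1 + y) := (hasDerivAt_id _).sub_const 1
    have h2 := (((((h1.const_mul 0.3328).const_add 0.2847).sub ((h1.pow 2).const_mul 1.871)).sub
      ((h1.pow 3).const_mul 2.2735)).add ((h1.pow 4).const_mul 2.8435)).add
      ((h1.pow 5).const_mul 4.167)
    have h3 := h2.div (hasDerivAt_pow 3 (1 + y)) (by positivity)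
    refine h3.congr_deriv ?_
    simp only [Pi.add_apply, Pi.sub_apply, Pi.pow_apply, add_sub_cancel_left]
    field_simp
    norm_num
    ring
  refine ⟨_, hd, ?_⟩
  have h := majorant_inequality Real.pi_gt_d4.le Real.pi_lt_d4.le hy
  have e : (Real.pi + 3 / 4 / (1 + y)) * majorant (1 + y)
      - ((0.3328 - 3.742 * y - 6.8205 * y ^ 2 + 11.374 * y ^ 3 + 20.835 * y ^ 4) * (1 + y)
        - 3 * (0.2847 + 0.3328 * y - 1.871 * y ^ 2 - 2.2735 * y ^ 3
          + 2.8435 * y ^ 4 + 4.167 * y ^ 5)) / (1 + y) ^ 4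
      = ((Real.pi * (1 + y) + 3.75) * (0.2847 + 0.3328 * y - 1.871 * y ^ 2 - 2.2735 * y ^ 3
          + 2.8435 * y ^ 4 + 4.167 * y ^ 5)
        - (1 + y) * (0.3328 - 3.742 * y - 6.8205 * y ^ 2 + 11.374 * y ^ 3 + 20.835 * y ^ 4))
        / (1 + y) ^ 4 := by
    rw [majorant, add_sub_cancel_left]
    field_simp
    ring
  rw [e, le_div_iff₀ (by positivity)]
  refine le_trans (le_of_eq ?_) h
  rw [add_sub_cancel_left]
  field_simp

theorem mul_log_rpow_le {x : ℝ} (hx : 1 ≤ x) :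
    x ^ (-(3 / 4) : ℝ) * (1.626 + Real.log x) ≤ 3 := by
  have h0 : 0 < x := by linarith
  have hp : 0 < x ^ (3 / 4 : ℝ) := by positivity
  have h1 : (1 : ℝ) ≤ x ^ (3 / 4 : ℝ) := Real.one_le_rpow hx (by norm_num)
  have h := Real.log_le_sub_one_of_pos hp
  rw [Real.log_rpow h0] at h
  rw [Real.rpow_neg h0.le, inv_mul_le_iff₀ hp]
  linarith

theorem exp_neg_pi_le : Real.exp (-Real.pi) ≤ 1 / 23.12 := by
  rw [Real.exp_neg, one_div]
  refine inv_anti₀ (by norm_num) ?_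
  have h1 : Real.exp 3 * Real.exp 0.1415 ≤ Real.exp Real.pi := by
    rw [← Real.exp_add]
    exact Real.exp_le_exp.2 (by linarith [Real.pi_gt_d4])
  have h2 : (2.71828 : ℝ) ^ 3 ≤ Real.exp 3 := by
    have : Real.exp 3 = Real.exp 1 ^ 3 := by rw [← Real.exp_nat_mul]; norm_num
    rw [this]
    gcongr
    linarith [Real.exp_one_gt_d9]
  have h3 := Real.quadratic_le_exp_of_nonneg (x := 0.1415) (by norm_num)
  calc (23.12 : ℝ) ≤ 2.71828 ^ 3 * (1 + 0.1415 + 0.1415 ^ 2 / 2) := by norm_num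
    _ ≤ _ := mul_le_mul h2 h3 (by norm_num) (Real.exp_pos _).le
    _ ≤ _ := h1

theorem hasDerivAt_exp_neg_pi_mul (x : ℝ) : HasDerivAt (fun x : ℝ => Real.exp (-Real.pi * x))
    (Real.exp (-Real.pi * x) * (-Real.pi)) x := by
  simpa using ((hasDerivAt_id x).const_mul (-Real.pi)).exp

theorem integrableOn_thetaTail_mul_cos_sub (a : ℝ) : IntegrableOn (fun x => thetaTail x
    * x ^ (-(3 / 4) : ℝ) * (1.626 * Real.cos (a * Real.log x)
      - Real.log x * Real.sin (a * Real.log x))) (Ioi 1) :=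
  (((integrableOn_thetaTail_mul_cos a).const_mul 1.626).sub
    (integrableOn_thetaTail_mul_log_mul_sin a)).congr
    (ae_of_all _ fun x => by simp only [Pi.sub_apply]; ring)

/-- The first term 2exp(-πx) of the tail is handled by `majorant`. The rest is at most 0.0004
exp(-πx) times a factor bounded by 3, and is paid for by the summand 0.0012/π · exp(-πx). -/
theorem integral_thetaTail_mul_cos_sub_le {a : ℝ} (ha : 0 < a)
    (ha1 : Real.pi ^ 2 - 7 / 48 ≤ a ^ 2) (ha2 : a ^ 2 ≤ Real.pi ^ 2 + 3 / 16) :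
    ∫ x in Ioi (1 : ℝ), thetaTail x * x ^ (-(3 / 4) : ℝ) * (1.626 * Real.cos (a * Real.log x)
      - Real.log x * Real.sin (a * Real.log x)) ≤ 0.5698 / 23.12 := by
  choose! d hd hle using fun x (hx : (1 : ℝ) ≤ x) => exists_hasDerivAt_majorant hx
  have hpi := Real.pi_pos
  refine (setIntegral_Ioi_le_of_hasDerivAt (S := fun x => 2 * (Real.exp (-Real.pi * x)
      * x ^ (-(3 / 4) : ℝ) * majorant x) + 0.0012 / Real.pi * Real.exp (-Real.pi * x))
    (fun x hx => ((hasDerivAt_exp_mul_rpow_mul (by linarith) (hd x hx)).const_mul 2).add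
      ((hasDerivAt_exp_neg_pi_mul x).const_mul _))
    (integrableOn_thetaTail_mul_cos_sub a) (fun x hx => ?_) ?_).trans ?_
  · have h0 : 0 < x := by linarith
    set f := 1.626 * Real.cos (a * Real.log x) - Real.log x * Real.sin (a * Real.log x) with hf
    set E := Real.exp (-Real.pi * x)
    set p := x ^ (-(3 / 4) : ℝ)
    have hE : 0 < E := Real.exp_pos _
    have hp : 0 < p := by positivity
    have h1 : f ≤ (Real.pi + 3 / 4 / x) * majorant x - d x :=
      (cos_sub_log_mul_sin_le ha ha1 ha2 hx.le).trans (hle x hx.le)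
    have h2 : p * f ≤ 3 := by
      refine le_trans ?_ (mul_log_rpow_le hx.le)
      gcongr
      have hl := Real.log_nonneg hx.le
      nlinarith [Real.cos_le_one (a * Real.log x), Real.neg_one_le_sin (a * Real.log x)]
    have h3 := two_mul_exp_le_thetaTail h0
    have h4 := thetaTail_le hx.le
    have h5 : 2 * E * (p * f) ≤ 2 * E * (p * ((Real.pi + 3 / 4 / x) * majorant x - d x)) := by
      gcongr
    have h6 : (thetaTail x - 2 * E) * (p * f) ≤ 0.0004 * E * 3 := by
      calc (thetaTail x - 2 * E) * (p * f) ≤ (thetaTail x - 2 * E) * 3 :=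
            mul_le_mul_of_nonneg_left h2 (by linarith)
        _ ≤ _ := by nlinarith
    have h7 : 0.0012 / Real.pi * (E * -Real.pi) = -0.0012 * E := by field_simp
    rw [h7]
    nlinarith
  · filter_upwards [eventually_ge_atTop 2] with x hx
    have := majorant_nonneg hx
    positivity
  · have h1 : majorant 1 = 0.2847 := by norm_num [majorant]
    simp only [h1, mul_one, Real.one_rpow]
    have h2 : 0.0012 / Real.pi ≤ 0.0004 := by
      rw [div_le_iff₀ hpi]; linarith [Real.pi_gt_three]
    have := exp_neg_pi_le
    have := Real.exp_pos (-Real.pi)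
    nlinarith

/-- Here 0.32 - 0.04/x serves as the majorant; its value 0.28 at x = 1, times 1 + 1/5000, stays
below 0.2801. -/
theorem integral_thetaTail_le :
    ∫ x in Ioi (1 : ℝ), thetaTail x * x ^ (-(3 / 4) : ℝ) ≤ 2 * 0.2801 / 23.12 := by
  refine (setIntegral_Ioi_le_of_hasDerivAt (S := fun x => 2 * (1 + 1 / 5000) * (Real.exp (-Real.pi * x)
      * x ^ (-(3 / 4) : ℝ) * (0.32 - 0.04 / x)))
    (S' := fun x => 2 * (1 + 1 / 5000) * (-(Real.exp (-Real.pi * x) * x ^ (-(3 / 4) : ℝ)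
      * ((Real.pi + 3 / 4 / x) * (0.32 - 0.04 / x) - 0.04 / x ^ 2))))
    (fun x hx => (hasDerivAt_exp_mul_rpow_mul (by linarith) ?_).const_mul _)
    (integrableOn_thetaTail_mul_rpow _) (fun x hx => ?_) ?_).trans ?_
  · have h0 : 0 < x := by linarith
    have := ((hasDerivAt_inv h0.ne').const_mul 0.04).const_sub 0.32
    simp only [← div_eq_mul_inv] at this
    exact this.congr_deriv (by ring)
  · have h0 : 0 < x := by linarith
    have h1 : 1 ≤ (Real.pi + 3 / 4 / x) * (0.32 - 0.04 / x) - 0.04 / x ^ 2 := by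
      have hu0 : 0 < x⁻¹ := by positivity
      have hu1 : x⁻¹ ≤ 1 := inv_le_one_of_one_le₀ hx.le
      have := Real.pi_gt_d4
      have := Real.pi_lt_d4
      simp only [div_eq_mul_inv _ x, div_eq_mul_inv _ (x ^ 2), ← inv_pow]
      set u := x⁻¹
      nlinarith [mul_nonneg hu0.le (sub_nonneg.2 hu1)]
    have h2 := thetaTail_le hx.le
    have hE := Real.exp_pos (-Real.pi * x)
    have hp : 0 < x ^ (-(3 / 4) : ℝ) := by positivity
    calc thetaTail x * x ^ (-(3 / 4) : ℝ)
        ≤ (2 * Real.exp (-Real.pi * x) * (1 + 1 / 5000)) * x ^ (-(3 / 4) : ℝ) * 1 := by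
          rw [mul_one]; gcongr
      _ ≤ (2 * Real.exp (-Real.pi * x) * (1 + 1 / 5000)) * x ^ (-(3 / 4) : ℝ)
          * ((Real.pi + 3 / 4 / x) * (0.32 - 0.04 / x) - 0.04 / x ^ 2) := by gcongr
      _ = _ := by ring
  · filter_upwards [eventually_ge_atTop 1] with x hx
    have : 0.04 / x ≤ 0.04 := div_le_self (by norm_num) hx
    have : 0 ≤ 0.32 - 0.04 / x := by linarith
    positivity
  · simp only [mul_one, Real.one_rpow]
    have := exp_neg_pi_le
    linarith

theorem completedZetaLine_neg_of_sq_le {t : ℝ} (ht : t ^ 2 ≤ 4 * (Real.pi ^ 2 + 3 / 16)) :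
    completedZetaLine t < 0 := by
  have hw : 0 < 1 / 4 + t ^ 2 := by positivity
  have h1 : ∫ x in Ioi (1 : ℝ), thetaTail x * x ^ (-(3 / 4) : ℝ) * Real.cos (t / 2 * Real.log x)
      ≤ ∫ x in Ioi (1 : ℝ), thetaTail x * x ^ (-(3 / 4) : ℝ) := by
    refine setIntegral_mono_on (integrableOn_thetaTail_mul_cos _)
      (integrableOn_thetaTail_mul_rpow _) measurableSet_Ioi fun x hx => ?_
    have h0 : (0 : ℝ) < x := zero_lt_one.trans hx
    exact mul_le_of_le_one_right (mul_nonneg (thetaTail_nonneg h0) (by positivity))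
      (Real.cos_le_one _)
  have h2 : 0.0247 < 1 / (1 / 4 + t ^ 2) := by
    rw [lt_div_iff₀ hw]
    linarith [pi_sq_bounds.2]
  rw [completedZetaLine_eq_integral]
  have h3 : (2 * 0.2801 / 23.12 : ℝ) ≤ 0.0247 := by norm_num
  linarith [integral_thetaTail_le]

/-- The integral parts of R' and 0.813R combine into half of the integral with weight 1.626 = 2 ·
0.813; the rational part outweighs it. -/
theorem deriv_completedZetaLine_add_neg {t : ℝ} (ht : 0 < t)
    (h1 : Real.pi ^ 2 - 7 / 48 ≤ (t / 2) ^ 2) (h2 : (t / 2) ^ 2 ≤ Real.pi ^ 2 + 3 / 16) :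
    deriv completedZetaLine t + 0.813 * completedZetaLine t < 0 := by
  obtain ⟨hp1, hp2⟩ := pi_sq_bounds
  have hI := integral_thetaTail_mul_cos_sub_le (a := t / 2) (by positivity) h1 h2
  have he : ∫ x in Ioi (1 : ℝ), thetaTail x * x ^ (-(3 / 4) : ℝ) * (1.626 * Real.cos (t / 2 * Real.log x)
      - Real.log x * Real.sin (t / 2 * Real.log x))
      = 1.626 * (∫ x in Ioi (1 : ℝ), thetaTail x * x ^ (-(3 / 4) : ℝ) * Real.cos (t / 2 * Real.log x))
        - ∫ x in Ioi (1 : ℝ), thetaTail x * x ^ (-(3 / 4) : ℝ)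
          * (Real.log x * Real.sin (t / 2 * Real.log x)) := by
    rw [← integral_const_mul, ← integral_sub ((integrableOn_thetaTail_mul_cos _).const_mul _)
      (integrableOn_thetaTail_mul_log_mul_sin _)]
    congr 1; ext x; ring
  rw [he] at hI
  rw [(hasDerivAt_completedZetaLine t).deriv, completedZetaLine_eq_integral]
  have hm : 2 * t / (1 / 4 + t ^ 2) ^ 2 - 0.813 * (1 / (1 / 4 + t ^ 2)) < -(0.2849 / 23.12) := by
    have hw : 0 < 1 / 4 + t ^ 2 := by positivity
    have ht2 : 2 * t ≤ 12.6856 := by nlinarith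
    have : 2 * t / (1 / 4 + t ^ 2) ^ 2 - 0.813 * (1 / (1 / 4 + t ^ 2))
        = -((0.813 * (1 / 4 + t ^ 2) - 2 * t) / (1 / 4 + t ^ 2) ^ 2) := by field_simp; ring
    rw [this, neg_lt_neg_iff, lt_div_iff₀ (by positivity)]
    nlinarith
  linarith

/-! ### Analytic quotients, lifts through the circle, and integer crossings. -/

/-- If `f` is analytic at a zero `z₀` of finite order `k`, then `f / f'` is analytic there,
with derivative `1 / k`. -/
theorem exists_hasDerivAt_div_deriv {f : ℂ → ℂ} {z₀ : ℂ} (hf : AnalyticAt ℂ f z₀)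
    (h0 : f z₀ = 0) (hne : ¬ ∀ᶠ z in 𝓝 z₀, f z = 0) :
    AnalyticAt ℂ (fun z => f z / deriv f z) z₀ ∧
      ∃ k : ℕ, 0 < k ∧ HasDerivAt (fun z => f z / deriv f z) (1 / k) z₀ := by
  obtain ⟨k, g, hg, hg0, hfg⟩ := hf.exists_eventuallyEq_pow_smul_nonzero_iff.2 hne
  have hk : k ≠ 0 := by
    rintro rfl
    have := hfg.self_of_nhds
    simp [h0] at this
    exact hg0 this.symm
  have hkC : (k : ℂ) ≠ 0 := Nat.cast_ne_zero.2 hk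
  set G : ℂ → ℂ := fun z => (z - z₀) * (g z / (k * g z + (z - z₀) * deriv g z)) with hG
  have hden : (k * g z₀ + (z₀ - z₀) * deriv g z₀) ≠ 0 := by simp [hkC, hg0]
  have hda : AnalyticAt ℂ (fun z => k * g z + (z - z₀) * deriv g z) z₀ :=
    (analyticAt_const.mul hg).add ((analyticAt_id.sub analyticAt_const).mul hg.deriv)
  have hqa : AnalyticAt ℂ (fun z => g z / (k * g z + (z - z₀) * deriv g z)) z₀ := hg.div hda hden
  have hGa : AnalyticAt ℂ G z₀ := (analyticAt_id.sub analyticAt_const).mul hqa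
  have heq : (fun z => f z / deriv f z) =ᶠ[𝓝 z₀] G := by
    filter_upwards [hfg, Filter.Eventually.eventually_nhds hfg, hg.eventually_analyticAt,
      hda.continuousAt.eventually_ne hden] with z hz hz' hgz hzd
    rcases eq_or_ne z z₀ with rfl | hzz
    · simp [h0, hG]
    have hz1 : z - z₀ ≠ 0 := sub_ne_zero.2 hzz
    have hd : deriv f z = (z - z₀) ^ (k - 1) * (k * g z + (z - z₀) * deriv g z) := by
      rw [Filter.EventuallyEq.deriv_eq hz']
      have h1 : HasDerivAt (fun z => (z - z₀) ^ k) (k * (z - z₀) ^ (k - 1)) z := by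
        exact (((hasDerivAt_id z).sub_const z₀).pow k).congr_deriv (by simp)
      have h2 := h1.mul hgz.differentiableAt.hasDerivAt
      have h3 : deriv (fun z => (z - z₀) ^ k • g z) z
          = k * (z - z₀) ^ (k - 1) * g z + (z - z₀) ^ k * deriv g z := h2.deriv
      rw [h3]
      obtain ⟨j, rfl⟩ := Nat.exists_eq_succ_of_ne_zero hk
      simp only [Nat.succ_eq_add_one, Nat.add_sub_cancel, pow_succ]
      ring
    rw [hd, hz, smul_eq_mul, hG]
    obtain ⟨j, rfl⟩ := Nat.exists_eq_succ_of_ne_zero hk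
    simp only [Nat.succ_eq_add_one, Nat.add_sub_cancel]
    have hj : (z - z₀) ^ j ≠ 0 := pow_ne_zero _ hz1
    rw [pow_succ]
    field_simp
  refine ⟨hGa.congr heq.symm, k, Nat.pos_of_ne_zero hk, ?_⟩
  have h1 := ((hasDerivAt_id z₀).sub_const z₀).mul hqa.differentiableAt.hasDerivAt
  refine (h1.congr_of_eventuallyEq heq).congr_deriv ?_
  simp only [id, sub_self, zero_mul, add_zero, one_mul]
  field_simp

theorem exp_two_pi_I_mul_eq_one_iff {x : ℝ} :
    cexp (2 * Real.pi * I * x) = 1 ↔ ∃ n : ℤ, x = n := by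
  rw [Complex.exp_eq_one_iff]
  refine exists_congr fun n => ?_
  rw [mul_comm (n : ℂ), mul_right_inj' (by simp [Real.pi_ne_zero])]
  norm_cast

/-- A continuous lift through `x ↦ exp (2πix)` of an analytic function is analytic. -/
theorem analyticAt_of_exp_eq {κ : ℝ → ℝ} {u : ℝ → ℂ} {t₀ : ℝ} (hκ : ContinuousAt κ t₀)
    (hu : AnalyticAt ℝ u t₀) (h : ∀ t, cexp (2 * Real.pi * I * κ t) = u t) :
    AnalyticAt ℝ κ t₀ := by
  have hu0 : u t₀ ≠ 0 := by rw [← h]; exact exp_ne_zero _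
  have h1 : AnalyticAt ℝ (fun t => u t / u t₀) t₀ := hu.div analyticAt_const hu0
  have h2 : AnalyticAt ℝ (fun t => Complex.log (u t / u t₀)) t₀ := by
    have hl : AnalyticAt ℂ Complex.log (u t₀ / u t₀) :=
      analyticAt_clog (by rw [div_self hu0]; exact one_mem_slitPlane)
    exact AnalyticAt.comp (g := Complex.log) (f := fun t => u t / u t₀) (x := t₀)
      hl.restrictScalars h1
  have h3 : AnalyticAt ℝ (fun t => (Complex.log (u t / u t₀)).im) t₀ :=
    (Complex.imCLM.analyticAt _).comp h2
  refine (analyticAt_const (v := κ t₀) |>.add (h3.div analyticAt_const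
    (show (2 * Real.pi : ℝ) ≠ 0 by positivity))).congr ?_
  -- Within distance 1/2 the principal logarithm of u(t)/u(t₀) recovers κ(t) - κ(t₀) with no jump.
  have hlt : ∀ᶠ t in 𝓝 t₀, |κ t - κ t₀| < 1 / 2 := by
    have := Metric.continuousAt_iff'.1 hκ (1 / 2) (by norm_num)
    simpa [Real.dist_eq] using this
  filter_upwards [hlt] with t ht
  have e : u t / u t₀ = cexp (((2 * Real.pi * (κ t - κ t₀) : ℝ) : ℂ) * I) := by
    rw [← h, ← h, ← exp_sub]; congr 1; push_cast; ring
  obtain ⟨l, r⟩ := abs_lt.1 ht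
  have hp := Real.pi_pos
  simp only [Pi.add_apply, Pi.div_apply]
  rw [e, Complex.log_exp (by simp; nlinarith) (by simp; nlinarith)]
  simp

/-- Integrating u'/(2πiu) gives a complex lift, and |u| = 1 forces it to be real. -/
theorem exists_analytic_lift {u : ℝ → ℂ} (hu : AnalyticOnNhd ℝ u univ) (h1 : ∀ t, ‖u t‖ = 1)
    {x : ℝ} (hx : cexp (2 * Real.pi * I * x) = u 0) :
    ∃ κ : ℝ → ℝ, AnalyticOnNhd ℝ κ univ ∧ (∀ t, cexp (2 * Real.pi * I * κ t) = u t) ∧ κ 0 = x := by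
  have hne : ∀ t, u t ≠ 0 := fun t h => by have := h1 t; simp [h] at this
  have hpi : (2 * Real.pi * I : ℂ) ≠ 0 := by simp [Real.pi_ne_zero]
  have hud : ∀ t, HasDerivAt u (deriv u t) t := fun t => (hu t trivial).differentiableAt.hasDerivAt
  set w : ℝ → ℂ := fun t => deriv u t / u t / (2 * Real.pi * I) with hw
  have hwc : Continuous w := by
    have h2 : Continuous (deriv u) :=
      continuous_iff_continuousAt.2 fun t => (hu t trivial).deriv.continuousAt
    have h3 : Continuous u := continuous_iff_continuousAt.2 fun t => (hu t trivial).continuousAt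
    exact (h2.div h3 hne).div_const _
  set F : ℝ → ℂ := fun t => x + ∫ s in (0 : ℝ)..t, w s with hF
  have hFd : ∀ t, HasDerivAt F (w t) t := fun t =>
    (hwc.integral_hasStrictDerivAt 0 t).hasDerivAt.const_add _
  have hFu : ∀ t, cexp (2 * Real.pi * I * F t) = u t := by
    intro t
    have hd : ∀ t, HasDerivAt (fun t => cexp (2 * Real.pi * I * F t) / u t) 0 t := fun t => by
      refine (((hFd t).const_mul _).cexp.div (hud t) (hne t)).congr_deriv ?_
      have := hne t
      simp only [hw]
      field_simp
      ring
    have := is_const_of_deriv_eq_zero (fun t => (hd t).differentiableAt) (fun t => (hd t).deriv) t 0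
    have h0 : F 0 = x := by simp [hF]
    rw [h0, hx, div_self (hne 0), div_eq_one_iff_eq (hne t)] at this
    exact this
  have hFre : ∀ t, F t = ((F t).re : ℂ) := by
    intro t
    have h2 := h1 t
    rw [← hFu t, norm_exp, Real.exp_eq_one_iff] at h2
    have h3 : (F t).im = 0 := by
      simpa [Real.pi_ne_zero] using h2
    exact Complex.ext rfl (by simp [h3])
  have hlift : ∀ t, cexp (2 * Real.pi * I * ((F t).re : ℝ)) = u t := fun t => by
    rw [← hFre t, hFu t]
  refine ⟨fun t => (F t).re, fun t _ => ?_, hlift, by simp [hF]⟩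
  exact analyticAt_of_exp_eq
    (continuous_re.continuousAt.comp (hFd t).continuousAt) (hu t trivial) hlift

theorem eq_of_exp_eq {κ₁ κ₂ : ℝ → ℝ} (h1 : Differentiable ℝ κ₁) (h2 : Differentiable ℝ κ₂)
    (h : ∀ t, cexp (2 * Real.pi * I * κ₁ t) = cexp (2 * Real.pi * I * κ₂ t)) (h0 : κ₁ 0 = κ₂ 0) :
    κ₁ = κ₂ := by
  have hd1 : ∀ t, HasDerivAt (fun t => cexp (2 * Real.pi * I * κ₁ t))
      (cexp (2 * Real.pi * I * κ₁ t) * (2 * Real.pi * I * (deriv κ₁ t : ℝ))) t := fun t =>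
    ((h1 t).hasDerivAt.ofReal_comp.const_mul _).cexp
  have hd2 : ∀ t, HasDerivAt (fun t => cexp (2 * Real.pi * I * κ₂ t))
      (cexp (2 * Real.pi * I * κ₂ t) * (2 * Real.pi * I * (deriv κ₂ t : ℝ))) t := fun t =>
    ((h2 t).hasDerivAt.ofReal_comp.const_mul _).cexp
  have he : ∀ t, deriv κ₁ t = deriv κ₂ t := fun t => by
    have e := (hd1 t).unique ((hd2 t).congr_of_eventuallyEq (Eventually.of_forall h))
    rw [h t] at e
    have e' := mul_left_cancel₀ (exp_ne_zero _) e
    have hpi : (2 * Real.pi * I : ℂ) ≠ 0 := by simp [Real.pi_ne_zero]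
    exact ofReal_injective (mul_left_cancel₀ hpi e')
  funext t
  have := is_const_of_deriv_eq_zero (f := fun t => κ₁ t - κ₂ t) (h1.sub h2) (fun t => by
    rw [deriv_fun_sub (h1 t) (h2 t), he t, sub_self]) t 0
  simp only [h0, sub_self] at this
  linarith

theorem mem_Ioo_of_forall_ne_int {κ : ℝ → ℝ} {s : Set ℝ} (hs : s.OrdConnected) (hκ : ContinuousOn κ s)
    (hne : ∀ t ∈ s, ∀ n : ℤ, κ t ≠ n) {m : ℤ} {a : ℝ} (ha : a ∈ s) (hm : κ a ∈ Ioo (m : ℝ) (m + 1)) :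
    ∀ t ∈ s, κ t ∈ Ioo (m : ℝ) (m + 1) := by
  intro t ht
  have hsub : uIcc a t ⊆ s := hs.uIcc_subset ha ht
  have hiv := intermediate_value_uIcc (hκ.mono hsub)
  constructor
  · by_contra! hlt
    obtain ⟨c, hc, hce⟩ := hiv (show (m : ℝ) ∈ uIcc (κ a) (κ t) from by
      rw [mem_uIcc]; exact Or.inr ⟨hlt, hm.1.le⟩)
    exact hne c (hsub hc) m hce
  · by_contra! hlt
    obtain ⟨c, hc, hce⟩ := hiv (show ((m : ℝ) + 1) ∈ uIcc (κ a) (κ t) from by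
      rw [mem_uIcc]; exact Or.inl ⟨hm.2.le, hlt⟩)
    exact hne c (hsub hc) (m + 1) (by push_cast; exact hce)

/-- If `κ` leaves the integer value `m` at `p` upwards, and next takes an integer value at `q`,
approaching it from below, then that value is `m + 1`. -/
theorem eq_add_one_of_forall_ne_int {κ : ℝ → ℝ} (hκ : Continuous κ) {p q : ℝ} (hpq : p < q) {m : ℤ}
    (hp : κ p = m) (hpr : ∀ᶠ t in 𝓝[>] p, m < κ t) (hne : ∀ t ∈ Ioo p q, ∀ n : ℤ, κ t ≠ n)
    {j : ℤ} (hq : κ q = j) (hql : ∀ᶠ t in 𝓝[<] q, κ t < j) : κ q = m + 1 := by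
  have h1 : ∀ᶠ t in 𝓝[>] p, κ t < m + 1 :=
    (hκ.continuousAt.tendsto.mono_left nhdsWithin_le_nhds).eventually_lt_const (by rw [hp]; linarith)
  obtain ⟨a, ha1, ha2, ha3⟩ := (hpr.and (h1.and (Ioo_mem_nhdsGT hpq))).exists
  have hmem := mem_Ioo_of_forall_ne_int ordConnected_Ioo hκ.continuousOn hne ha3 ⟨ha1, ha2⟩
  have h2 : κ q ≤ m + 1 := by
    refine le_of_tendsto (hκ.continuousAt.tendsto.mono_left nhdsWithin_le_nhds :
      Tendsto κ (𝓝[<] q) _) ?_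
    filter_upwards [Ioo_mem_nhdsLT hpq] with t ht using (hmem t ht).2.le
  obtain ⟨b, hb1, hb2⟩ := (hql.and (Ioo_mem_nhdsLT hpq)).exists
  have h3 := (hmem b hb2).1
  rw [hq] at h2 ⊢
  have h4 : (m : ℝ) < j := h3.trans hb1
  have h5 : m < j := by exact_mod_cast h4
  have h6 : j ≤ m + 1 := by exact_mod_cast h2
  have : j = m + 1 := by omega
  rw [this]; push_cast; ring

/-! ### The phase 1 + 2ϑ'ζ/ζ' on the critical line. -/

theorem hasDerivAt_Gammaℝ {s : ℂ} (hs : 0 < s.re) : HasDerivAt Gammaℝ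
    (Gammaℝ s * (-(1 / 2) * Real.log Real.pi + 1 / 2 * digamma (s / 2))) s := by
  have hp : (Real.pi : ℂ) ≠ 0 := ofReal_ne_zero.2 Real.pi_ne_zero
  have hs2 : 0 < (s / 2).re := by rw [div_ofNat_re]; positivity
  have hΓ : DifferentiableAt ℂ Gamma (s / 2) := differentiableAt_Gamma _ fun m hm => by
    rw [hm] at hs2
    simp only [neg_re, natCast_re] at hs2
    linarith [m.cast_nonneg (α := ℝ)]
  have hd : deriv Gamma (s / 2) = digamma (s / 2) * Gamma (s / 2) := by
    rw [digamma_def, logDeriv_apply, div_mul_cancel₀ _ (Gamma_ne_zero_of_re_pos hs2)]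
  have h1 : HasDerivAt (fun s : ℂ => -s / 2) (-1 / 2) s := (hasDerivAt_id s).neg.div_const 2
  have h2 := h1.const_cpow (c := (Real.pi : ℂ)) (Or.inl hp)
  have h3 : HasDerivAt (fun s : ℂ => Gamma (s / 2)) (deriv Gamma (s / 2) * (1 / 2)) s :=
    hΓ.hasDerivAt.comp s ((hasDerivAt_id s).div_const 2)
  have h4 : Gammaℝ = fun s : ℂ => (Real.pi : ℂ) ^ (-s / 2) * Gamma (s / 2) := by
    funext s; exact Gammaℝ_def s
  rw [h4]
  refine (h2.mul h3).congr_deriv ?_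
  rw [hd, ofReal_log Real.pi_pos.le]
  ring

theorem critical_re (t : ℝ) : (1 / 2 + I * t : ℂ).re = 1 / 2 := by simp

theorem hasDerivAt_critical (t : ℝ) : HasDerivAt (fun t : ℝ => (1 / 2 + I * t : ℂ)) I t := by
  simpa using ((hasDerivAt_id t).ofReal_comp.const_mul I).const_add (1 / 2 : ℂ)

/-- Half the imaginary part of the digamma function along the line `1/4 + it/2`. -/
noncomputable def halfImDigamma (t : ℝ) : ℝ := 1 / 2 * (digamma (1 / 4 + I * ((t / 2 : ℝ) : ℂ))).im

/-- `R' + hR`, where `R` is the completed zeta function on the critical line and `h` is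
`halfImDigamma`. -/
noncomputable def completedZetaLineTwist (t : ℝ) : ℝ :=
  deriv completedZetaLine t + halfImDigamma t * completedZetaLine t

/-- Differentiate Λ = Gammaℝ · ζ, where Gammaℝ'/Gammaℝ = ϑ' + ih on the line and R' = iΛ'. -/
theorem Gammaℝ_mul_deriv_riemannZeta (t : ℝ) :
    Gammaℝ (1 / 2 + I * t) * deriv riemannZeta (1 / 2 + I * t)
      = -((deriv riemannSiegelTheta t * completedZetaLine t : ℝ)
          + I * (completedZetaLineTwist t : ℝ)) := by
  set s : ℂ := 1 / 2 + I * t with hs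
  have hre : 0 < s.re := by rw [hs, critical_re]; norm_num
  obtain ⟨hs0, hs1⟩ := critical_line_ne t
  have hΛ : HasDerivAt completedRiemannZeta (deriv completedRiemannZeta s) s :=
    (differentiableAt_completedZeta hs0 hs1).hasDerivAt
  have e1 : deriv completedRiemannZeta s * I = (deriv completedZetaLine t : ℝ) := by
    have h1 : HasDerivAt (fun t : ℝ => completedRiemannZeta (1 / 2 + I * t))
        (deriv completedRiemannZeta s * I) t := hΛ.comp t (hasDerivAt_critical t)
    have h2 : HasDerivAt (fun t : ℝ => (completedZetaLine t : ℂ)) (deriv completedZetaLine t : ℝ) t :=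
      (hasDerivAt_completedZetaLine t).differentiableAt.hasDerivAt.ofReal_comp
    exact h1.unique (h2.congr_of_eventuallyEq
      (Eventually.of_forall completedZeta_critical_eq_ofReal))
  have e2 : deriv completedRiemannZeta s = Gammaℝ s * (-(1 / 2) * Real.log Real.pi
      + 1 / 2 * digamma (s / 2)) * riemannZeta s + Gammaℝ s * deriv riemannZeta s := by
    have h1 := (hasDerivAt_Gammaℝ hre).mul (differentiableAt_riemannZeta hs1).hasDerivAt
    refine HasDerivAt.deriv (h1.congr_of_eventuallyEq ?_)
    filter_upwards [(isOpen_lt continuous_const continuous_re).mem_nhds hre] with z hz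
    have hz0 : z ≠ 0 := by rintro rfl; simp at hz
    rw [Pi.mul_apply, riemannZeta_def_of_ne_zero hz0,
      mul_div_cancel₀ _ (Gammaℝ_ne_zero_of_re_pos hz)]
  have e3 : Gammaℝ s * riemannZeta s = (completedZetaLine t : ℂ) := by
    rw [← completedZeta_critical_eq, completedZeta_critical_eq_ofReal]
  have e4 : (-(1 / 2) * Real.log Real.pi + 1 / 2 * digamma (s / 2) : ℂ)
      = (deriv riemannSiegelTheta t : ℝ) + I * (halfImDigamma t : ℝ) := by
    have : s / 2 = 1 / 4 + I * ((t / 2 : ℝ) : ℂ) := by rw [hs]; push_cast; ring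
    rw [this, deriv_riemannSiegelTheta, halfImDigamma]
    apply Complex.ext <;> simp
  rw [completedZetaLineTwist]
  push_cast
  rw [e4] at e2
  linear_combination (-I) * e1 - e2 + deriv completedRiemannZeta s * I_sq
    - ((deriv riemannSiegelTheta t : ℝ) + I * (halfImDigamma t : ℝ)) * e3

theorem completedZetaLineTwist_neg (t : ℝ) :
    completedZetaLineTwist (-t) = -completedZetaLineTwist t := by
  have h1 : deriv completedZetaLine (-t) = -deriv completedZetaLine t := by
    have := deriv_comp_neg completedZetaLine t
    simp only [completedZetaLine_neg] at this
    linarith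
  have h2 : halfImDigamma (-t) = -halfImDigamma t := by
    rw [halfImDigamma, halfImDigamma, neg_div, im_digamma_neg]; ring
  rw [completedZetaLineTwist, completedZetaLineTwist, h1, h2, completedZetaLine_neg]
  ring

/-- The function `1 + 2ϑ'ζ/ζ'` on the critical line. -/
noncomputable def kappaPhase (t : ℝ) : ℂ :=
  1 + 2 * ((deriv riemannSiegelTheta t : ℝ) : ℂ)
    * (riemannZeta (1 / 2 + I * t) / deriv riemannZeta (1 / 2 + I * t))

theorem kappaPhase_mul (t : ℝ) (h : deriv riemannZeta (1 / 2 + I * t) ≠ 0) :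
    kappaPhase t * ((deriv riemannSiegelTheta t * completedZetaLine t : ℝ)
          + I * (completedZetaLineTwist t : ℝ))
      = -(deriv riemannSiegelTheta t * completedZetaLine t : ℝ)
          + I * (completedZetaLineTwist t : ℝ) := by
  have h1 := Gammaℝ_mul_deriv_riemannZeta t
  have hz : riemannZeta (1 / 2 + I * t)
      = (completedZetaLine t : ℂ) / Gammaℝ (1 / 2 + I * t) := by
    rw [eq_div_iff (Gammaℝ_critical_ne_zero t), mul_comm, ← completedZeta_critical_eq,
      completedZeta_critical_eq_ofReal]
  have hG := Gammaℝ_critical_ne_zero t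
  rw [← neg_eq_iff_eq_neg] at h1
  rw [kappaPhase, hz, ← h1]
  have e : (-(deriv riemannSiegelTheta t * completedZetaLine t : ℝ)
          + I * (completedZetaLineTwist t : ℝ) : ℂ)
      = -(Gammaℝ (1 / 2 + I * t) * deriv riemannZeta (1 / 2 + I * t))
        - 2 * (deriv riemannSiegelTheta t * completedZetaLine t : ℝ) := by
    rw [h1]; ring
  rw [e]
  push_cast
  generalize deriv riemannZeta (1 / 2 + I * t) = z at *
  generalize Gammaℝ (1 / 2 + I * t) = G at *
  field_simp
  ring

theorem norm_kappaPhase (t : ℝ) : ‖kappaPhase t‖ = 1 := by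
  by_cases h : deriv riemannZeta (1 / 2 + I * t) = 0
  -- Division by zero returns 0 here, so the phase is 1.
  · rw [kappaPhase, h]; simp
  have h1 := congrArg norm (kappaPhase_mul t h)
  set x : ℝ := deriv riemannSiegelTheta t * completedZetaLine t
  set y : ℝ := completedZetaLineTwist t
  have e : ‖(-(x : ℂ) + I * y)‖ = ‖(x + I * y : ℂ)‖ := by
    rw [Complex.norm_def, Complex.norm_def]; simp [normSq_apply]
  have hne : (x + I * y : ℂ) ≠ 0 := by
    intro h0
    have := Gammaℝ_mul_deriv_riemannZeta t
    rw [show ((deriv riemannSiegelTheta t * completedZetaLine t : ℝ)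
          + I * (completedZetaLineTwist t : ℝ) : ℂ) = 0 from h0, neg_zero] at this
    exact (mul_ne_zero (Gammaℝ_critical_ne_zero t) h) this
  rw [norm_mul, e] at h1
  exact mul_right_cancel₀ (norm_ne_zero_iff.2 hne) (h1.trans (one_mul _).symm)

theorem im_kappaPhase_mul (t : ℝ) (h : deriv riemannZeta (1 / 2 + I * t) ≠ 0) :
    (kappaPhase t).im * ((deriv riemannSiegelTheta t * completedZetaLine t) ^ 2
        + completedZetaLineTwist t ^ 2)
      = 2 * (deriv riemannSiegelTheta t * completedZetaLine t) * completedZetaLineTwist t := by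
  have h1 := kappaPhase_mul t h
  set x : ℝ := deriv riemannSiegelTheta t * completedZetaLine t
  set y : ℝ := completedZetaLineTwist t
  have hr := congrArg re h1
  have hi := congrArg im h1
  simp at hr hi
  linear_combination x * hi - y * hr

theorem exists_turning_point : ∃ t₀ : ℝ, 0 < t₀ ∧ deriv riemannSiegelTheta t₀ = 0
    ∧ (∀ t, |t| ≤ t₀ → completedZetaLine t < 0) ∧ completedZetaLineTwist t₀ < 0 := by
  obtain ⟨t₀, h0, hD, h1, h2⟩ := exists_deriv_riemannSiegelTheta_eq_zero
  have hR : ∀ t, |t| ≤ t₀ → completedZetaLine t < 0 := fun t ht => by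
    refine completedZetaLine_neg_of_sq_le ?_
    have := sq_le_sq' (by linarith [neg_abs_le t, abs_nonneg t]) ((le_abs_self t).trans ht)
    nlinarith
  refine ⟨t₀, h0, hD, hR, ?_⟩
  -- As R(t₀) < 0, replacing h by the smaller 0.813 only increases R' + hR.
  have hh : 0.813 < halfImDigamma t₀ := by
    have := im_digamma_gt (y := t₀ / 2) (by positivity) h1 h2
    rw [halfImDigamma]; linarith
  have hR0 := hR t₀ (abs_of_pos h0).le
  have := deriv_completedZetaLine_add_neg h0 h1 h2
  rw [completedZetaLineTwist]
  nlinarith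

theorem deriv_riemannSiegelTheta_abs (t : ℝ) :
    deriv riemannSiegelTheta |t| = deriv riemannSiegelTheta t := by
  rcases abs_choice t with h | h <;> rw [h]
  exact deriv_riemannSiegelTheta_neg t

theorem deriv_riemannSiegelTheta_neg_of_lt {t₀ t : ℝ} (hD : deriv riemannSiegelTheta t₀ = 0)
    (ht : |t| < t₀) : deriv riemannSiegelTheta t < 0 := by
  rw [← hD, ← deriv_riemannSiegelTheta_abs]
  exact strictMonoOn_deriv_riemannSiegelTheta (abs_nonneg t) ((abs_nonneg t).trans ht.le) ht

theorem deriv_riemannSiegelTheta_pos_of_lt {t₀ t : ℝ} (h0 : 0 < t₀)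
    (hD : deriv riemannSiegelTheta t₀ = 0)
    (ht : t₀ < |t|) : 0 < deriv riemannSiegelTheta t := by
  rw [← hD, ← deriv_riemannSiegelTheta_abs t]
  exact strictMonoOn_deriv_riemannSiegelTheta h0.le (abs_nonneg t) ht

theorem abs_eq_of_deriv_riemannSiegelTheta_eq_zero {t₀ t : ℝ} (h0 : 0 < t₀)
    (hD : deriv riemannSiegelTheta t₀ = 0) (ht : deriv riemannSiegelTheta t = 0) : |t| = t₀ := by
  rcases lt_trichotomy |t| t₀ with h | h | h
  · exact absurd ht (deriv_riemannSiegelTheta_neg_of_lt hD h).ne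
  · exact h
  · exact absurd ht (deriv_riemannSiegelTheta_pos_of_lt h0 hD h).ne'

/-- A zero of ζ' makes both ϑ'R and R' + hR vanish. With R ≠ 0 this forces ϑ' = 0, so t = ±t₀; but
R' + hR is odd and nonzero at t₀. -/
theorem deriv_riemannZeta_critical_ne_zero {t : ℝ} (ht : completedZetaLine t ≠ 0) :
    deriv riemannZeta (1 / 2 + I * t) ≠ 0 := by
  intro h
  obtain ⟨t₀, h0, hD, -, hB⟩ := exists_turning_point
  have h1 := Gammaℝ_mul_deriv_riemannZeta t
  rw [h, mul_zero, eq_comm, neg_eq_zero] at h1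
  have hre := congrArg re h1
  have him := congrArg im h1
  simp at hre him
  have hDt : deriv riemannSiegelTheta t = 0 := hre.resolve_right ht
  have := abs_eq_of_deriv_riemannSiegelTheta_eq_zero h0 hD hDt
  rcases eq_or_eq_neg_of_abs_eq this with rfl | rfl
  · exact hB.ne him
  · rw [completedZetaLineTwist_neg, neg_eq_zero] at him
    exact hB.ne him

theorem not_eventually_riemannZeta_eq_zero (t : ℝ) :
    ¬ ∀ᶠ z in 𝓝 (1 / 2 + I * t : ℂ), riemannZeta z = 0 := by
  intro h
  have ha : AnalyticOnNhd ℂ riemannZeta {1}ᶜ :=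
    DifferentiableOn.analyticOnNhd
      (fun z hz => (differentiableAt_riemannZeta hz).differentiableWithinAt) isOpen_compl_singleton
  have hc : IsPreconnected ({1}ᶜ : Set ℂ) := (isConnected_compl_singleton_of_one_lt_rank
    (by rw [rank_real_complex]; exact Nat.one_lt_ofNat) 1).isPreconnected
  have h0 := ha.eqOn_zero_of_preconnected_of_eventuallyEq_zero hc (critical_line_ne t).2 h
    (critical_line_ne 0).2
  obtain ⟨t₀, ht, -, hR, -⟩ := exists_turning_point
  exact (hR 0 (by simpa using ht.le)).ne ((completedZetaLine_eq_zero_iff 0).2 h0)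

theorem analyticAt_riemannZeta_critical (t : ℝ) : AnalyticAt ℂ riemannZeta (1 / 2 + I * t) :=
  DifferentiableOn.analyticAt (s := {1}ᶜ)
    (fun _ hz => (differentiableAt_riemannZeta hz).differentiableWithinAt)
    (isOpen_compl_singleton.mem_nhds (critical_line_ne t).2)

theorem eventually_completedZetaLine_ne_zero (t : ℝ) :
    ∀ᶠ s in 𝓝[≠] t, completedZetaLine s ≠ 0 := by
  have h := (analyticAt_riemannZeta_critical t).eventually_eq_zero_or_eventually_ne_zero.resolve_left
    (not_eventually_riemannZeta_eq_zero t)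
  have hc : Tendsto (fun s : ℝ => (1 / 2 + I * s : ℂ)) (𝓝[≠] t) (𝓝[≠] (1 / 2 + I * t)) := by
    refine tendsto_nhdsWithin_of_tendsto_nhds_of_eventually_within _
      ((by fun_prop : Continuous fun s : ℝ => (1 / 2 + I * s : ℂ)).continuousAt.tendsto.mono_left
        nhdsWithin_le_nhds) ?_
    filter_upwards [self_mem_nhdsWithin] with s hs h
    have h1 := add_left_cancel h
    exact hs (ofReal_injective (mul_left_cancel₀ I_ne_zero h1))
  filter_upwards [hc.eventually h] with s hs h0
  exact hs ((completedZetaLine_eq_zero_iff s).1 h0)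

theorem analyticAt_critical (t : ℝ) : AnalyticAt ℝ (fun t : ℝ => (1 / 2 + I * t : ℂ)) t :=
  analyticAt_const.add (analyticAt_const.mul (ofRealCLM.analyticAt t))

theorem analyticAt_deriv_riemannSiegelTheta (t : ℝ) :
    AnalyticAt ℝ (deriv riemannSiegelTheta) t := by
  have hopen : IsOpen {s : ℂ | 0 < s.re} := isOpen_lt continuous_const continuous_re
  have hd : DifferentiableOn ℂ Gamma {s : ℂ | 0 < s.re} := fun s hs =>
    (differentiableAt_Gamma s fun m hm => by
      have h : (0 : ℝ) < s.re := hs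
      rw [hm] at h
      simp only [neg_re, natCast_re] at h
      linarith [m.cast_nonneg (α := ℝ)]).differentiableWithinAt
  have hg : AnalyticAt ℂ digamma (1 / 4 + I * ((t : ℂ) / 2)) := by
    have hm := hopen.mem_nhds (quarter_line_re_pos t)
    have := (hd.analyticAt hm).deriv.div (hd.analyticAt hm)
      (Gamma_ne_zero_of_re_pos (quarter_line_re_pos t))
    rwa [digamma_def]
  have hl : AnalyticAt ℝ (fun t : ℝ => (1 / 4 + I * ((t : ℂ) / 2) : ℂ)) t :=
    analyticAt_const.add (analyticAt_const.mul ((ofRealCLM.analyticAt t).div_const))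
  have h1 : AnalyticAt ℝ (fun t : ℝ => digamma (1 / 4 + I * ((t : ℂ) / 2))) t :=
    AnalyticAt.comp (g := digamma) (f := fun t : ℝ => (1 / 4 + I * ((t : ℂ) / 2) : ℂ)) (x := t)
      hg.restrictScalars hl
  have h2 : AnalyticAt ℝ (fun t : ℝ => (digamma (1 / 4 + I * ((t : ℂ) / 2))).re) t :=
    (reCLM.analyticAt _).comp h1
  rw [funext fun t => (hasDerivAt_riemannSiegelTheta t).deriv]
  exact analyticAt_const.add (analyticAt_const.mul h2)

theorem analyticAt_riemannZeta_div_deriv (t : ℝ) :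
    AnalyticAt ℂ (fun z => riemannZeta z / deriv riemannZeta z) (1 / 2 + I * t) := by
  by_cases h : completedZetaLine t = 0
  · exact (exists_hasDerivAt_div_deriv (analyticAt_riemannZeta_critical t)
      ((completedZetaLine_eq_zero_iff t).1 h) (not_eventually_riemannZeta_eq_zero t)).1
  · exact (analyticAt_riemannZeta_critical t).div (analyticAt_riemannZeta_critical t).deriv
      (deriv_riemannZeta_critical_ne_zero h)

theorem analyticOnNhd_kappaPhase : AnalyticOnNhd ℝ kappaPhase univ := fun t _ => by
  have h1 : AnalyticAt ℝ (fun t : ℝ =>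
      riemannZeta (1 / 2 + I * t) / deriv riemannZeta (1 / 2 + I * t)) t :=
    AnalyticAt.comp (g := fun z => riemannZeta z / deriv riemannZeta z)
      (f := fun t : ℝ => (1 / 2 + I * t : ℂ)) (x := t)
      (analyticAt_riemannZeta_div_deriv t).restrictScalars (analyticAt_critical t)
  have h2 : AnalyticAt ℝ (fun t : ℝ => ((deriv riemannSiegelTheta t : ℝ) : ℂ)) t :=
    (ofRealCLM.analyticAt _).comp (analyticAt_deriv_riemannSiegelTheta t)
  exact analyticAt_const.add ((analyticAt_const.mul h2).mul h1)

theorem completedZetaLineTwist_zero : completedZetaLineTwist 0 = 0 := by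
  have := completedZetaLineTwist_neg 0
  rw [neg_zero] at this
  linarith

/-- The twist is odd and vanishes at 0, so (-x + iy)/(x + iy) reduces to -x/x; this is compatible
with κ(0) = -1/2. -/
theorem kappaPhase_zero : kappaPhase 0 = -1 := by
  obtain ⟨t₀, h0, hD, hR, -⟩ := exists_turning_point
  have hR0 := hR 0 (by simpa using h0.le)
  have hD0 := deriv_riemannSiegelTheta_neg_of_lt (t := 0) hD (by simpa using h0)
  have h := kappaPhase_mul 0 (deriv_riemannZeta_critical_ne_zero hR0.ne)
  rw [completedZetaLineTwist_zero, ofReal_zero, mul_zero, add_zero, add_zero, ← neg_one_mul] at h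
  exact mul_right_cancel₀ (ofReal_ne_zero.2 (mul_ne_zero hD0.ne hR0.ne)) h

theorem kappaPhase_eq_one_iff (t : ℝ) :
    kappaPhase t = 1 ↔ deriv riemannSiegelTheta t = 0 ∨ completedZetaLine t = 0 := by
  rw [kappaPhase, add_eq_left, mul_eq_zero, mul_eq_zero, div_eq_zero_iff, ofReal_eq_zero,
    ← completedZetaLine_eq_zero_iff]
  constructor
  · rintro ((h | h) | h | h)
    · simp at h
    · exact Or.inl h
    · exact Or.inr h
    · exact Or.inr (by_contra fun hR => deriv_riemannZeta_critical_ne_zero hR h)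
  · rintro (h | h)
    · exact Or.inl (Or.inr h)
    · exact Or.inr (Or.inl h)

/-- `k` is the multiplicity of the zero, where ζ/ζ' has derivative 1/k; the term with ϑ'' drops out
because ζ/ζ' vanishes. Multiple zeros are thus harmless. -/
theorem hasDerivAt_kappaPhase_of_zero {t : ℝ} (ht : completedZetaLine t = 0) :
    ∃ k : ℕ, 0 < k ∧ HasDerivAt kappaPhase (2 * I * (deriv riemannSiegelTheta t : ℝ) / k) t := by
  have hz := (completedZetaLine_eq_zero_iff t).1 ht
  obtain ⟨-, k, hk, hd⟩ := exists_hasDerivAt_div_deriv (analyticAt_riemannZeta_critical t)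
      hz (not_eventually_riemannZeta_eq_zero t)
  refine ⟨k, hk, ?_⟩
  have h1 : HasDerivAt (fun t : ℝ =>
      riemannZeta (1 / 2 + I * t) / deriv riemannZeta (1 / 2 + I * t)) (1 / k * I) t :=
    HasDerivAt.comp (h₂ := fun z => riemannZeta z / deriv riemannZeta z)
      (h := fun t : ℝ => (1 / 2 + I * t : ℂ)) t hd (hasDerivAt_critical t)
  have h2 := (analyticAt_deriv_riemannSiegelTheta t).differentiableAt.hasDerivAt.ofReal_comp
  refine (((h2.const_mul 2).mul h1).const_add 1).congr_deriv ?_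
  rw [hz]
  simp only [zero_div, mul_zero, zero_add]
  ring

theorem continuous_completedZetaLineTwist : Continuous completedZetaLineTwist := by
  have h : completedZetaLineTwist = fun t : ℝ =>
      -(Gammaℝ (1 / 2 + I * t) * deriv riemannZeta (1 / 2 + I * t)).im := by
    funext t; rw [Gammaℝ_mul_deriv_riemannZeta]; simp
  rw [h]
  refine (continuous_im.comp (continuous_iff_continuousAt.2 fun t => ?_)).neg
  refine ContinuousAt.mul ?_ ?_
  · exact ContinuousAt.comp (g := Gammaℝ) (f := fun t : ℝ => (1 / 2 + I * t : ℂ))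
      (hasDerivAt_Gammaℝ (by rw [critical_re]; norm_num)).continuousAt
      (hasDerivAt_critical t).continuousAt
  · exact ContinuousAt.comp (g := deriv riemannZeta) (f := fun t : ℝ => (1 / 2 + I * t : ℂ))
      (analyticAt_riemannZeta_critical t).deriv.continuousAt (hasDerivAt_critical t).continuousAt

theorem eventually_sides_of_deriv_pos {f : ℝ → ℝ} {x : ℝ} (hf : 0 < deriv f x) :
    (∀ᶠ t in 𝓝[<] x, f t < f x) ∧ ∀ᶠ t in 𝓝[>] x, f x < f t := by
  have hd : HasDerivAt f (deriv f x) x :=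
    (differentiableAt_of_deriv_ne_zero hf.ne').hasDerivAt
  have h1 := (hasDerivAt_iff_tendsto_slope.1 hd).eventually_const_lt hf
  constructor
  · have h2 := h1.filter_mono (nhdsWithin_mono x fun t (ht : t < x) => ht.ne)
    filter_upwards [h2, self_mem_nhdsWithin] with t ht htx
    rw [slope_def_field] at ht
    have := mul_neg_of_pos_of_neg ht (sub_neg.2 htx)
    rw [div_mul_cancel₀ _ (sub_neg.2 htx).ne] at this
    linarith
  · have h2 := h1.filter_mono (nhdsWithin_mono x fun t (ht : x < t) => ht.ne')
    filter_upwards [h2, self_mem_nhdsWithin] with t ht htx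
    rw [slope_def_field] at ht
    have := (div_pos_iff_of_pos_right (sub_pos.2 htx)).1 ht
    linarith

/-! ### The values of κ at the turning point and at the zeros. -/

namespace IsKappa

variable {κ : ℝ → ℝ}

theorem differentiable (h : IsKappa κ) : Differentiable ℝ κ := fun t =>
  (h.analytic t trivial).differentiableAt

theorem continuous (h : IsKappa κ) : Continuous κ := h.differentiable.continuous

theorem exp_eq_kappaPhase (h : IsKappa κ) (t : ℝ) :
    cexp (2 * Real.pi * I * κ t) = kappaPhase t := h.exp_eq t

theorem sin_eq (h : IsKappa κ) (t : ℝ) : Real.sin (2 * Real.pi * κ t) = (kappaPhase t).im := by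
  rw [← h.exp_eq_kappaPhase, show 2 * Real.pi * I * κ t = ((2 * Real.pi * κ t : ℝ) : ℂ) * I by
    push_cast; ring, exp_ofReal_mul_I_im]

theorem exists_int_iff (h : IsKappa κ) (t : ℝ) :
    (∃ n : ℤ, κ t = n) ↔ deriv riemannSiegelTheta t = 0 ∨ completedZetaLine t = 0 := by
  rw [← exp_two_pi_I_mul_eq_one_iff, h.exp_eq_kappaPhase, kappaPhase_eq_one_iff]

theorem deriv_pos_of_zero (h : IsKappa κ) {t : ℝ} (ht : completedZetaLine t = 0)
    (hD : 0 < deriv riemannSiegelTheta t) : 0 < deriv κ t := by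
  obtain ⟨k, hk, hd⟩ := hasDerivAt_kappaPhase_of_zero ht
  have h1 : HasDerivAt (fun t => cexp (2 * Real.pi * I * κ t))
      (cexp (2 * Real.pi * I * κ t) * (2 * Real.pi * I * (deriv κ t : ℝ))) t :=
    ((h.differentiable t).hasDerivAt.ofReal_comp.const_mul _).cexp
  have h2 := h1.unique (hd.congr_of_eventuallyEq (Eventually.of_forall h.exp_eq_kappaPhase))
  rw [h.exp_eq_kappaPhase, (kappaPhase_eq_one_iff t).2 (Or.inr ht), one_mul] at h2
  have hk0 : (0 : ℝ) < k := Nat.cast_pos.2 hk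
  have hkC : (k : ℂ) ≠ 0 := Nat.cast_ne_zero.2 hk.ne'
  have h3 : Real.pi * deriv κ t = deriv riemannSiegelTheta t / k := by
    have h4 : ((Real.pi * deriv κ t : ℝ) : ℂ) * (2 * I)
        = ((deriv riemannSiegelTheta t / k : ℝ) : ℂ) * (2 * I) := by
      push_cast
      linear_combination h2
    exact ofReal_injective (mul_right_cancel₀ (by simp) h4)
  have h5 : 0 < Real.pi * deriv κ t := by rw [h3]; positivity
  exact pos_of_mul_pos_right h5 Real.pi_pos.le

/-- Near t₀ both R and its twist are negative, so sin 2πκ is a positive multiple of ϑ' and changes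
sign from negative to positive at t₀. Together with confinement to (-1, 0) on [0, t₀) this fixes the
value and the direction of crossing. -/
theorem turning_point (h : IsKappa κ) {t₀ : ℝ} (h0 : 0 < t₀)
    (hD : deriv riemannSiegelTheta t₀ = 0) (hR : ∀ t, |t| ≤ t₀ → completedZetaLine t < 0)
    (hB : completedZetaLineTwist t₀ < 0) : κ t₀ = 0 ∧ ∀ᶠ t in 𝓝[>] t₀, 0 < κ t := by
  have hpi := Real.pi_pos
  have hsin : ∀ᶠ t in 𝓝 t₀, ∃ c : ℝ, 0 < c ∧
      Real.sin (2 * Real.pi * κ t) = c * deriv riemannSiegelTheta t := by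
    filter_upwards [continuous_completedZetaLine.continuousAt.eventually_lt_const
      (hR t₀ (abs_of_pos h0).le), continuous_completedZetaLineTwist.continuousAt.eventually_lt_const
      hB] with t hRt hBt
    have h1 := im_kappaPhase_mul t (deriv_riemannZeta_critical_ne_zero hRt.ne)
    have hpos : 0 < (deriv riemannSiegelTheta t * completedZetaLine t) ^ 2
        + completedZetaLineTwist t ^ 2 := by
      have := sq_pos_of_neg hBt; positivity
    refine ⟨2 * (completedZetaLine t * completedZetaLineTwist t)
      / ((deriv riemannSiegelTheta t * completedZetaLine t) ^ 2 + completedZetaLineTwist t ^ 2),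
      div_pos (mul_pos two_pos (mul_pos_of_neg_of_neg hRt hBt)) hpos, ?_⟩
    rw [h.sin_eq, div_mul_eq_mul_div, eq_div_iff hpos.ne', h1]
    ring
  have hmem : ∀ t ∈ Ico 0 t₀, κ t ∈ Ioo (((-1 : ℤ) : ℝ)) ((-1 : ℤ) + 1) := by
    refine mem_Ioo_of_forall_ne_int ordConnected_Ico h.continuous.continuousOn (fun t ht n hn => ?_)
      (left_mem_Ico.2 h0) ?_
    · have habs : |t| = t := abs_of_nonneg ht.1
      rcases (h.exists_int_iff t).1 ⟨n, hn⟩ with h' | h'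
      · exact (deriv_riemannSiegelTheta_neg_of_lt hD (by rw [habs]; exact ht.2)).ne h'
      · exact (hR t (by rw [habs]; exact ht.2.le)).ne h'
    · rw [h.map_zero]; norm_num
  have hleft : ∀ᶠ t in 𝓝[<] t₀, κ t ∈ Icc (-(1 / 2)) 0 := by
    filter_upwards [Ioo_mem_nhdsLT h0, hsin.filter_mono nhdsWithin_le_nhds] with t ht hs
    obtain ⟨c, hc, hs⟩ := hs
    obtain ⟨l, r⟩ := hmem t ⟨ht.1.le, ht.2⟩
    push_cast at l r
    have hDt := deriv_riemannSiegelTheta_neg_of_lt (t := t) hD (by rw [abs_of_pos ht.1]; exact ht.2)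
    refine ⟨?_, by linarith⟩
    -- On (-1, -1/2) the sine of 2πκ would be nonnegative, whereas ϑ' < 0 here. This excludes the
    -- integer -1 as the limit at t₀.
    by_contra! hlt
    have h1 : 0 ≤ Real.sin (2 * Real.pi * κ t + 2 * Real.pi) :=
      Real.sin_nonneg_of_nonneg_of_le_pi (by nlinarith) (by nlinarith)
    rw [Real.sin_add_two_pi, hs] at h1
    nlinarith
  have hval : κ t₀ ∈ Icc (-(1 / 2) : ℝ) 0 :=
    isClosed_Icc.mem_of_tendsto (h.continuous.continuousAt.tendsto.mono_left nhdsWithin_le_nhds)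
      hleft
  obtain ⟨n, hn⟩ := (h.exists_int_iff t₀).2 (Or.inl hD)
  have hn0 : n = 0 := by
    rw [hn] at hval
    have h1 : (-1 : ℝ) < n := by linarith [hval.1]
    have h2 : n ≤ 0 := by exact_mod_cast hval.2
    have h3 : -1 < n := by exact_mod_cast h1
    omega
  rw [hn0, Int.cast_zero] at hn
  refine ⟨hn, ?_⟩
  have hnear : ∀ᶠ t in 𝓝 t₀, -(1 / 2) < κ t :=
    h.continuous.continuousAt.eventually_const_lt (by rw [hn]; norm_num)
  filter_upwards [self_mem_nhdsWithin, hsin.filter_mono nhdsWithin_le_nhds,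
    hnear.filter_mono nhdsWithin_le_nhds] with t ht hs hk
  obtain ⟨c, hc, hs⟩ := hs
  have htpos : 0 < t := h0.trans ht
  have hDt := deriv_riemannSiegelTheta_pos_of_lt (t := t) h0 hD (by rw [abs_of_pos htpos]; exact ht)
  by_contra! hle
  have h1 : Real.sin (2 * Real.pi * κ t) ≤ 0 :=
    Real.sin_nonpos_of_nonpos_of_neg_pi_le (by nlinarith) (by nlinarith)
  rw [hs] at h1
  have := mul_pos hc hDt
  linarith

theorem next_zero (h : IsKappa κ) {t₀ p q : ℝ} (h0 : 0 < t₀) (hD : deriv riemannSiegelTheta t₀ = 0)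
    (hp0 : t₀ ≤ p) (hpq : p < q) {m : ℤ} (hp : κ p = m) (hpr : ∀ᶠ t in 𝓝[>] p, m < κ t)
    (hne : ∀ t ∈ Ioo p q, completedZetaLine t ≠ 0) (hq : completedZetaLine q = 0) :
    κ q = m + 1 ∧ ∀ᶠ t in 𝓝[>] q, m + 1 < κ t := by
  have hDpos : ∀ t, p < t → 0 < deriv riemannSiegelTheta t := fun t ht =>
    deriv_riemannSiegelTheta_pos_of_lt h0 hD
      (by rw [abs_of_pos (h0.trans (hp0.trans_lt ht))]; exact hp0.trans_lt ht)
  obtain ⟨hl, hr⟩ := eventually_sides_of_deriv_pos (h.deriv_pos_of_zero hq (hDpos q hpq))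
  obtain ⟨j, hj⟩ := (h.exists_int_iff q).2 (Or.inr hq)
  have hval : κ q = m + 1 := by
    refine eq_add_one_of_forall_ne_int h.continuous hpq hp hpr (fun t ht n hn => ?_) hj
      (by simpa [hj] using hl)
    rcases (h.exists_int_iff t).1 ⟨n, hn⟩ with h' | h'
    · exact (hDpos t ht.1).ne' h'
    · exact hne t ht h'
  exact ⟨hval, by simpa [hval] using hr⟩

end IsKappa

theorem exists_isKappa : ∃ κ : ℝ → ℝ, IsKappa κ := by
  obtain ⟨κ, h1, h2, h3⟩ := exists_analytic_lift analyticOnNhd_kappaPhase norm_kappaPhase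
    (x := -1 / 2) (by
      rw [kappaPhase_zero, show (2 * Real.pi * I * ((-1 / 2 : ℝ) : ℂ)) = -(Real.pi * I) by
        push_cast; ring, exp_neg, exp_pi_mul_I]
      norm_num)
  exact ⟨κ, h1, h2, h3⟩

theorem IsKappa.unique {κ₁ κ₂ : ℝ → ℝ} (h1 : IsKappa κ₁) (h2 : IsKappa κ₂) : κ₁ = κ₂ :=
  eq_of_exp_eq h1.differentiable h2.differentiable
    (fun t => by rw [h1.exp_eq_kappaPhase, h2.exp_eq_kappaPhase]) (by rw [h1.map_zero, h2.map_zero])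

/-- Hardy's theorem makes the set nonempty, isolation of zeros keeps its infimum above the previous
term, and closedness of the zero set makes the infimum a zero. -/
theorem criticalOrdinate_succ_spec (n : ℕ) : criticalOrdinate n < criticalOrdinate (n + 1) ∧
    completedZetaLine (criticalOrdinate (n + 1)) = 0 ∧
    ∀ t ∈ Ioo (criticalOrdinate n) (criticalOrdinate (n + 1)), completedZetaLine t ≠ 0 := by
  set c := criticalOrdinate n
  set S : Set ℝ := {t : ℝ | c < t ∧ riemannZeta (1 / 2 + I * t) = 0} with hS
  have hmemS : ∀ t, t ∈ S ↔ c < t ∧ completedZetaLine t = 0 := fun t => by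
    rw [completedZetaLine_eq_zero_iff]; rfl
  have hc : criticalOrdinate (n + 1) = sInf S := rfl
  have hne : S.Nonempty := by
    obtain ⟨t, ht⟩ := exists_completedZetaLine_zero_gt c
    exact ⟨t, (hmemS t).2 ht⟩
  have hbdd : BddBelow S := ⟨c, fun t ht => ht.1.le⟩
  have hlt : c < sInf S := by
    have h1 := (eventually_completedZetaLine_ne_zero c).filter_mono
      (nhdsWithin_mono c fun t (ht : c < t) => ht.ne')
    obtain ⟨d, hd, hd'⟩ := mem_nhdsGT_iff_exists_Ioo_subset.1 h1
    refine (show c < d from hd).trans_le (le_csInf hne fun t ht => ?_)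
    by_contra! htd
    exact hd' ⟨ht.1, htd⟩ ((hmemS t).1 ht).2
  have hzero : completedZetaLine (sInf S) = 0 := by
    have hcl := csInf_mem_closure hne hbdd
    have hsub : closure S ⊆ {t | completedZetaLine t = 0} :=
      closure_minimal (fun t ht => ((hmemS t).1 ht).2)
        (isClosed_eq continuous_completedZetaLine continuous_const)
    exact hsub hcl
  rw [hc]
  exact ⟨hlt, hzero, fun t ht h0 => (csInf_le hbdd ((hmemS t).2 ⟨ht.1, h0⟩)).not_gt ht.2⟩

/-- The induction carries the upward exit along with the value. Its base starts from t₀, where κ =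
0, and not from the auxiliary ordinate 0, where κ = -1/2. -/
theorem IsKappa.map_criticalOrdinate_succ {κ : ℝ → ℝ} (h : IsKappa κ) {t₀ : ℝ} (h0 : 0 < t₀)
    (hD : deriv riemannSiegelTheta t₀ = 0) (hR : ∀ t, |t| ≤ t₀ → completedZetaLine t < 0)
    (hB : completedZetaLineTwist t₀ < 0) (n : ℕ) : t₀ < criticalOrdinate (n + 1) ∧
      κ (criticalOrdinate (n + 1)) = ((n + 1 : ℕ) : ℤ) ∧
      ∀ᶠ t in 𝓝[>] criticalOrdinate (n + 1), (((n + 1 : ℕ) : ℤ) : ℝ) < κ t := by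
  induction n with
  | zero =>
    obtain ⟨hlt, hz, hne⟩ := criticalOrdinate_succ_spec 0
    have hc0 : criticalOrdinate 0 = 0 := rfl
    rw [hc0] at hlt hne
    have ht : t₀ < criticalOrdinate (0 + 1) := by
      by_contra! hle
      exact (hR _ (by rw [abs_of_pos hlt]; exact hle)).ne hz
    obtain ⟨e, hr⟩ := h.turning_point h0 hD hR hB
    have := h.next_zero (m := 0) h0 hD le_rfl ht (by simpa using e) (by simpa using hr)
      (fun t hts => hne t ⟨h0.trans hts.1, hts.2⟩) hz
    exact ⟨ht, by simpa using this⟩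
  | succ n ih =>
    obtain ⟨hlt, hz, hne⟩ := criticalOrdinate_succ_spec (n + 1)
    have := h.next_zero h0 hD ih.1.le hlt ih.2.1 ih.2.2 hne hz
    exact ⟨ih.1.trans hlt, by simpa using this⟩

theorem proposition17 :
    (∃! κ : ℝ → ℝ, IsKappa κ) ∧
      ∀ κ : ℝ → ℝ, IsKappa κ → ∀ n : ℕ, 1 ≤ n → κ (criticalOrdinate n) = n := by
  obtain ⟨κ₀, h₀⟩ := exists_isKappa
  refine ⟨⟨κ₀, h₀, fun κ h => h.unique h₀⟩, fun κ h n hn => ?_⟩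
  obtain ⟨t₀, h0, hD, hR, hB⟩ := exists_turning_point
  obtain ⟨m, rfl⟩ := Nat.exists_eq_add_of_le' hn
  simpa using (h.map_criticalOrdinate_succ h0 hD hR hB m).2.1
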